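/- **Theorem.** Let $p$ be a prime and $c'\in\mathbf{Z}_p$. Let $\mathrm{Vir}$ be the Virasoro Lie ring over $\mathbf{Z}_p$ with quasicentral charge $c'$, that is, the free $\mathbf{Z}_p$-module on $L(n)$ $(n\in\mathbf{Z})$ and a central element $\kappa$, with $$[L(m),L(n)]=(m-n)L(m+n)+\delta_{m+n,0}\tbinom{m+1}{3}c'\kappa .$$ Let $W$ be the highest weight module over $\mathbf{Z}_p$ generated by a state $v_0$ with $L(n)v_0=0$ for all $n\ge 0$ and $\kappa v_0=v_0$ (the enveloping algebra of $\mathrm{Vir}$ modulo the left ideal generated by $L(n)$, $n\geq 0$, and $\kappa-1$), let $W_1\subseteq W$ be the $\mathrm{Vir}$-submodule generated by $L(-1)v_0$, and put $V=W/W_1$, $\mathbf{1}=v_0+W_1$, $\omega=L(-2)\mathbf{1}$. Then there is a unique structure $Y$ of algebraic vertex algebra over $\mathbf{Z}_p$ on $V$ with vacuum vector $\mathbf{1}$ such that $Y(\omega,z)=\sum_{n\in\mathbf{Z}}L(n)z^{-n-2}$ (the Virasoro vertex algebra over $\mathbf{Z}_p$). Let $V'=\varprojlim_k V/p^kV$,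 let the modes of $V'$ act componentwise, $(u_k)_k(n)(w_k)_k=(u_k(n)w_k)_k$, and extend them $\mathbf{Q}_p$-bilinearly to $V'[1/p]=\mathbf{Q}_p\otimes_{\mathbf{Z}_p}V'$, which carries the gauge $|x|=\inf\{|a| : a\in\mathbf{Q}_p,\ x\in a\cdot \mathrm{im}(V')\}$. Then: 1. The maps $V\to V'\to V'[1/p]$ are injective, and the image of $V'$ is the closed unit ball of $V'[1/p]$. 2. $(V'[1/p],Y,\mathbf{1},\omega)$ is a $p$-adic vertex operator algebra of central charge $c=2c'$. This means the following. * $V'[1/p]$ is a $p$-adic Banach space: its gauge is an ultrametric norm with values in $|\mathbf{Q}_p|$, and it is complete. * Each $Y(a,z)=\sum_n a(n)z^{-n-1}$ is a $p$-adic field: $|a(n)b|\le M|a||b|$ for all $n$ and $b$, with $M$ depending only on $a$, and $a(n)b\to0$ as $n\to\infty$ for every $b$. The map $a\mapsto Y(a,z)$ is continuous for the norm $|Y(a,z)|=\sup_n|a(n)|$. * $|\mathbf{1}|\le1$; $a(-1)\mathbf{1}=a$, and $a(n)\mathbf{1}=0$ for $n\ge0$. * For all $r,s,t\in\mathbf{Z}$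 and all $u,v,w$ the two sides of the Jacobi identity converge and are equal: $$\sum_{i\ge0}\tbinom ri (u(t+i)v)(r+s-i)w=\sum_{i\ge0}(-1)^i\tbinom ti\bigl(u(r+t-i)v(s+i)w-(-1)^tv(s+t-i)u(r+i)w\bigr).$$ * The operators $L(n)=\omega(n+1)$ satisfy $[L(m),L(n)]=(m-n)L(m+n)+\delta_{m+n,0}\tfrac{m^3-m}{12}c\,\mathrm{id}$ and $[L(-1),Y(v,z)]=\partial_zY(v,z)$. * The eigenspaces $\{x\mid L(0)x=kx\}$ for $k\in\mathbf{Z}$ are finite-dimensional over $\mathbf{Q}_p$ and vanish for all sufficiently negative $k$, and their sum is dense. 3. $V$ is the sum of its eigenspaces $V_{(k)}=\{v\in V\mid L(0)v=kv\}$, $k\in\mathbf{Z}$, and the integral $L(0)$-eigenspaces of the completion are exactly those of $V$: for every $k\in\mathbf{Z}$, $\{x\in V'\mid L(0)x=kx\}=V_{(k)}$ and $\{x\in V'[1/p]\mid L(0)x=kx\}=\mathbf{Q}_p\cdot V_{(k)}$. -/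

import Mathlib

open scoped TensorProduct Topology

noncomputable section

/-! ## Algebraic vertex algebras over a commutative ring -/

/-- A family of `n`-th products on an `R`-module: `Y n u v` is `u(n)v`, so that `Y` encodes the
linear map `u ↦ Y(u, z) = ∑ₙ u(n) z^{-n-1}` from `V` to `End(V)[[z, z⁻¹]]`. -/
abbrev ModeMap (R V : Type*) [CommRing R] [AddCommGroup V] [Module R V] : Type _ :=
  ℤ → V →ₗ[R] V →ₗ[R] V

section Jacobi

variable {R V : Type*} [CommRing R] [AddCommGroup V] [Module R V]

/-- The `i`-th term of the left-hand side of the Jacobi identity. -/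
def jacobiLeft (Y : ModeMap R V) (r s t : ℤ) (u v w : V) (i : ℕ) : V :=
  (Ring.choose r i : ℤ) • Y (r + s - i) (Y (t + i) u v) w

/-- The `i`-th term of the right-hand side of the Jacobi identity. -/
def jacobiRight (Y : ModeMap R V) (r s t : ℤ) (u v w : V) (i : ℕ) : V :=
  ((-1) ^ i * Ring.choose t i : ℤ) •
    (Y (r + t - i) u (Y (s + i) v w) -
      (t.negOnePow : ℤ) • Y (s + t - i) v (Y (r + i) u w))

/-- `(V, Y, 𝟏)` is an algebraic vertex algebra over `R`. By truncation, the sums in the Jacobi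
identity have finite support. -/
structure IsVertexAlgebra (Y : ModeMap R V) (vac : V) : Prop where
  truncation : ∀ u v : V, ∃ n₀ : ℤ, ∀ n : ℤ, n₀ < n → Y n u v = 0
  creative : ∀ u : V, Y (-1) u vac = u
  creative_nonneg : ∀ (u : V) (n : ℤ), 0 ≤ n → Y n u vac = 0
  jacobi : ∀ (r s t : ℤ) (u v w : V),
    ∑ᶠ i : ℕ, jacobiLeft Y r s t u v w i = ∑ᶠ i : ℕ, jacobiRight Y r s t u v w i

end Jacobi

/-! ## `p`-adic vertex operator algebras

A `p`-adic Banach space is treated as a semi-normed `ℚ_[p]`-space which satisfies the predicate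
`IsPAdicBanach`; that predicate includes the statement that the semi-norm is a norm. -/

section PAdic

variable (p : ℕ) [Fact p.Prime] (E : Type*) [SeminormedAddCommGroup E] [NormedSpace ℚ_[p] E]

/-- `E` is a `p`-adic Banach space: its semi-norm is a norm, it is complete and ultrametric, and
all norms of vectors are norms of scalars. -/
structure IsPAdicBanach : Prop where
  eq_zero : ∀ x : E, ‖x‖ = 0 → x = 0
  complete : CompleteSpace E
  ultrametric : ∀ x y : E, ‖x + y‖ ≤ max ‖x‖ ‖y‖
  norm_mem : ∀ x : E, x ≠ 0 → ∃ n : ℤ, ‖x‖ = (p : ℝ) ^ n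

variable {p E}

/-- The modes `a n` form a `p`-adic field on `E` associated to the state `x`. The first
condition includes the continuity of every mode. -/
structure IsPAdicField (x : E) (a : ℤ → E →ₗ[ℚ_[p]] E) : Prop where
  bounded : ∃ M : ℝ, 0 ≤ M ∧ ∀ (n : ℤ) (b : E), ‖a n b‖ ≤ M * ‖x‖ * ‖b‖
  tendsto : ∀ b : E, Filter.Tendsto (fun n : ℤ => a n b) Filter.atTop (𝓝 0)

/-- The sup-norm of a `p`-adic field: the supremum over `n` of the operator norms of the modes
`a n`. -/
def fieldNorm (a : ℤ → E →ₗ[ℚ_[p]] E) : ℝ :=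
  ⨆ n : ℤ, ⨆ b : E, ‖a n b‖ / ‖b‖

/-- `(E, Y, 𝟏)` is a `p`-adic vertex algebra. -/
structure IsPAdicVertexAlgebra (Y : ModeMap ℚ_[p] E) (vac : E) : Prop where
  banach : IsPAdicBanach p E
  field : ∀ a : E, IsPAdicField a (fun n => Y n a)
  /-- Continuity of the state-field correspondence for the sup-norm on `p`-adic fields. -/
  continuous : ∀ a : E, ∀ ε : ℝ, 0 < ε → ∃ δ : ℝ, 0 < δ ∧
    ∀ b : E, ‖b - a‖ < δ → fieldNorm (fun n => Y n b - Y n a) < ε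
  vac_norm : ‖vac‖ ≤ 1
  creative : ∀ a : E, Y (-1) a vac = a
  creative_nonneg : ∀ (a : E) (n : ℤ), 0 ≤ n → Y n a vac = 0
  jacobi : ∀ (r s t : ℤ) (u v w : E), ∃ S : E,
    HasSum (jacobiLeft Y r s t u v w) S ∧ HasSum (jacobiRight Y r s t u v w) S

/-- The operator `L(n) = ω(n + 1)`, where `Y(ω, z) = ∑ₙ L(n) z^{-n-2}`. -/
def conformalMode (Y : ModeMap ℚ_[p] E) (ω : E) (n : ℤ) : Module.End ℚ_[p] E :=
  Y (n + 1) ω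

/-- `(E, Y, 𝟏, ω)` is a weakly conformal `p`-adic vertex algebra of central charge `c`. -/
structure IsWeaklyConformal (Y : ModeMap ℚ_[p] E) (vac ω : E) (c : ℚ_[p]) : Prop where
  vertexAlgebra : IsPAdicVertexAlgebra Y vac
  virasoro : ∀ m n : ℤ,
    conformalMode Y ω m * conformalMode Y ω n - conformalMode Y ω n * conformalMode Y ω m =
      ((m - n : ℤ) : ℚ_[p]) • conformalMode Y ω (m + n) +
        (if m + n = 0 then ((m ^ 3 - m : ℤ) : ℚ_[p]) / 12 * c else 0) • 1
  /-- `[L(-1), Y(v, z)] = ∂_z Y(v, z)`, coefficientwise. -/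
  translation : ∀ (v w : E) (n : ℤ),
    conformalMode Y ω (-1) (Y n v w) - Y n v (conformalMode Y ω (-1) w) =
      ((-n : ℤ) : ℚ_[p]) • Y (n - 1) v w

/-- The eigenspace `{v | L(0) v = k v}` for an integer `k`. -/
def weightSpace (Y : ModeMap ℚ_[p] E) (ω : E) (k : ℤ) : Submodule ℚ_[p] E :=
  Module.End.eigenspace (conformalMode Y ω 0) (k : ℚ_[p])

/-- `(E, Y, 𝟏, ω)` is a conformal `p`-adic vertex algebra of central charge `c`. -/
structure IsConformal (Y : ModeMap ℚ_[p] E) (vac ω : E) (c : ℚ_[p]) : Prop where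
  weaklyConformal : IsWeaklyConformal Y vac ω c
  finite : ∀ k : ℤ, FiniteDimensional ℚ_[p] (weightSpace Y ω k)
  bounded_below : ∃ t : ℤ, ∀ k : ℤ, k < t → weightSpace Y ω k = ⊥

/-- `(E, Y, 𝟏, ω)` is a `p`-adic vertex operator algebra of central charge `c`: it is conformal,
and it is the completion of the sum of its integral `L(0)`-eigenspaces. -/
structure IsPAdicVOA (Y : ModeMap ℚ_[p] E) (vac ω : E) (c : ℚ_[p]) : Prop where
  conformal : IsConformal Y vac ω c
  dense : Dense ((⨆ k : ℤ, weightSpace Y ω k : Submodule ℚ_[p] E) : Set E)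

end PAdic

/-! ## The Virasoro Lie ring and the Virasoro Fock space -/

section Virasoro

variable (R : Type*) [CommRing R] (c' : R)

/-- The Virasoro Lie algebra over `R` with quasicentral charge `c'`. The element `(x, a)` stands
for `∑ₙ xₙ L(n) + a κ`. -/
def VirasoroAlgebra (_c' : R) : Type _ := (ℤ →₀ R) × R

namespace VirasoroAlgebra

instance : AddCommGroup (VirasoroAlgebra R c') := inferInstanceAs (AddCommGroup ((ℤ →₀ R) × R))
instance : Module R (VirasoroAlgebra R c') := inferInstanceAs (Module R ((ℤ →₀ R) × R))

variable {R}

/-- The basis element `L(n)`. -/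
def L (n : ℤ) : VirasoroAlgebra R c' := (Finsupp.single n 1, 0)

/-- The central basis element `κ`. -/
def kappa : VirasoroAlgebra R c' := (0, 1)

/-- The value `(m - n) L(m + n) + δ_{m+n,0} binom(m+1, 3) c' κ` of the bracket of `L(m)` and
`L(n)`. -/
def bracketLL (m n : ℤ) : VirasoroAlgebra R c' :=
  ((m - n : ℤ) : R) • L c' (m + n) +
    (if m + n = 0 then ((Ring.choose (m + 1) 3 : ℤ) : R) * c' else 0) • kappa c'

/-- The bilinear map on `⨁ₙ R L(n)` with values `bracketLL` on basis elements. -/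
def bracketAux : (ℤ →₀ R) →ₗ[R] (ℤ →₀ R) →ₗ[R] VirasoroAlgebra R c' :=
  Finsupp.linearCombination R fun m => Finsupp.linearCombination R fun n => bracketLL c' m n

instance : Bracket (VirasoroAlgebra R c') (VirasoroAlgebra R c') :=
  ⟨fun x y => bracketAux c' x.1 y.1⟩

theorem lie_def (x y : VirasoroAlgebra R c') : ⁅x, y⁆ = bracketAux c' x.1 y.1 := rfl

theorem bracketAux_single (m n : ℤ) (a b : R) :
    bracketAux c' (Finsupp.single m a) (Finsupp.single n b) = (a * b) • bracketLL c' m n := by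
  simp [bracketAux, Finsupp.linearCombination_single, mul_smul]

theorem six_mul_choose (m : ℤ) : 6 * Ring.choose (m + 1) 3 = (m + 1) * m * (m - 1) := by
  have h := Ring.descPochhammer_eq_factorial_smul_choose (m + 1) 3
  rw [show Nat.factorial 3 = 6 from rfl, ← Polynomial.eval_eq_smeval, nsmul_eq_mul] at h
  simp [descPochhammer_succ_right] at h
  rw [← h]
  ring

theorem choose_neg (m n : ℤ) (h : m + n = 0) :
    Ring.choose (n + 1) 3 = -Ring.choose (m + 1) 3 := by
  have h1 := six_mul_choose m
  have h2 := six_mul_choose n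
  obtain rfl : n = -m := by omega
  have : 6 * Ring.choose (-m + 1) 3 = 6 * -Ring.choose (m + 1) 3 := by
    linear_combination h2 + h1
  exact mul_left_cancel₀ (by norm_num) this

theorem cocycle (m n k : ℤ) (h : m + n + k = 0) :
    (n - k) * Ring.choose (m + 1) 3 =
      (m - n) * Ring.choose (m + n + 1) 3 + (m - k) * Ring.choose (n + 1) 3 := by
  have h1 := six_mul_choose m
  have h2 := six_mul_choose n
  have h3 := six_mul_choose (m + n)
  obtain rfl : k = -m - n := by omega
  refine mul_left_cancel₀ (show (6 : ℤ) ≠ 0 by norm_num) ?_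
  linear_combination (n - (-m - n)) * h1 - (m - n) * h3 - (m - (-m - n)) * h2

theorem bracketLL_swap (m n : ℤ) : bracketLL c' n m = -bracketLL c' m n := by
  unfold bracketLL
  rw [add_comm n m, neg_add, ← neg_smul, ← neg_smul]
  congr 2
  · push_cast; ring
  · split_ifs with h
    · rw [choose_neg m n h]; push_cast; ring
    · simp

theorem bracketAux_swap (f g : ℤ →₀ R) : bracketAux c' g f = -bracketAux c' f g := by
  induction f using Finsupp.induction_linear with
  | zero => simp
  | add f₁ f₂ h₁ h₂ => simp only [map_add, LinearMap.add_apply, h₁, h₂, neg_add]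
  | single m a =>
    induction g using Finsupp.induction_linear with
    | zero => simp
    | add f₁ f₂ h₁ h₂ => simp only [map_add, LinearMap.add_apply, h₁, h₂, neg_add]
    | single n b =>
      rw [bracketAux_single, bracketAux_single, bracketLL_swap, smul_neg, mul_comm]

theorem bracketAux_self (f : ℤ →₀ R) : bracketAux c' f f = 0 := by
  induction f using Finsupp.induction_linear with
  | zero => simp
  | add f₁ f₂ h₁ h₂ =>
    simp only [map_add, LinearMap.add_apply, h₁, h₂, bracketAux_swap c' f₁ f₂]
    simp
  | single m a =>
    rw [bracketAux_single, bracketLL]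
    by_cases h : m = 0
    · subst h
      have h1 := six_mul_choose 0
      have h2 : Ring.choose (0 + 1 : ℤ) 3 = 0 := by simpa using h1
      rw [h2]; simp
    · rw [if_neg (by omega)]; simp

theorem bracketLL_fst (m n : ℤ) :
    (bracketLL c' m n).1 = Finsupp.single (m + n) ((m - n : ℤ) : R) := by
  change ((m - n : ℤ) : R) • Finsupp.single (m + n) (1 : R) + _ • (0 : ℤ →₀ R) = _
  simp

theorem bracketAux_jacobi (f g h : ℤ →₀ R) :
    bracketAux c' f (bracketAux c' g h).1 =
      bracketAux c' (bracketAux c' f g).1 h + bracketAux c' g (bracketAux c' f h).1 := by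
  have fa : ∀ x y : VirasoroAlgebra R c', (x + y).1 = x.1 + y.1 := fun _ _ => rfl
  have fs : ∀ (a : R) (x : VirasoroAlgebra R c'), (a • x).1 = a • x.1 := fun _ _ => rfl
  have fz : (0 : VirasoroAlgebra R c').1 = 0 := rfl
  induction f using Finsupp.induction_linear with
  | zero => simp [fz]
  | add f₁ f₂ h₁ h₂ => simp only [map_add, LinearMap.add_apply, fa, h₁, h₂]; abel
  | single m a =>
  induction g using Finsupp.induction_linear with
  | zero => simp [fz]
  | add f₁ f₂ h₁ h₂ => simp only [map_add, LinearMap.add_apply, fa, h₁, h₂]; abel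
  | single n b =>
  induction h using Finsupp.induction_linear with
  | zero => simp [fz]
  | add f₁ f₂ h₁ h₂ => simp only [map_add, fa, h₁, h₂]; abel
  | single k c =>
    simp only [bracketAux_single, fs, bracketLL_fst, Finsupp.smul_single, smul_eq_mul]
    unfold bracketLL
    rw [show m + (n + k) = m + n + k by ring, show n + (m + k) = m + n + k by ring]
    simp only [smul_add, smul_smul]
    rw [add_add_add_comm, ← add_smul, ← add_smul]
    congr 2
    · push_cast; ring
    · split_ifs with h0
      · have := congrArg (Int.cast : ℤ → R) (cocycle m n k h0)
        push_cast at this ⊢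
        linear_combination a * b * c * c' * this
      · simp

instance : LieRing (VirasoroAlgebra R c') where
  add_lie x y z := by
    change bracketAux c' (x.1 + y.1) z.1 = _
    rw [map_add, LinearMap.add_apply]; rfl
  lie_add x y z := by
    change bracketAux c' x.1 (y.1 + z.1) = _
    rw [map_add]; rfl
  lie_self x := bracketAux_self c' x.1
  leibniz_lie x y z := bracketAux_jacobi c' x.1 y.1 z.1

instance : LieAlgebra R (VirasoroAlgebra R c') where
  lie_smul t x y := by
    change bracketAux c' x.1 (t • y.1) = _
    rw [map_smul]; rfl

end VirasoroAlgebra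

/-- The enveloping algebra of the Virasoro Lie ring. -/
abbrev VirU : Type _ := UniversalEnvelopingAlgebra R (VirasoroAlgebra R c')

variable {R}

/-- The element `L(n)` of the enveloping algebra. -/
def envL (n : ℤ) : VirU R c' :=
  UniversalEnvelopingAlgebra.ι R (VirasoroAlgebra.L c' n)

/-- The element `κ` of the enveloping algebra. -/
def envK : VirU R c' :=
  UniversalEnvelopingAlgebra.ι R (VirasoroAlgebra.kappa c')

/-- The left ideal generated by `L(n)` for `n ≥ 0` and by `κ - 1`. -/
def vermaIdeal : Submodule (VirU R c') (VirU R c') :=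
  Submodule.span (VirU R c') (envL c' '' {n : ℤ | 0 ≤ n} ∪ {envK c' - 1})

/-- The highest weight module `W`, generated by a state `v₀` that is annihilated by all `L(n)`
with `n ≥ 0`, and on which `κ` acts as the identity. -/
abbrev VirW : Type _ := VirU R c' ⧸ vermaIdeal c'

/-- The generating state `v₀` of `W`. -/
def virV0 : VirW c' := Submodule.Quotient.mk 1

/-- The submodule `W₁` of `W` generated by `L(-1) v₀`. -/
def virW1 : Submodule (VirU R c') (VirW c') :=
  Submodule.span (VirU R c') {envL c' (-1) • virV0 c'}

/-- The Virasoro Fock space `V = W / W₁`. -/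
abbrev VirV : Type _ := VirW c' ⧸ virW1 c'

/-- The operator `L(n)` on the Virasoro Fock space. -/
def virL (n : ℤ) : Module.End R (VirV c') :=
  Algebra.lsmul R R (VirV c') (envL c' n)

/-- The vacuum vector `𝟏 = v₀ + W₁`. -/
def virVac : VirV c' := Submodule.Quotient.mk (virV0 c')

/-- The conformal vector `ω = L(-2) 𝟏`. -/
def virOmega : VirV c' := virL c' (-2) (virVac c')

/-- The eigenspace `{v | L(0) v = k v}` in the Virasoro Fock space, for an integer `k`. -/
def virWeightSpace (k : ℤ) : Submodule R (VirV c') :=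
  Module.End.eigenspace (virL c' 0) (k : R)

/-- `Y` is the vertex operator of the Virasoro vertex algebra on `V`: it makes `(V, Y, 𝟏)` an
algebraic vertex algebra, and `Y(ω, z) = ∑ₙ L(n) z^{-n-2}`. -/
structure IsVirasoroVertexOperator (Y : ModeMap R (VirV c')) : Prop where
  vertexAlgebra : IsVertexAlgebra Y (virVac c')
  omega : ∀ n : ℤ, Y (n + 1) (virOmega c') = virL c' n

end Virasoro

/-! ## Adic completion of bilinear products -/

section Completion

variable {R M : Type*} [CommRing R] [AddCommGroup M] [Module R M]

theorem smul_top_le_comap (J : Ideal R) (f : M →ₗ[R] M) :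
    (J • ⊤ : Submodule R M) ≤ (J • ⊤ : Submodule R M).comap f :=
  Submodule.smul_le.2 fun r hr m _ => by
    rw [Submodule.mem_comap, map_smul]
    exact Submodule.smul_mem_smul hr trivial

theorem apply_mem_smul_top (J : Ideal R) (B : M →ₗ[R] M →ₗ[R] M) (v : M) {u : M}
    (hu : u ∈ (J • ⊤ : Submodule R M)) : B u v ∈ (J • ⊤ : Submodule R M) :=
  smul_top_le_comap J (B.flip v) hu

/-- The bilinear product on `M / J M` induced by a bilinear product on `M`. -/
def quotientProduct (J : Ideal R) (B : M →ₗ[R] M →ₗ[R] M) :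
    (M ⧸ (J • ⊤ : Submodule R M)) →ₗ[R] (M ⧸ (J • ⊤ : Submodule R M)) →ₗ[R]
      (M ⧸ (J • ⊤ : Submodule R M)) :=
  Submodule.liftQ _
    { toFun := fun u => Submodule.mapQ _ _ (B u) (smul_top_le_comap J (B u))
      map_add' := fun u v => by
        apply Submodule.linearMap_qext
        ext w
        simp
      map_smul' := fun r u => by
        apply Submodule.linearMap_qext
        ext w
        simp }
    (fun u hu => by
      rw [LinearMap.mem_ker]
      apply Submodule.linearMap_qext
      ext w
      simpa [Submodule.Quotient.mk_eq_zero] using apply_mem_smul_top J B w hu)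

theorem quotientProduct_mk (J : Ideal R) (B : M →ₗ[R] M →ₗ[R] M) (u v : M) :
    quotientProduct J B (Submodule.Quotient.mk u) (Submodule.Quotient.mk v) =
      Submodule.Quotient.mk (B u v) := rfl

theorem transitionMap_quotientProduct (I : Ideal R) (B : M →ₗ[R] M →ₗ[R] M) {m n : ℕ}
    (hmn : m ≤ n) (x y : M ⧸ (I ^ n • ⊤ : Submodule R M)) :
    AdicCompletion.transitionMap I M hmn (quotientProduct (I ^ n) B x y) =
      quotientProduct (I ^ m) B (AdicCompletion.transitionMap I M hmn x)
        (AdicCompletion.transitionMap I M hmn y) := by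
  obtain ⟨a, rfl⟩ := Submodule.Quotient.mk_surjective _ x
  obtain ⟨b, rfl⟩ := Submodule.Quotient.mk_surjective _ y
  have h : ∀ c : M, AdicCompletion.transitionMap I M hmn (Submodule.Quotient.mk c) =
      Submodule.Quotient.mk c := fun c => Submodule.factor_mk _ c
  rw [quotientProduct_mk, h, h, h, quotientProduct_mk]

/-- The product of two compatible sequences in `lim M / I ^ k M`, taken componentwise. -/
def completedProduct (I : Ideal R) (B : M →ₗ[R] M →ₗ[R] M) :
    AdicCompletion I M →ₗ[R] AdicCompletion I M →ₗ[R] AdicCompletion I M where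
  toFun u := AdicCompletion.lift I
    (fun k => quotientProduct (I ^ k) B (AdicCompletion.eval I M k u) ∘ₗ AdicCompletion.eval I M k)
    (fun {m n} hmn => LinearMap.ext fun v => by
      have h : ∀ x : AdicCompletion I M, AdicCompletion.transitionMap I M hmn
          (AdicCompletion.eval I M n x) = AdicCompletion.eval I M m x := fun x =>
        AdicCompletion.transitionMap_comp_eval_apply I M hmn x
      rw [LinearMap.comp_apply, LinearMap.comp_apply, transitionMap_quotientProduct, h, h]
      rfl)
  map_add' u₁ u₂ := LinearMap.ext fun v => AdicCompletion.ext fun k => by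
    rw [LinearMap.add_apply, AdicCompletion.val_add_apply,
      AdicCompletion.eval_lift_apply, AdicCompletion.eval_lift_apply, AdicCompletion.eval_lift_apply]
    simp only [map_add, LinearMap.comp_apply, LinearMap.add_apply]
  map_smul' r u := LinearMap.ext fun v => AdicCompletion.ext fun k => by
    rw [RingHom.id_apply, LinearMap.smul_apply, AdicCompletion.val_smul_apply,
      AdicCompletion.eval_lift_apply, AdicCompletion.eval_lift_apply]
    simp only [map_smul, LinearMap.comp_apply, LinearMap.smul_apply]

theorem eval_completedProduct (I : Ideal R) (B : M →ₗ[R] M →ₗ[R] M) (u v : AdicCompletion I M)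
    (k : ℕ) : AdicCompletion.eval I M k (completedProduct I B u v) =
      quotientProduct (I ^ k) B (AdicCompletion.eval I M k u) (AdicCompletion.eval I M k v) :=
  rfl

end Completion

/-! ## The `p`-adic Banach space attached to a completed `ℤ_[p]`-module -/

section BanachSpace

variable (p : ℕ) [Fact p.Prime] (M : Type*) [AddCommGroup M] [Module ℤ_[p] M]

/-- The `ℚ_[p]`-vector space `M[1/p]`. -/
def RationalSpan : Type _ := ℚ_[p] ⊗[ℤ_[p]] M

instance : AddCommGroup (RationalSpan p M) := inferInstanceAs (AddCommGroup (ℚ_[p] ⊗[ℤ_[p]] M))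
instance : Module ℚ_[p] (RationalSpan p M) := inferInstanceAs (Module ℚ_[p] (ℚ_[p] ⊗[ℤ_[p]] M))
instance : Module ℤ_[p] (RationalSpan p M) := inferInstanceAs (Module ℤ_[p] (ℚ_[p] ⊗[ℤ_[p]] M))

variable {M}

/-- The canonical map `M → M[1/p]`. -/
def toRationalSpan : M →ₗ[ℤ_[p]] RationalSpan p M :=
  TensorProduct.mk ℤ_[p] ℚ_[p] M 1

variable {p}

/-- The gauge of the image of `M` in `M[1/p]`: the infimum of the norms of the scalars `a` with
`x ∈ a M`. -/
def gaugeNorm (x : RationalSpan p M) : ℝ :=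
  sInf {r : ℝ | ∃ (a : ℚ_[p]) (m : M), x = a • toRationalSpan p m ∧ r = ‖a‖}

theorem exists_common_scalar (a b : ℚ_[p]) (m n : M) (h : ‖a‖ ≤ ‖b‖) :
    ∃ k : M, a • toRationalSpan p m + b • toRationalSpan p n = b • toRationalSpan p k := by
  by_cases hb : b = 0
  · subst hb
    have ha : a = 0 := by simpa using h
    exact ⟨0, by simp [ha]⟩
  · have hab : ‖a / b‖ ≤ 1 := by
      rw [norm_div]
      exact div_le_one_of_le₀ h (norm_nonneg b)
    let t : ℤ_[p] := ⟨a / b, hab⟩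
    have key : a • toRationalSpan p m = b • toRationalSpan p (t • m) := by
      change (a • (1 : ℚ_[p])) ⊗ₜ[ℤ_[p]] m = (b • (1 : ℚ_[p])) ⊗ₜ[ℤ_[p]] (t • m)
      rw [← TensorProduct.smul_tmul]
      congr 1
      change a • (1 : ℚ_[p]) = (a / b) * (b • (1 : ℚ_[p]))
      simp [hb]
    exact ⟨t • m + n, by rw [key, map_add, smul_add]⟩

theorem exists_rep (x : RationalSpan p M) :
    ∃ (a : ℚ_[p]) (m : M), x = a • toRationalSpan p m := by
  refine TensorProduct.induction_on x ⟨0, 0, ?_⟩ (fun a m => ⟨a, m, ?_⟩) ?_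
  · rw [zero_smul]; rfl
  · change a ⊗ₜ[ℤ_[p]] m = (a • (1 : ℚ_[p])) ⊗ₜ[ℤ_[p]] m
    simp
  · rintro _ _ ⟨a, m, rfl⟩ ⟨b, n, rfl⟩
    rcases le_total ‖a‖ ‖b‖ with h | h
    · obtain ⟨k, hk⟩ := exists_common_scalar a b m n h
      exact ⟨b, k, hk⟩
    · obtain ⟨k, hk⟩ := exists_common_scalar b a n m h
      exact ⟨a, k, (add_comm _ _).trans hk⟩

theorem gaugeNorm_le (a : ℚ_[p]) (m : M) : gaugeNorm (a • toRationalSpan p m) ≤ ‖a‖ :=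
  csInf_le ⟨0, by rintro _ ⟨a, m, -, rfl⟩; exact norm_nonneg a⟩ ⟨a, m, rfl, rfl⟩

theorem le_gaugeNorm (x : RationalSpan p M) (r : ℝ)
    (h : ∀ (a : ℚ_[p]) (m : M), x = a • toRationalSpan p m → r ≤ ‖a‖) : r ≤ gaugeNorm x := by
  obtain ⟨a, m, hx⟩ := exists_rep x
  refine le_csInf ⟨_, a, m, hx, rfl⟩ ?_
  rintro _ ⟨b, n, hb, rfl⟩
  exact h b n hb

theorem gaugeNorm_nonneg (x : RationalSpan p M) : 0 ≤ gaugeNorm x :=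
  le_gaugeNorm x 0 fun a _ _ => norm_nonneg a

theorem gaugeNorm_zero : gaugeNorm (0 : RationalSpan p M) = 0 :=
  le_antisymm (by simpa using gaugeNorm_le (0 : ℚ_[p]) (0 : M)) (gaugeNorm_nonneg 0)

theorem gaugeNorm_add_le (x y : RationalSpan p M) :
    gaugeNorm (x + y) ≤ gaugeNorm x + gaugeNorm y := by
  rw [← sub_le_iff_le_add]
  refine le_gaugeNorm x _ fun a m hx => ?_
  rw [sub_le_comm]
  refine le_gaugeNorm y _ fun b n hy => ?_
  rw [sub_le_iff_le_add, hx, hy]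
  rcases le_total ‖a‖ ‖b‖ with h | h
  · obtain ⟨k, hk⟩ := exists_common_scalar a b m n h
    rw [hk]
    exact (gaugeNorm_le b k).trans (le_add_of_nonneg_right (norm_nonneg a))
  · obtain ⟨k, hk⟩ := exists_common_scalar b a n m h
    rw [add_comm, hk]
    exact (gaugeNorm_le a k).trans (le_add_of_nonneg_left (norm_nonneg b))

theorem gaugeNorm_smul_le (c : ℚ_[p]) (x : RationalSpan p M) :
    gaugeNorm (c • x) ≤ ‖c‖ * gaugeNorm x := by
  by_cases hc : c = 0
  · subst hc
    simp [gaugeNorm_zero]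
  · rw [← div_le_iff₀' (norm_pos_iff.2 hc)]
    refine le_gaugeNorm x _ fun a m hx => ?_
    rw [div_le_iff₀' (norm_pos_iff.2 hc), hx, smul_smul, ← norm_mul]
    exact gaugeNorm_le _ _

theorem gaugeNorm_neg (x : RationalSpan p M) : gaugeNorm (-x) = gaugeNorm x := by
  have h : ∀ y : RationalSpan p M, gaugeNorm (-y) ≤ gaugeNorm y := fun y => by
    simpa using gaugeNorm_smul_le (-1 : ℚ_[p]) y
  exact le_antisymm (h x) (by simpa using h (-x))

/-- `M[1/p]` with the gauge of the image of `M` as its semi-norm. When `M` is torsion-free and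
`p`-adically separated, this is a norm and its closed unit ball is `M`. -/
instance : SeminormedAddCommGroup (RationalSpan p M) :=
  AddGroupSeminorm.toSeminormedAddCommGroup
    { toFun := gaugeNorm
      map_zero' := gaugeNorm_zero
      add_le' := gaugeNorm_add_le
      neg' := gaugeNorm_neg }

instance : NormedSpace ℚ_[p] (RationalSpan p M) where
  norm_smul_le := gaugeNorm_smul_le

variable (p)

/-- The ideal `p ℤ_p`. -/
abbrev idealP : Ideal ℤ_[p] := Ideal.span {(p : ℤ_[p])}

variable {p}

/-- The modes on `M'[1/p]`, where `M' = lim M / p ^ k M`: the products of compatible sequences,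
extended `ℚ_[p]`-bilinearly. -/
def completedModes (Y : ModeMap ℤ_[p] M) :
    ModeMap ℚ_[p] (RationalSpan p (AdicCompletion (idealP p) M)) := fun n =>
  LinearMap.BilinMap.baseChange ℚ_[p] (completedProduct (idealP p) (Y n))

end BanachSpace

/-! ## The completed Virasoro Fock space -/

section CompletedVirasoro

variable {p : ℕ} [Fact p.Prime] (c' : ℤ_[p])

/-- The completion `V' = lim V / p ^ k V` of the Virasoro Fock space over `ℤ_p`. -/
abbrev VirCompletion : Type _ := AdicCompletion (idealP p) (VirV c')

/-- The canonical map `V → V'`. -/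
abbrev virOf : VirV c' →ₗ[ℤ_[p]] VirCompletion c' := AdicCompletion.of (idealP p) (VirV c')

/-- The `p`-adic Banach space `V'[1/p]`. -/
abbrev VirBanach : Type _ := RationalSpan p (VirCompletion c')

/-- The canonical map `V → V'[1/p]`. -/
def virToBanach : VirV c' →ₗ[ℤ_[p]] VirBanach c' :=
  toRationalSpan p ∘ₗ virOf c'

end CompletedVirasoro

end

noncomputable section

/-! ## Fields on a module and their products -/

section Fields

/-! The algebraic half is a reconstruction theorem over an arbitrary commutative ring. A pair of
fields is studied through `modeComm A B t r s`, the coefficients of (x - z)^t A(x)B(z) expanded for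
|x| > |z| minus those of (x - z)^t B(z)A(x) expanded for |z| > |x|. Multiplication by x - z gives
U(t+1, r, s) = U(t, r+1, s) - U(t, r, s+1). The basic argument is descent in t: if an identity holds
at t + 1, its error at t depends only on r + s, and truncation in s, or the value at r = 0, makes
the error vanish. This carries Dong's lemma (`IsLocal.fieldProd`), Goddard's uniqueness theorem
(`IsGenerating.eq_zero`) and the Jacobi identity (`IsGenerating.finsum_jacobiLeft`). The field L(z)
is local of order 4 with itself, so it generates a vertex algebra as soon as V has no ℤ-torsion. The
structure is unique because the associator formula determines the field of u(t)v from the fields of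
u and v (`IsVertexAlgebra.eq_of_generators`).

Torsion-freeness follows from a basis: V is free on the monomials L(-n₁-2)⋯L(-nₛ-2)𝟏 indexed by
multisets. Spanning is straightening (`IsVirasoroRep.multisetSpan_eq_top`). Independence is tested
on a polynomial Fock space over a field of characteristic zero. There two free fields, each
commuting with itself, with a background charge proportional to μ, give a Virasoro representation
with c' = 1 - 12μ. This is affine in μ, so every c' occurs without extracting roots
(`fockL_isVirasoroRep`). The leading symbols of the L(-n-2) are algebraically independent quadratic
polynomials (`linearIndependent_fock`).

The analytic half works modulo p^k. There all sums in the axioms are finite and the identities are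
those of V; completeness of the gauge norm turns this into convergence and equality in V'[1/p]
(`IsVertexAlgebra.isPAdicVertexAlgebra`). Finally L(0) is diagonal in the basis, with integral
weights of finite multiplicity. An eigenvector in V' has coordinates only at its own weight, so it
is a finite sum and lies in V (`eigenspace_completion`). -/

theorem finsum_eq_sum_range {M : Type*} [AddCommMonoid M] {f : ℕ → M} {n : ℕ}
    (h : ∀ i, n ≤ i → f i = 0) : ∑ᶠ i, f i = ∑ i ∈ Finset.range n, f i := by
  refine finsum_eq_sum_of_support_subset f fun i hi => ?_
  rw [Finset.coe_range, Set.mem_Iio]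
  by_contra hn
  exact hi (h i (not_lt.1 hn))

/-- A function of two integers that depends only on their sum and vanishes for large second
argument is zero. -/
theorem eq_zero_of_shift {W : Type*} [Zero W] {f : ℤ → ℤ → W}
    (h : ∀ r s, f (r + 1) s = f r (s + 1)) (s₀ : ℤ) (hs : ∀ r s, s₀ < s → f r s = 0) (r s : ℤ) :
    f r s = 0 := by
  have key : ∀ (k : ℕ) (r s : ℤ), f r s = f (r - k) (s + k) := by
    intro k
    induction k with
    | zero => simp
    | succ k ih =>
      intro r s
      rw [ih r s, show r - (k : ℤ) = r - ((k + 1 : ℕ) : ℤ) + 1 by push_cast; ring, h]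
      congr 1
      push_cast; ring
  rw [key (s₀ - s + 1).toNat r s]
  exact hs _ _ (by omega)

theorem apply_add_comm_of_shift {W : Type*} {f : ℤ → ℤ → W}
    (h : ∀ r s, f (r + 1) s = f r (s + 1)) (r s j : ℤ) : f (r + j) s = f r (s + j) := by
  induction j using Int.induction_on generalizing r s with
  | zero => simp
  | succ j ih => rw [← add_assoc, h, ih, add_assoc, add_comm 1]
  | pred j ih =>
    have := h (r + (-j - 1)) (s - 1)
    rw [sub_add_cancel, add_assoc, sub_add_cancel, ih] at this
    rw [← this]
    congr 1; ring

/-- Uniqueness of the multiplication by `(x - z) ^ t` in the domain `|x| > |z|`. -/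
theorem eq_zero_of_recursion {W : Type*} [AddGroup W] {U : ℤ → ℤ → ℤ → W}
    (hrec : ∀ t r s, U (t + 1) r s = U t (r + 1) s - U t r (s + 1)) (s₀ : ℤ)
    (hs : ∀ t r s, s₀ < s → U t r s = 0) (h0 : ∀ r s, U 0 r s = 0) (t r s : ℤ) : U t r s = 0 := by
  induction t using Int.induction_on generalizing r s with
  | zero => exact h0 r s
  | succ i ih => rw [hrec, ih, ih, sub_zero]
  | pred i ih =>
    -- Vanishing one step above makes this function depend on `r + s` only.
    refine eq_zero_of_shift (f := U (-i - 1)) (fun r s => ?_) s₀ (hs _) r s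
    rw [← sub_eq_zero, ← hrec, sub_add_cancel, ih]

variable (R M : Type*) [CommRing R] [AddCommGroup M] [Module R M]

/-- The fields on `M`: the families of operators `A n` with `A n w = 0` for `n ≫ 0`. -/
def fieldSubmodule : Submodule R (ℤ → Module.End R M) where
  carrier := {A | ∀ w, ∃ n₀ : ℤ, ∀ n, n₀ < n → A n w = 0}
  zero_mem' _ := ⟨0, fun _ _ => rfl⟩
  add_mem' {A B} hA hB w := by
    obtain ⟨m, hm⟩ := hA w
    obtain ⟨n, hn⟩ := hB w
    refine ⟨max m n, fun k hk => ?_⟩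
    simp [hm k (by omega), hn k (by omega)]
  smul_mem' c A hA w := by
    obtain ⟨m, hm⟩ := hA w
    exact ⟨m, fun k hk => by simp [hm k hk]⟩

variable {R M}

/-- The `i`-th term in the expansion of `(x - z) ^ t A(x) B(z) w` in the domain `|x| > |z|`. -/
def contractTerm (A B : ℤ → Module.End R M) (t r s : ℤ) (w : M) (i : ℕ) : M :=
  ((-1) ^ i * Ring.choose t i : ℤ) • A (r + t - i) (B (s + i) w)

/-- The bound comes from the truncation of `B` on `w` alone, hence is uniform in `t` and `r`. The
uniformity in `r` is what makes `fieldProd` a field. -/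
theorem exists_contractTerm_eq_zero (A : ℤ → Module.End R M) (B : fieldSubmodule R M) (s : ℤ)
    (w : M) : ∃ n : ℕ, ∀ t r i, n ≤ i → contractTerm A B.1 t r s w i = 0 := by
  obtain ⟨n, hn⟩ := B.2 w
  refine ⟨(n - s + 1).toNat, fun t r i hi => ?_⟩
  rw [contractTerm, hn _ (by omega), map_zero, smul_zero]

theorem finite_support_contractTerm (A : ℤ → Module.End R M) (B : fieldSubmodule R M) (t r s : ℤ)
    (w : M) : (Function.support (contractTerm A B.1 t r s w)).Finite := by
  obtain ⟨n, hn⟩ := exists_contractTerm_eq_zero A B s w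
  refine (Set.finite_Iio n).subset fun i hi => ?_
  by_contra h
  exact hi (hn t r i (not_lt.1 h))

/-- The coefficients of `(x - z) ^ t A(x) B(z)`, expanded in the domain `|x| > |z|`. -/
def contract (A : ℤ → Module.End R M) (B : fieldSubmodule R M) (t r s : ℤ) : Module.End R M where
  toFun w := ∑ᶠ i, contractTerm A B.1 t r s w i
  map_add' v w := by
    rw [← finsum_add_distrib (finite_support_contractTerm A B t r s v)
      (finite_support_contractTerm A B t r s w)]
    exact finsum_congr fun i => by simp only [contractTerm, map_add, smul_add]
  map_smul' c v := by
    rw [RingHom.id_apply, smul_finsum' c (finite_support_contractTerm A B t r s v)]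
    exact finsum_congr fun i => by simp only [contractTerm, map_smul, smul_comm c]

theorem contract_apply (A : ℤ → Module.End R M) (B : fieldSubmodule R M) (t r s : ℤ) (w : M) :
    contract A B t r s w = ∑ᶠ i, contractTerm A B.1 t r s w i := rfl

theorem contract_zero (A : ℤ → Module.End R M) (B : fieldSubmodule R M) (r s : ℤ) :
    contract A B 0 r s = A r * B.1 s := by
  ext w
  rw [contract_apply, finsum_eq_single _ 0]
  · simp [contractTerm]
  · intro i hi
    simp [contractTerm, Ring.choose_zero_pos ℤ (Nat.pos_of_ne_zero hi)]

/-- Pascal's rule, read as multiplication by one more factor x - z. Together with `contract_zero`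
and the truncation in `s` it characterizes `contract`, so later proofs use this recursion in place
of the binomial sums. -/
theorem contract_succ (A : ℤ → Module.End R M) (B : fieldSubmodule R M) (t r s : ℤ) :
    contract A B (t + 1) r s = contract A B t (r + 1) s - contract A B t r (s + 1) := by
  ext w
  obtain ⟨n, hn⟩ := exists_contractTerm_eq_zero A B s w
  obtain ⟨m, hm⟩ := exists_contractTerm_eq_zero A B (s + 1) w
  rw [LinearMap.sub_apply, contract_apply, contract_apply, contract_apply,
    finsum_eq_sum_range (n := max m n + 1) fun i hi => hn _ _ i (by omega),
    finsum_eq_sum_range (n := max m n + 1) fun i hi => hn _ _ i (by omega),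
    finsum_eq_sum_range (n := max m n) fun i hi => hm _ _ i (by omega),
    Finset.sum_range_succ', Finset.sum_range_succ', add_sub_right_comm, ← Finset.sum_sub_distrib]
  congr 1
  · refine Finset.sum_congr rfl fun i _ => ?_
    simp only [contractTerm]
    rw [Ring.choose_succ_succ, show r + (t + 1) - ((i + 1 : ℕ) : ℤ) = r + t - i by push_cast; ring,
      show r + 1 + t - ((i + 1 : ℕ) : ℤ) = r + t - i by push_cast; ring,
      show s + ((i + 1 : ℕ) : ℤ) = s + 1 + i by push_cast; ring, ← sub_smul]
    congr 1
    ring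
  · simp only [contractTerm, Ring.choose_zero_right, add_assoc, add_comm t 1]

theorem exists_contract_eq_zero (A : ℤ → Module.End R M) (B : fieldSubmodule R M) (w : M) :
    ∃ s₀ : ℤ, ∀ t r s, s₀ < s → contract A B t r s w = 0 := by
  obtain ⟨n, hn⟩ := B.2 w
  refine ⟨n, fun t r s hs => ?_⟩
  rw [contract_apply, ← finsum_zero (α := ℕ)]
  exact finsum_congr fun i => by rw [contractTerm, hn _ (by omega), map_zero, smul_zero]

theorem contract_add_left (A₁ A₂ : ℤ → Module.End R M) (B : fieldSubmodule R M) (t r s : ℤ) :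
    contract (A₁ + A₂) B t r s = contract A₁ B t r s + contract A₂ B t r s := by
  ext w
  rw [LinearMap.add_apply, contract_apply, contract_apply, contract_apply,
    ← finsum_add_distrib (finite_support_contractTerm _ B t r s w)
      (finite_support_contractTerm _ B t r s w)]
  exact finsum_congr fun i => by
    simp only [contractTerm, Pi.add_apply, LinearMap.add_apply, smul_add]

theorem contract_add_right (A : ℤ → Module.End R M) (B₁ B₂ : fieldSubmodule R M) (t r s : ℤ) :
    contract A (B₁ + B₂) t r s = contract A B₁ t r s + contract A B₂ t r s := by
  ext w
  rw [LinearMap.add_apply, contract_apply, contract_apply, contract_apply,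
    ← finsum_add_distrib (finite_support_contractTerm _ _ t r s w)
      (finite_support_contractTerm _ _ t r s w)]
  exact finsum_congr fun i => by
    simp only [contractTerm, Submodule.coe_add, Pi.add_apply, LinearMap.add_apply, map_add,
      smul_add]

theorem contract_smul_left (c : R) (A : ℤ → Module.End R M) (B : fieldSubmodule R M)
    (t r s : ℤ) : contract (c • A) B t r s = c • contract A B t r s := by
  ext w
  rw [LinearMap.smul_apply, contract_apply, contract_apply,
    smul_finsum' c (finite_support_contractTerm _ _ t r s w)]
  exact finsum_congr fun i => by
    simp only [contractTerm, Pi.smul_apply, LinearMap.smul_apply, smul_comm c]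

theorem contract_smul_right (c : R) (A : ℤ → Module.End R M) (B : fieldSubmodule R M)
    (t r s : ℤ) : contract A (c • B) t r s = c • contract A B t r s := by
  ext w
  rw [LinearMap.smul_apply, contract_apply, contract_apply,
    smul_finsum' c (finite_support_contractTerm _ _ t r s w)]
  exact finsum_congr fun i => by
    simp only [contractTerm, Submodule.coe_smul, Pi.smul_apply, LinearMap.smul_apply, map_smul,
      smul_comm c]

/-- The coefficients of the difference of the expansions of `(x - z) ^ t A(x) B(z)` in the domain
`|x| > |z|` and of `(x - z) ^ t B(z) A(x)` in the domain `|z| > |x|`. -/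
def modeComm (A B : fieldSubmodule R M) (t r s : ℤ) : Module.End R M :=
  contract A.1 B t r s - (t.negOnePow : ℤ) • contract B.1 A t s r

theorem modeComm_zero (A B : fieldSubmodule R M) (r s : ℤ) :
    modeComm A B 0 r s = A.1 r * B.1 s - B.1 s * A.1 r := by
  simp [modeComm, contract_zero]

theorem modeComm_succ (A B : fieldSubmodule R M) (t r s : ℤ) :
    modeComm A B (t + 1) r s = modeComm A B t (r + 1) s - modeComm A B t r (s + 1) := by
  simp only [modeComm, contract_succ, Int.negOnePow_succ, Units.val_neg, neg_smul, smul_sub]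
  abel

theorem modeComm_swap (A B : fieldSubmodule R M) (t r s : ℤ) :
    modeComm B A t s r = -((t.negOnePow : ℤ) • modeComm A B t r s) := by
  change contract B.1 A t s r - (t.negOnePow : ℤ) • contract A.1 B t r s =
    -((t.negOnePow : ℤ) • (contract A.1 B t r s - (t.negOnePow : ℤ) • contract B.1 A t s r))
  rw [smul_sub, smul_smul, ← Units.val_mul, ← Int.negOnePow_add,
    Int.negOnePow_even _ ⟨t, rfl⟩]
  simp

theorem modeComm_add_left (A₁ A₂ B : fieldSubmodule R M) (t r s : ℤ) :
    modeComm (A₁ + A₂) B t r s = modeComm A₁ B t r s + modeComm A₂ B t r s := by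
  simp only [modeComm, Submodule.coe_add, contract_add_left, contract_add_right, smul_add]
  abel

theorem modeComm_smul_left (c : R) (A B : fieldSubmodule R M) (t r s : ℤ) :
    modeComm (c • A) B t r s = c • modeComm A B t r s := by
  simp only [modeComm, Submodule.coe_smul, contract_smul_left, contract_smul_right, smul_sub,
    smul_comm c]

/-- The `t`-th product `A(t)B` of two fields. -/
def fieldProd (t : ℤ) (A B : fieldSubmodule R M) : fieldSubmodule R M :=
  ⟨fun s => modeComm A B t 0 s, fun w => by
    obtain ⟨s₀, hs₀⟩ := exists_contract_eq_zero A.1 B w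
    obtain ⟨n, hn⟩ := exists_contractTerm_eq_zero B.1 A 0 w
    -- In the second expansion only the terms with i < n occur, for every `s`. Each of them applies
    -- `B` at index s + t - i to one of finitely many vectors, so a common bound `K` exists.
    have hb : ∀ i : ℕ, ∃ k : ℤ, ∀ j, k < j → B.1 j (A.1 (0 + i) w) = 0 := fun i => B.2 _
    choose k hk using hb
    obtain ⟨K, hK⟩ := ((Finset.range n).image k).bddAbove
    refine ⟨max s₀ (K - t + n), fun s hs => ?_⟩
    change modeComm A B t 0 s w = 0
    rw [modeComm, LinearMap.sub_apply, hs₀ t 0 s (by omega), LinearMap.smul_apply, contract_apply,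
      finsum_eq_sum_range fun i hi => hn t s i hi, Finset.sum_eq_zero, smul_zero, sub_zero]
    intro i hi
    have hiK : k i ≤ K := hK (Finset.mem_coe.2 (Finset.mem_image_of_mem k hi))
    rw [Finset.mem_range] at hi
    rw [contractTerm, hk i _ (by omega), smul_zero]⟩

theorem fieldProd_apply (t : ℤ) (A B : fieldSubmodule R M) (s : ℤ) :
    (fieldProd t A B).1 s = modeComm A B t 0 s := rfl

/-! ### Locality -/

/-- Two fields are mutually local if `(x - z) ^ N [A(x), B(z)] = 0` for some `N`. -/
def IsLocal (A B : fieldSubmodule R M) : Prop :=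
  ∃ N : ℕ, ∀ r s, modeComm A B N r s = 0

theorem modeComm_eq_zero_of_le {A B : fieldSubmodule R M} {N : ℤ}
    (h : ∀ r s, modeComm A B N r s = 0) {t : ℤ} (ht : N ≤ t) (r s : ℤ) :
    modeComm A B t r s = 0 := by
  induction t, ht using Int.leInduction generalizing r s with
  | base => exact h r s
  | succ n _ ih => rw [modeComm_succ, ih, ih, sub_zero]

theorem IsLocal.symm {A B : fieldSubmodule R M} (h : IsLocal A B) : IsLocal B A := by
  obtain ⟨N, hN⟩ := h
  exact ⟨N, fun r s => by rw [modeComm_swap, hN, smul_zero, neg_zero]⟩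

theorem IsLocal.add {A₁ A₂ B : fieldSubmodule R M} (h₁ : IsLocal A₁ B) (h₂ : IsLocal A₂ B) :
    IsLocal (A₁ + A₂) B := by
  obtain ⟨N₁, h₁⟩ := h₁
  obtain ⟨N₂, h₂⟩ := h₂
  refine ⟨max N₁ N₂, fun r s => ?_⟩
  rw [modeComm_add_left, modeComm_eq_zero_of_le h₁ (by simp), modeComm_eq_zero_of_le h₂ (by simp),
    add_zero]

theorem IsLocal.smul {A B : fieldSubmodule R M} (c : R) (h : IsLocal A B) : IsLocal (c • A) B := by
  obtain ⟨N, h⟩ := h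
  exact ⟨N, fun r s => by rw [modeComm_smul_left, h, smul_zero]⟩

theorem IsLocal.zero (B : fieldSubmodule R M) : IsLocal 0 B := by
  refine ⟨0, fun r s => ?_⟩
  rw [Nat.cast_zero, modeComm_zero]
  simp

/-! ### Difference operators in three variables, for Dong's lemma -/

section Shift

variable (W : Type*) [AddCommGroup W]

/-- Translation of the first argument. -/
def shiftFst : Module.End ℤ (ℤ → ℤ → ℤ → W) where
  toFun f r s q := f (r + 1) s q
  map_add' _ _ := rfl
  map_smul' _ _ := rfl

/-- Translation of the second argument. -/
def shiftSnd : Module.End ℤ (ℤ → ℤ → ℤ → W) where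
  toFun f r s q := f r (s + 1) q
  map_add' _ _ := rfl
  map_smul' _ _ := rfl

/-- Translation of the third argument. -/
def shiftThd : Module.End ℤ (ℤ → ℤ → ℤ → W) where
  toFun f r s q := f r s (q + 1)
  map_add' _ _ := rfl
  map_smul' _ _ := rfl

theorem shiftFst_comm_shiftSnd : Commute (shiftFst W) (shiftSnd W) := rfl
theorem shiftFst_comm_shiftThd : Commute (shiftFst W) (shiftThd W) := rfl
theorem shiftSnd_comm_shiftThd : Commute (shiftSnd W) (shiftThd W) := rfl

/-- Multiplication by `x₁ - x₂`. -/
def diff₁₂ : Module.End ℤ (ℤ → ℤ → ℤ → W) := shiftFst W - shiftSnd W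
/-- Multiplication by `x₁ - x₃`. -/
def diff₁₃ : Module.End ℤ (ℤ → ℤ → ℤ → W) := shiftFst W - shiftThd W
/-- Multiplication by `x₂ - x₃`. -/
def diff₂₃ : Module.End ℤ (ℤ → ℤ → ℤ → W) := shiftSnd W - shiftThd W

variable {W}

theorem diff₁₂_apply (f : ℤ → ℤ → ℤ → W) (r s q : ℤ) :
    diff₁₂ W f r s q = f (r + 1) s q - f r (s + 1) q := rfl
theorem diff₁₃_apply (f : ℤ → ℤ → ℤ → W) (r s q : ℤ) :
    diff₁₃ W f r s q = f (r + 1) s q - f r s (q + 1) := rfl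
theorem diff₂₃_apply (f : ℤ → ℤ → ℤ → W) (r s q : ℤ) :
    diff₂₃ W f r s q = f r (s + 1) q - f r s (q + 1) := rfl

theorem diff₁₂_comm_diff₁₃ : Commute (diff₁₂ W) (diff₁₃ W) := by
  refine .sub_left (.sub_right (.refl _) (shiftFst_comm_shiftThd W))
    (.sub_right (shiftFst_comm_shiftSnd W).symm (shiftSnd_comm_shiftThd W))

theorem diff₁₂_comm_diff₂₃ : Commute (diff₁₂ W) (diff₂₃ W) := by
  refine .sub_left (.sub_right (shiftFst_comm_shiftSnd W) (shiftFst_comm_shiftThd W))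
    (.sub_right (.refl _) (shiftSnd_comm_shiftThd W))

theorem diff₁₃_comm_diff₂₃ : Commute (diff₁₃ W) (diff₂₃ W) := by
  refine .sub_left (.sub_right (shiftFst_comm_shiftSnd W) (shiftFst_comm_shiftThd W))
    (.sub_right (shiftSnd_comm_shiftThd W).symm (.refl _))

/-- Write x₂ - x₃ = (x₁ - x₃) - (x₁ - x₂) and expand the power N + k of it. A term with at least N
factors x₁ - x₃ is killed together with the spare factor (x₂ - x₃)^N; every other term has at least
k factors x₁ - x₂. -/
theorem diff₂₃_pow_eq_zero {f : ℤ → ℤ → ℤ → W} {k N : ℕ} (h₁₂ : ((diff₁₂ W) ^ k) f = 0)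
    (h : (diff₁₃ W ^ N * diff₂₃ W ^ N) f = 0) : (diff₂₃ W ^ (N + (N + k))) f = 0 := by
  have e : diff₂₃ W = diff₁₃ W + -diff₁₂ W := by
    simp only [diff₁₂, diff₁₃, diff₂₃]; abel
  have hc : Commute (diff₁₃ W) (-diff₁₂ W) := (diff₁₂_comm_diff₁₃ (W := W)).symm.neg_right
  rw [pow_add, Module.End.mul_apply]
  conv_lhs => enter [2, 1]; rw [e, hc.add_pow]
  rw [LinearMap.sum_apply, map_sum]
  refine Finset.sum_eq_zero fun m hm => ?_
  rw [Finset.mem_range] at hm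
  have hnat : ((Nat.choose (N + k) m : Module.End ℤ (ℤ → ℤ → ℤ → W))) f =
      Nat.choose (N + k) m • f := by
    rw [Module.End.natCast_apply]
  rw [Module.End.mul_apply, hnat, map_nsmul, map_nsmul]
  suffices h0 : (diff₂₃ W ^ N) ((diff₁₃ W ^ m * (-diff₁₂ W) ^ (N + k - m)) f) = 0 by
    rw [h0, smul_zero]
  rw [← Module.End.mul_apply]
  by_cases hNm : N ≤ m
  · obtain ⟨j, rfl⟩ := Nat.exists_eq_add_of_le hNm
    have : (diff₂₃ W) ^ N * (diff₁₃ W ^ (N + j) * (-diff₁₂ W) ^ (N + k - (N + j))) =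
        diff₁₃ W ^ j * (-diff₁₂ W) ^ (N + k - (N + j)) * (diff₁₃ W ^ N * diff₂₃ W ^ N) := by
      have c1 := (diff₁₃_comm_diff₂₃ (W := W)).pow_pow N N
      have c2 := (hc.pow_pow N (N + k - (N + j)))
      have c3 := (((diff₁₂_comm_diff₂₃ (W := W)).neg_left).pow_pow (N + k - (N + j)) N)
      have c4 := (diff₁₃_comm_diff₂₃ (W := W)).pow_pow (N + j) N
      rw [← mul_assoc, ← c4.eq, mul_assoc, ← c3.eq, add_comm N j, pow_add, mul_assoc, mul_assoc]
      rw [← mul_assoc (diff₁₃ W ^ N), add_comm j N, c2.eq, mul_assoc]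
    rw [this, Module.End.mul_apply, h, map_zero]
  · obtain ⟨j, hj⟩ := Nat.exists_eq_add_of_le (show k ≤ N + k - m by omega)
    rw [hj, add_comm k j, pow_add, neg_pow (diff₁₂ W) k, Module.End.mul_apply, Module.End.mul_apply,
      Module.End.mul_apply, Module.End.mul_apply, h₁₂]
    simp

/-- Exchanging the first two variables exchanges `diff₁₃` and `diff₂₃`, and these commute, so the
product of their powers is symmetric. -/
theorem diff_pow_swap (f : ℤ → ℤ → ℤ → W) (N : ℕ) :
    (diff₁₃ W ^ N * diff₂₃ W ^ N) (fun r s q => f s r q) =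
      fun r s q => (diff₁₃ W ^ N * diff₂₃ W ^ N) f s r q := by
  have h₁ : ∀ (n : ℕ) (f : ℤ → ℤ → ℤ → W), (diff₁₃ W ^ n) (fun r s q => f s r q) =
      fun r s q => (diff₂₃ W ^ n) f s r q := by
    intro n
    induction n with
    | zero => intro f; rfl
    | succ n ih =>
      intro f
      rw [pow_succ, Module.End.mul_apply, pow_succ, Module.End.mul_apply, ← ih]
      rfl
  have h₂ : ∀ (n : ℕ) (f : ℤ → ℤ → ℤ → W), (diff₂₃ W ^ n) (fun r s q => f s r q) =
      fun r s q => (diff₁₃ W ^ n) f s r q := by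
    intro n
    induction n with
    | zero => intro f; rfl
    | succ n ih =>
      intro f
      rw [pow_succ, Module.End.mul_apply, pow_succ, Module.End.mul_apply, ← ih]
      rfl
  rw [Module.End.mul_apply, h₂, h₁, ((diff₁₃_comm_diff₂₃ (W := W)).pow_pow N N).eq,
    Module.End.mul_apply]

end Shift


/-- The operators only raise indices, so truncation in `s` survives. The bound may depend on `q` but
not on `t` and `r`, as `eq_zero_of_recursion` demands. -/
theorem exists_diff_pow_apply_eq_zero {ι : Type*} {g : ι → ℤ → ℤ → ℤ → Module.End R M} (w : M)
    (D : Module.End ℤ (ℤ → ℤ → ℤ → Module.End R M))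
    (hD : D = diff₁₃ (Module.End R M) ∨ D = diff₂₃ (Module.End R M)) (n : ℕ)
    (h : ∀ q, ∃ s₀ : ℤ, ∀ t r s, s₀ < s → g t r s q w = 0) :
    ∀ q, ∃ s₀ : ℤ, ∀ t r s, s₀ < s → (D ^ n) (g t) r s q w = 0 := by
  induction n with
  | zero => simpa using h
  | succ n ih =>
    intro q
    obtain ⟨s₁, h₁⟩ := ih q
    obtain ⟨s₂, h₂⟩ := ih (q + 1)
    refine ⟨max s₁ s₂, fun t r s hs => ?_⟩
    rw [pow_succ', Module.End.mul_apply]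
    rcases hD with rfl | rfl
    · rw [diff₁₃_apply, LinearMap.sub_apply, h₁ _ _ _ (by omega), h₂ _ _ _ (by omega), sub_zero]
    · rw [diff₂₃_apply, LinearMap.sub_apply, h₁ _ _ _ (by omega), h₂ _ _ _ (by omega), sub_zero]

theorem diff₂₃_pow_mul_modeComm (A : ℤ → Module.End R M) (B C : fieldSubmodule R M) (n : ℕ) :
    (diff₂₃ (Module.End R M) ^ n) (fun r s q => A r * modeComm B C 0 s q) =
      fun r s q => A r * modeComm B C n s q := by
  induction n with
  | zero => rfl
  | succ n ih =>
    rw [pow_succ', Module.End.mul_apply, ih]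
    funext r s q
    rw [diff₂₃_apply, ← mul_sub, Nat.cast_succ, modeComm_succ]

theorem diff₁₃_pow_modeComm_mul (A C : fieldSubmodule R M) (B : ℤ → Module.End R M) (n : ℕ) :
    (diff₁₃ (Module.End R M) ^ n) (fun r s q => modeComm A C 0 r q * B s) =
      fun r s q => modeComm A C n r q * B s := by
  induction n with
  | zero => rfl
  | succ n ih =>
    rw [pow_succ', Module.End.mul_apply, ih]
    funext r s q
    rw [diff₁₃_apply, ← sub_mul, Nat.cast_succ, modeComm_succ]

/-- At t = 0 the Leibniz rule [AB, C] = A[B, C] + [A, C]B reduces the claim to the two localities.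
Raising t by one is multiplication by x₁ - x₂, which commutes with the operators applied here, so
`eq_zero_of_recursion` carries the vanishing to every t, negative ones included. -/
theorem diff_pow_contract_comm {A B C : fieldSubmodule R M} {N : ℕ}
    (hAC : ∀ r s, modeComm A C N r s = 0) (hBC : ∀ r s, modeComm B C N r s = 0) (t : ℤ) :
    (diff₁₃ (Module.End R M) ^ N * diff₂₃ (Module.End R M) ^ N)
      (fun r s q => contract A.1 B t r s * C.1 q -
      C.1 q * contract A.1 B t r s) = 0 := by
  set g : ℤ → ℤ → ℤ → ℤ → Module.End R M := fun t r s q =>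
    contract A.1 B t r s * C.1 q - C.1 q * contract A.1 B t r s with hg
  have g_succ : ∀ t, g (t + 1) = diff₁₂ (Module.End R M) (g t) := fun t => by
    funext r s q
    simp only [hg, diff₁₂_apply, contract_succ, sub_mul, mul_sub]
    abel
  have c : Commute (diff₁₂ (Module.End R M))
      (diff₁₃ (Module.End R M) ^ N * diff₂₃ (Module.End R M) ^ N) :=
    ((diff₁₂_comm_diff₁₃ (W := Module.End R M)).pow_right N).mul_right
      ((diff₁₂_comm_diff₂₃ (W := Module.End R M)).pow_right N)
  have tr : ∀ w q, ∃ s₀ : ℤ, ∀ t r s, s₀ < s → g t r s q w = 0 := by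
    intro w q
    obtain ⟨s₁, h₁⟩ := exists_contract_eq_zero A.1 B w
    obtain ⟨s₂, h₂⟩ := exists_contract_eq_zero A.1 B (C.1 q w)
    refine ⟨max s₁ s₂, fun t r s hs => ?_⟩
    rw [hg, LinearMap.sub_apply, Module.End.mul_apply, Module.End.mul_apply,
      h₁ _ _ _ (by omega), h₂ _ _ _ (by omega), map_zero, sub_zero]
  have g_zero : g 0 = (fun r s q => A.1 r * modeComm B C 0 s q) +
      fun r s q => modeComm A C 0 r q * B.1 s := by
    funext r s q
    simp only [hg, contract_zero, modeComm_zero, Pi.add_apply, mul_sub, sub_mul, mul_assoc]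
    abel
  have base : (diff₁₃ (Module.End R M) ^ N * diff₂₃ (Module.End R M) ^ N) (g 0) = 0 := by
    rw [g_zero, map_add]
    nth_rewrite 2 [((diff₁₃_comm_diff₂₃ (W := Module.End R M)).pow_pow N N).eq]
    rw [Module.End.mul_apply, Module.End.mul_apply, diff₂₃_pow_mul_modeComm,
      diff₁₃_pow_modeComm_mul]
    simp only [hAC, hBC, mul_zero, zero_mul]
    exact (congrArg₂ (· + ·) (map_zero _) (map_zero _)).trans (add_zero 0)
  funext r s q
  ext w
  obtain ⟨s₀, hs₀⟩ := exists_diff_pow_apply_eq_zero w (diff₁₃ (Module.End R M)) (.inl rfl) N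
    (exists_diff_pow_apply_eq_zero w (diff₂₃ (Module.End R M)) (.inr rfl) N (tr w)) q
  refine eq_zero_of_recursion
    (U := fun t r s => (diff₁₃ (Module.End R M) ^ N * diff₂₃ (Module.End R M) ^ N) (g t) r s q w)
    (fun t r s => ?_) s₀ hs₀
    (fun r s => by rw [base]; rfl) t r s
  rw [g_succ, ← Module.End.mul_apply, ← c.eq, Module.End.mul_apply, diff₁₂_apply,
    LinearMap.sub_apply]

/-- Dong's lemma. -/
theorem IsLocal.fieldProd {A B C : fieldSubmodule R M} (t : ℤ) (hAB : IsLocal A B)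
    (hAC : IsLocal A C) (hBC : IsLocal B C) : IsLocal (fieldProd t A B) C := by
  obtain ⟨N₁, h₁⟩ := hAB
  obtain ⟨N₂, h₂⟩ := hAC
  obtain ⟨N₃, h₃⟩ := hBC
  set N := max N₂ N₃
  have hAC : ∀ r s, modeComm A C N r s = 0 := modeComm_eq_zero_of_le h₂ (by simp [N])
  have hBC : ∀ r s, modeComm B C N r s = 0 := modeComm_eq_zero_of_le h₃ (by simp [N])
  set f : ℤ → ℤ → ℤ → ℤ → Module.End R M := fun t r s q =>
    modeComm A B t r s * C.1 q - C.1 q * modeComm A B t r s with hf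
  have f_succ : ∀ (k : ℕ) (t : ℤ), (diff₁₂ (Module.End R M) ^ k) (f t) = f (t + k) := by
    intro k
    induction k with
    | zero => simp
    | succ k ih =>
      intro t
      have : diff₁₂ (Module.End R M) (f t) = f (t + 1) := by
        funext r s q
        simp only [hf, diff₁₂_apply, modeComm_succ, sub_mul, mul_sub]
        abel
      rw [pow_succ, Module.End.mul_apply, this, ih]
      congr 1
      push_cast; ring
  -- This many factors x₁ - x₂ raise the exponent `t` to at least the order of locality of `A` and
  -- `B`.
  have h12 : (diff₁₂ (Module.End R M) ^ (N₁ - t).toNat) (f t) = 0 := by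
    rw [f_succ]
    funext r s q
    simp only [hf, modeComm_eq_zero_of_le h₁ (show (N₁ : ℤ) ≤ t + (N₁ - t).toNat by omega),
      zero_mul, mul_zero, sub_zero]
    rfl
  have h1 := diff_pow_contract_comm hAC hBC t
  have h2 := diff_pow_contract_comm hBC hAC t
  have h13 : (diff₁₃ (Module.End R M) ^ N * diff₂₃ (Module.End R M) ^ N) (f t) = 0 := by
    have e : f t = (fun r s q => contract A.1 B t r s * C.1 q - C.1 q * contract A.1 B t r s) -
        (t.negOnePow : ℤ) • fun r s q =>
          contract B.1 A t s r * C.1 q - C.1 q * contract B.1 A t s r := by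
      funext r s q
      simp only [hf, modeComm, Pi.sub_apply, Pi.smul_apply, sub_mul, mul_sub, smul_sub,
        smul_mul_assoc, mul_smul_comm]
      abel
    rw [e, map_sub, h1, map_zsmul, diff_pow_swap (fun r s q =>
      contract B.1 A t r s * C.1 q - C.1 q * contract B.1 A t r s), h2]
    simp only [Pi.zero_apply, zero_sub, neg_eq_zero]
    exact smul_zero _
  have := diff₂₃_pow_eq_zero h12 h13
  refine ⟨N + (N + (N₁ - t).toNat), fun s q => ?_⟩
  -- Setting the first index to 0 turns the pair (A, B) into the product A(t)B, and `diff₂₃` then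
  -- acts as the recursion for its commutator with `C`.
  have key : ∀ n : ℕ, (diff₂₃ (Module.End R M) ^ n) (f t) 0 =
      modeComm (_root_.fieldProd t A B) C n := by
    intro n
    induction n with
    | zero =>
      funext s q
      rw [Nat.cast_zero, modeComm_zero]
      rfl
    | succ n ih =>
      funext s q
      rw [pow_succ', Module.End.mul_apply, diff₂₃_apply, ih, Nat.cast_succ, modeComm_succ]
  rw [← key, this]
  rfl

end Fields
end

noncomputable section

/-! ## Reconstruction of vertex algebras from generating fields -/

section Reconstruction

variable {R M : Type*} [CommRing R] [AddCommGroup M] [Module R M]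

/-- `[T, A(z)] = ∂_z A(z)`, coefficientwise. -/
def IsCovariant (T : Module.End R M) (A : ℤ → Module.End R M) : Prop :=
  ∀ n : ℤ, T * A n - A n * T = (-n : ℤ) • A (n - 1)

/-- The factor (x - z)^t is annihilated by ∂ₓ + ∂_z, so the claim should reduce to the product rule
at t = 0. Formally, the difference of the two sides satisfies the recursion in `t` and vanishes for
large `s`; the extra 1 in the bound accounts for the index `s - 1`. -/
theorem IsCovariant.contract {T : Module.End R M} {A : ℤ → Module.End R M}
    {B : fieldSubmodule R M} (hA : IsCovariant T A) (hB : IsCovariant T B.1) (t r s : ℤ) :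
    T * contract A B t r s - contract A B t r s * T =
      (-r : ℤ) • contract A B t (r - 1) s + (-s : ℤ) • contract A B t r (s - 1) := by
  ext w
  obtain ⟨s₁, h₁⟩ := exists_contract_eq_zero A B w
  obtain ⟨s₂, h₂⟩ := exists_contract_eq_zero A B (T w)
  rw [← sub_eq_zero, ← LinearMap.sub_apply]
  refine eq_zero_of_recursion (U := fun t r s => (T * _root_.contract A B t r s -
    _root_.contract A B t r s * T - ((-r : ℤ) • _root_.contract A B t (r - 1) s +
      (-s : ℤ) • _root_.contract A B t r (s - 1))) w) (fun t r s => ?_) (max s₁ s₂ + 1)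
      (fun t r s hs => ?_) (fun r s => ?_) t r s
  · rw [← LinearMap.sub_apply]
    congr 1
    simp only [contract_succ, add_sub_cancel_right, sub_add_cancel, mul_sub, sub_mul, smul_sub,
      neg_smul, add_smul, neg_add_rev, one_smul]
    abel
  · simp [h₁ t r s (by omega), h₂ t r s (by omega), h₁ t (r - 1) s (by omega),
      h₁ t r (s - 1) (by omega)]
  · have e : T * (A r * B.1 s) - A r * B.1 s * T =
        (T * A r - A r * T) * B.1 s + A r * (T * B.1 s - B.1 s * T) := by
      simp only [mul_sub, sub_mul, mul_assoc]; abel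
    simp only [contract_zero]
    rw [e, hA r, hB s, smul_mul_assoc, mul_smul_comm, sub_self, LinearMap.zero_apply]

/-- The derivative in x enters with the coefficient -r, which is zero at r = 0, so only the
derivative in z remains. -/
theorem IsCovariant.fieldProd {T : Module.End R M} {A B : fieldSubmodule R M}
    (hA : IsCovariant T A.1) (hB : IsCovariant T B.1) (t : ℤ) :
    IsCovariant T (fieldProd t A B).1 := by
  intro s
  have h₁ := hA.contract hB t 0 s
  have h₂ := hB.contract hA t s 0
  rw [fieldProd_apply, fieldProd_apply, modeComm, modeComm, mul_sub, sub_mul, mul_smul_comm,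
    smul_mul_assoc, sub_sub_sub_comm, ← smul_sub, h₁, h₂]
  simp only [neg_zero, zero_smul, zero_add, add_zero, smul_sub, smul_comm (-s) (_ : ℤ)]

/-- `A` is creative: `A(n) 𝟏 = 0` for `n ≥ 0`. -/
def IsCreative (vac : M) (A : ℤ → Module.End R M) : Prop :=
  ∀ n : ℤ, 0 ≤ n → A n vac = 0

theorem modeComm_apply_vac {vac : M} {A B : fieldSubmodule R M} (hA : IsCreative vac A.1)
    (t s : ℤ) : modeComm A B t 0 s vac = contract A.1 B t 0 s vac := by
  rw [modeComm, LinearMap.sub_apply, LinearMap.smul_apply, contract_apply (B.1),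
    finsum_congr (g := fun _ => 0) fun i => by
      rw [contractTerm, hA _ (by omega), map_zero, smul_zero], finsum_zero, smul_zero, sub_zero]

theorem IsCreative.fieldProd {vac : M} {A B : fieldSubmodule R M} (hA : IsCreative vac A.1)
    (hB : IsCreative vac B.1) (t : ℤ) : IsCreative vac (fieldProd t A B).1 := by
  intro n hn
  rw [fieldProd_apply, modeComm_apply_vac hA, contract_apply,
    finsum_congr (g := fun _ => 0) fun i => by
      rw [contractTerm, hB _ (by omega), map_zero, smul_zero], finsum_zero]

/-- Evaluation at the vacuum turns the t-th product of fields into the t-th mode. This gives both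
the surjectivity in `evVac_bijective` and the identification of the field of u(t)v in
`stateField_apply`. -/
theorem fieldProd_neg_one_vac {vac : M} {A B : fieldSubmodule R M} (hA : IsCreative vac A.1)
    (hB : IsCreative vac B.1) (t : ℤ) :
    (fieldProd t A B).1 (-1) vac = A.1 t (B.1 (-1) vac) := by
  rw [fieldProd_apply, modeComm_apply_vac hA, contract_apply, finsum_eq_single _ 0]
  · simp [contractTerm]
  · intro i hi
    rw [contractTerm, hB _ (by omega), map_zero, smul_zero]

/-- A family of fields that generates a vertex algebra with vacuum vector `vac` and translation
operator `T`. -/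
structure IsGenerating {ι : Type*} (T : Module.End R M) (vac : M)
    (G : ι → fieldSubmodule R M) : Prop where
  vac_eq : T vac = 0
  covariant : ∀ i, IsCovariant T (G i).1
  creative : ∀ i, IsCreative vac (G i).1
  isLocal : ∀ i j, IsLocal (G i) (G j)
  span : ∀ N : Submodule R M, vac ∈ N → (∀ i n, ∀ v ∈ N, (G i).1 n v ∈ N) → N = ⊤
  torsion_free : ∀ (n : ℤ) (v : M), n ≠ 0 → n • v = 0 → v = 0

/-- The fields that are translation covariant, creative, and mutually local with the given
fields. -/
def localFields {ι : Type*} (T : Module.End R M) (vac : M) (G : ι → fieldSubmodule R M) :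
    Submodule R (fieldSubmodule R M) where
  carrier := {A | IsCovariant T A.1 ∧ IsCreative vac A.1 ∧ ∀ i, IsLocal A (G i)}
  zero_mem' := ⟨fun n => by simp, fun n _ => rfl, fun i => IsLocal.zero _⟩
  add_mem' {A B} hA hB := by
    refine ⟨fun n => ?_, fun n hn => ?_, fun i => (hA.2.2 i).add (hB.2.2 i)⟩
    · have h₁ := hA.1 n
      have h₂ := hB.1 n
      simp only [Submodule.coe_add, Pi.add_apply, mul_add, add_mul, smul_add]
      rw [← h₁, ← h₂]; abel
    · simp [hA.2.1 n hn, hB.2.1 n hn]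
  smul_mem' c A hA := by
    refine ⟨fun n => ?_, fun n hn => ?_, fun i => (hA.2.2 i).smul c⟩
    · have h₁ := hA.1 n
      simp only [Submodule.coe_smul, Pi.smul_apply, mul_smul_comm, smul_mul_assoc]
      rw [← smul_sub, h₁, smul_comm]
    · simp [hA.2.1 n hn]

/-- The identity field. -/
def oneField : fieldSubmodule R M :=
  ⟨fun n => if n = -1 then 1 else 0, fun w => ⟨-1, fun n hn => by
    simp [show n ≠ -1 by omega]⟩⟩

namespace IsGenerating

variable {ι : Type*} {T : Module.End R M} {vac : M} {G : ι → fieldSubmodule R M}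

theorem oneField_mem (_ : IsGenerating T vac G) : oneField ∈ localFields T vac G := by
  refine ⟨fun n => ?_, fun n hn => ?_, fun i => ⟨0, fun r s => ?_⟩⟩
  · by_cases h₀ : n = 0
    · subst h₀; simp [oneField]
    · have : n - 1 ≠ -1 := by omega
      by_cases h₁ : n = -1 <;> simp [oneField, this, h₁]
  · simp [oneField, show n ≠ -1 by omega]
  · rw [Nat.cast_zero, modeComm_zero]
    by_cases h₁ : r = -1 <;> simp [oneField, h₁]

theorem mem (h : IsGenerating T vac G) (i : ι) : G i ∈ localFields T vac G :=
  ⟨h.covariant i, h.creative i, h.isLocal i⟩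

theorem fieldProd_mem (h : IsGenerating T vac G) {A : fieldSubmodule R M}
    (hA : A ∈ localFields T vac G) (i : ι) (t : ℤ) : fieldProd t (G i) A ∈ localFields T vac G :=
  ⟨(h.covariant i).fieldProd hA.1 t, (h.creative i).fieldProd hA.2.1 t,
    fun j => (hA.2.2 i).symm.fieldProd t (h.isLocal i j) (hA.2.2 j)⟩

/-- Covariance and T𝟏 = 0 give T A(-1-k)𝟏 = (k+1) A(-2-k)𝟏. Dividing by k + 1 is the one use of
`torsion_free`; it takes the place of divided powers of `T`. -/
theorem apply_vac_eq_zero (h : IsGenerating T vac G) {A : fieldSubmodule R M}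
    (hc : IsCovariant T A.1) (hA : IsCreative vac A.1) (h₀ : A.1 (-1) vac = 0) (n : ℤ) :
    A.1 n vac = 0 := by
  by_cases hn : 0 ≤ n
  · exact hA n hn
  · have key : ∀ k : ℕ, A.1 (-1 - k) vac = 0 := by
      intro k
      induction k with
      | zero => simpa using h₀
      | succ k ih =>
        have := congrArg (fun f => f vac) (hc (-1 - k))
        simp only [LinearMap.sub_apply, Module.End.mul_apply, ih, h.vac_eq, map_zero, sub_zero,
          LinearMap.smul_apply] at this
        rw [show -1 - (k : ℤ) - 1 = -1 - ((k + 1 : ℕ) : ℤ) by push_cast; ring] at this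
        exact h.torsion_free _ _ (by omega) this.symm
    have := key (-1 - n).toNat
    rwa [show -1 - ((-1 - n).toNat : ℤ) = n by omega] at this

/-- Since A(x)v = 0, locality says (x - z)^N A(x)B(z)v = 0. As B(z)v is truncated, the factors x - z
can be cancelled one at a time by `eq_zero_of_shift`. -/
theorem modeComm_mul_apply_eq_zero {A B : fieldSubmodule R M} {v : M} (hA : ∀ n, A.1 n v = 0)
    (hAB : IsLocal A B) (r s : ℤ) : A.1 r (B.1 s v) = 0 := by
  obtain ⟨N, hN⟩ := hAB
  obtain ⟨s₀, hs₀⟩ := B.2 v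
  have key : ∀ k ≤ N, ∀ r s, modeComm A B ((N - k : ℕ) : ℤ) r s v = 0 := by
    intro k
    induction k with
    | zero => intro _ r s; rw [Nat.sub_zero, hN]; rfl
    | succ k ih =>
      intro hk
      have hrec := ih (by omega)
      refine eq_zero_of_shift (fun r s => ?_) s₀ (fun r s hs => ?_)
      · rw [← sub_eq_zero, ← LinearMap.sub_apply, ← modeComm_succ,
          show ((N - (k + 1) : ℕ) : ℤ) + 1 = ((N - k : ℕ) : ℤ) by omega, hrec]
      · rw [modeComm, LinearMap.sub_apply, LinearMap.smul_apply, contract_apply, contract_apply,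
          finsum_congr (g := fun _ => 0) fun i => by
            rw [contractTerm, hs₀ _ (by omega), map_zero, smul_zero],
          finsum_congr (f := contractTerm _ _ _ _ _ _) (g := fun _ => 0) fun i => by
            rw [contractTerm, hA, map_zero, smul_zero], finsum_zero, smul_zero, sub_zero]
  have := key N le_rfl r s
  rwa [Nat.sub_self, Nat.cast_zero, modeComm_zero, LinearMap.sub_apply, Module.End.mul_apply,
    Module.End.mul_apply, hA, map_zero, sub_zero] at this

/-- Goddard's uniqueness theorem. -/
theorem eq_zero (h : IsGenerating T vac G) {A : fieldSubmodule R M}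
    (hA : A ∈ localFields T vac G) (h₀ : A.1 (-1) vac = 0) : A = 0 := by
  let N : Submodule R M := ⨅ n, LinearMap.ker (A.1 n)
  have hN : ∀ v, v ∈ N ↔ ∀ n, A.1 n v = 0 := fun v => by simp [N, Submodule.mem_iInf]
  -- The vectors killed by all modes of `A` include the vacuum and are stable under the generators.
  have : N = ⊤ := h.span N ((hN _).2 (h.apply_vac_eq_zero hA.1 hA.2.1 h₀)) fun i n v hv =>
    (hN _).2 fun r => modeComm_mul_apply_eq_zero ((hN v).1 hv) (hA.2.2 i) r n
  ext n v
  exact (hN v).1 (this ▸ Submodule.mem_top) n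

/-- The value `A(-1) 𝟏`. -/
def evVac (T : Module.End R M) (vac : M) (G : ι → fieldSubmodule R M) :
    localFields T vac G →ₗ[R] M where
  toFun A := A.1.1 (-1) vac
  map_add' _ _ := rfl
  map_smul' _ _ := rfl

theorem evVac_bijective (h : IsGenerating T vac G) : Function.Bijective (evVac T vac G) := by
  constructor
  · rw [injective_iff_map_eq_zero]
    exact fun A hA => Subtype.ext (h.eq_zero A.2 hA)
  · rw [← LinearMap.range_eq_top]
    refine h.span _ ⟨⟨oneField, h.oneField_mem⟩, ?_⟩ ?_
    · simp [evVac, oneField]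
    · rintro i n _ ⟨A, rfl⟩
      exact ⟨⟨_, h.fieldProd_mem A.2 i n⟩, fieldProd_neg_one_vac (h.creative i) A.2.2.1 n⟩

/-- The field attached to a state. -/
def stateField (h : IsGenerating T vac G) : M ≃ₗ[R] localFields T vac G :=
  (LinearEquiv.ofBijective (evVac T vac G) h.evVac_bijective).symm

theorem stateField_vac (h : IsGenerating T vac G) (v : M) : (h.stateField v).1.1 (-1) vac = v :=
  (LinearEquiv.ofBijective (evVac T vac G) h.evVac_bijective).apply_symm_apply v

theorem eq_stateField (h : IsGenerating T vac G) {A : fieldSubmodule R M}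
    (hA : A ∈ localFields T vac G) : A = (h.stateField (A.1 (-1) vac)).1 :=
  congrArg Subtype.val
    ((LinearEquiv.ofBijective (evVac T vac G) h.evVac_bijective).symm_apply_apply ⟨A, hA⟩).symm

/-- Membership in `localFields` only asks for locality with the generators. The states whose field
is local with `A` form a submodule, stable under the generators by Dong's lemma, hence everything.
-/
theorem isLocal_of_mem (h : IsGenerating T vac G) {A B : fieldSubmodule R M}
    (hA : A ∈ localFields T vac G) (hB : B ∈ localFields T vac G) : IsLocal B A := by
  let N : Submodule R M :=
    { carrier := {v | IsLocal (h.stateField v).1 A}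
      zero_mem' := by
        rw [Set.mem_ofPred_eq, map_zero]; exact IsLocal.zero A
      add_mem' := fun {v w} hv hw => by
        rw [Set.mem_ofPred_eq, map_add]; exact IsLocal.add hv hw
      smul_mem' := fun c v hv => by
        rw [Set.mem_ofPred_eq, map_smul]; exact IsLocal.smul c hv }
  have : N = ⊤ := by
    refine h.span N ?_ fun i n v hv => ?_
    · have h₁ := h.eq_stateField h.oneField_mem
      have h₂ : (oneField : fieldSubmodule R M).1 (-1) vac = vac := by simp [oneField]
      rw [h₂] at h₁
      change IsLocal _ A
      rw [← h₁]
      refine ⟨0, fun r s => ?_⟩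
      rw [Nat.cast_zero, modeComm_zero]
      by_cases h₁ : r = -1 <;> simp [oneField, h₁]
    · have h₁ := h.eq_stateField (h.fieldProd_mem (h.stateField v).2 i n)
      rw [fieldProd_neg_one_vac (h.creative i) (h.stateField v).2.2.1, h.stateField_vac] at h₁
      change IsLocal _ A
      rw [← h₁]
      exact IsLocal.fieldProd n ((h.stateField v).2.2.2 i).symm (hA.2.2 i).symm hv
  rw [h.eq_stateField hB]
  have hmem : B.1 (-1) vac ∈ N := this ▸ Submodule.mem_top
  exact hmem

/-- Both sides belong to `localFields` and have the same value at the vacuum, so uniqueness applies.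
Membership of the right side needs the mutual locality of arbitrary state fields. -/
theorem stateField_apply (h : IsGenerating T vac G) (t : ℤ) (u v : M) :
    (h.stateField ((h.stateField u).1.1 t v)).1 =
      fieldProd t (h.stateField u).1 (h.stateField v).1 := by
  have hu := (h.stateField u).2
  have hv := (h.stateField v).2
  have hm : fieldProd t (h.stateField u).1 (h.stateField v).1 ∈ localFields T vac G :=
    ⟨hu.1.fieldProd hv.1 t, hu.2.1.fieldProd hv.2.1 t,
      fun j => (h.isLocal_of_mem hv hu).fieldProd t (hu.2.2 j) (hv.2.2 j)⟩
  have := h.eq_stateField hm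
  rw [fieldProd_neg_one_vac hu.2.1 hv.2.1, h.stateField_vac] at this
  exact this.symm

/-- The vertex operator reconstructed from a generating family of fields. -/
def modeMap (h : IsGenerating T vac G) : ModeMap R M := fun n =>
  { toFun := fun u => (h.stateField u).1.1 n
    map_add' := fun u v => by rw [map_add]; rfl
    map_smul' := fun c u => by rw [map_smul]; rfl }

theorem modeMap_apply (h : IsGenerating T vac G) (n : ℤ) (u : M) :
    h.modeMap n u = (h.stateField u).1.1 n := rfl

theorem finsum_jacobiRight (h : IsGenerating T vac G) (r s t : ℤ) (u v w : M) :
    ∑ᶠ i, jacobiRight h.modeMap r s t u v w i =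
      modeComm (h.stateField u).1 (h.stateField v).1 t r s w := by
  have h₁ := finite_support_contractTerm (h.stateField u).1.1 (h.stateField v).1 t r s w
  have h₂ := finite_support_contractTerm (h.stateField v).1.1 (h.stateField u).1 t s r w
  rw [modeComm, LinearMap.sub_apply, LinearMap.smul_apply, contract_apply, contract_apply,
    smul_finsum' _ h₂]
  refine Eq.trans ?_ (finsum_sub_distrib h₁ (h₂.subset (Function.support_const_smul_subset
    (t.negOnePow : ℤ) _)))
  refine finsum_congr fun i => ?_
  simp only [jacobiRight, contractTerm, modeMap_apply, smul_sub]
  rw [smul_comm]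

/-- Descending induction on `t` from the order of locality `N`, where both sides are zero. Both
satisfy the same recursion, so at each lower `t` the difference depends on `r + s` only. It may then
be computed at r = 0, where the left side is the single term defining the t-th product. -/
theorem finsum_jacobiLeft (h : IsGenerating T vac G) (r s t : ℤ) (u v w : M) :
    ∑ᶠ i, jacobiLeft h.modeMap r s t u v w i =
      modeComm (h.stateField u).1 (h.stateField v).1 t r s w := by
  obtain ⟨N, hN⟩ := h.isLocal_of_mem (h.stateField v).2 (h.stateField u).2
  set A := (h.stateField u).1
  set B := (h.stateField v).1
  have hterm : ∀ (r s t : ℤ) (i : ℕ), jacobiLeft h.modeMap r s t u v w i =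
      (Ring.choose r i : ℤ) • modeComm A B (t + i) 0 (r + s - i) w := by
    intro r s t i
    rw [jacobiLeft, h.modeMap_apply (r + s - i), h.modeMap_apply (t + i), h.stateField_apply,
      fieldProd_apply]
  have hvan : ∀ (r s t : ℤ) (i : ℕ), (N - t).toNat ≤ i →
      jacobiLeft h.modeMap r s t u v w i = 0 := by
    intro r s t i hi
    rw [hterm, modeComm_eq_zero_of_le hN (by omega), LinearMap.zero_apply, smul_zero]
  have hrec : ∀ r s t : ℤ, ∑ᶠ i, jacobiLeft h.modeMap r s (t + 1) u v w i =
      ∑ᶠ i, jacobiLeft h.modeMap (r + 1) s t u v w i -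
        ∑ᶠ i, jacobiLeft h.modeMap r (s + 1) t u v w i := by
    intro r s t
    rw [finsum_eq_sum_range (n := (N - t).toNat) fun i hi => hvan r s (t + 1) i (by omega),
      finsum_eq_sum_range (n := (N - t).toNat + 1) fun i hi => hvan (r + 1) s t i (by omega),
      finsum_eq_sum_range (n := (N - t).toNat + 1) fun i hi => hvan r (s + 1) t i (by omega),
      Finset.sum_range_succ', Finset.sum_range_succ', add_sub_add_comm, ← Finset.sum_sub_distrib]
    rw [show jacobiLeft h.modeMap (r + 1) s t u v w 0 - jacobiLeft h.modeMap r (s + 1) t u v w 0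
      = 0 by simp only [hterm, Ring.choose_zero_right, sub_eq_zero]; rw [add_right_comm, add_assoc],
      add_zero]
    refine Finset.sum_congr rfl fun i _ => ?_
    simp only [hterm]
    rw [Ring.choose_succ_succ, show r + 1 + s - ((i + 1 : ℕ) : ℤ) = r + s - i by push_cast; ring,
      show r + (s + 1) - ((i + 1 : ℕ) : ℤ) = r + s - i by push_cast; ring,
      show t + ((i + 1 : ℕ) : ℤ) = t + 1 + i by push_cast; ring, ← sub_smul, add_sub_cancel_right]
  have hbase : ∀ s t, ∑ᶠ i, jacobiLeft h.modeMap 0 s t u v w i = modeComm A B t 0 s w := by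
    intro s t
    rw [finsum_eq_single _ 0]
    · rw [hterm]; simp
    · intro i hi
      rw [hterm, Ring.choose_zero_pos ℤ (Nat.pos_of_ne_zero hi), zero_smul]
  have key : ∀ (k : ℕ) (r s : ℤ), ∑ᶠ i, jacobiLeft h.modeMap r s (N - k) u v w i =
      modeComm A B (N - k) r s w := by
    intro k
    induction k with
    | zero =>
      intro r s
      rw [modeComm_eq_zero_of_le hN (by simp), LinearMap.zero_apply]
      exact (finsum_congr fun i => hvan r s _ i (by simp)).trans finsum_zero
    | succ k ih =>
      set f : ℤ → ℤ → M := fun r s =>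
        ∑ᶠ i, jacobiLeft h.modeMap r s (N - (k + 1 : ℕ)) u v w i -
          modeComm A B (N - (k + 1 : ℕ)) r s w
      have hs : ∀ r s, f (r + 1) s = f r (s + 1) := by
        intro r s
        change ∑ᶠ i, jacobiLeft h.modeMap (r + 1) s (N - (k + 1 : ℕ)) u v w i -
            modeComm A B (N - (k + 1 : ℕ)) (r + 1) s w =
          ∑ᶠ i, jacobiLeft h.modeMap r (s + 1) (N - (k + 1 : ℕ)) u v w i -
            modeComm A B (N - (k + 1 : ℕ)) r (s + 1) w
        have h₁ := hrec r s (N - (k + 1 : ℕ))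
        have h₂ := congrArg (fun f => f w) (modeComm_succ A B (N - (k + 1 : ℕ)) r s)
        rw [show (N : ℤ) - ((k + 1 : ℕ) : ℤ) + 1 = N - k by push_cast; ring] at h₁ h₂
        simp only [LinearMap.sub_apply] at h₂
        rw [ih, h₂] at h₁
        rw [sub_eq_sub_iff_sub_eq_sub]
        exact h₁.symm
      intro r s
      rw [← sub_eq_zero]
      change f r s = 0
      have := apply_add_comm_of_shift hs 0 s r
      rw [zero_add] at this
      rw [this]
      simp only [f, hbase, sub_self]
  have := key (N - t).toNat r s
  by_cases ht : t ≤ N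
  · rwa [show (N : ℤ) - ((N - t).toNat : ℤ) = t by omega] at this
  · rw [modeComm_eq_zero_of_le hN (by omega), LinearMap.zero_apply, ← finsum_zero (α := ℕ)]
    exact finsum_congr fun i => hvan _ _ _ _ (by omega)

theorem isVertexAlgebra (h : IsGenerating T vac G) : IsVertexAlgebra h.modeMap vac where
  truncation u v := (h.stateField u).1.2 v
  creative u := h.stateField_vac u
  creative_nonneg u n hn := (h.stateField u).2.2.1 n hn
  jacobi r s t u v w := by rw [h.finsum_jacobiLeft, h.finsum_jacobiRight]

theorem modeMap_generator (h : IsGenerating T vac G) (i : ι) (n : ℤ) :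
    h.modeMap n ((G i).1 (-1) vac) = (G i).1 n := by
  rw [modeMap_apply, ← h.eq_stateField (h.mem i)]

end IsGenerating

end Reconstruction
end

noncomputable section

/-! ### The field of the vacuum and uniqueness of the vertex algebra structure -/

section Uniqueness

theorem neg_one_pow_mul_choose_neg_one (i : ℕ) : ((-1) ^ i * Ring.choose (-1) i : ℤ) = 1 := by
  induction i with
  | zero => simp
  | succ i ih =>
    have := Ring.choose_succ_succ (-1 : ℤ) i
    rw [show (-1 : ℤ) + 1 = 0 by ring, Ring.choose_zero_pos ℤ (by omega)] at this
    rw [pow_succ]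
    linear_combination ih + (-1) ^ i * this

namespace IsVertexAlgebra

variable {R M : Type*} [CommRing R] [AddCommGroup M] [Module R M] {Y Z : ModeMap R M} {vac : M}

/-- The associator formula. -/
theorem apply_apply (h : IsVertexAlgebra Y vac) (s t : ℤ) (u v w : M) :
    Y s (Y t u v) w = ∑ᶠ i, jacobiRight Y 0 s t u v w i := by
  rw [← h.jacobi, finsum_eq_single _ 0]
  · simp [jacobiLeft]
  · intro i hi
    rw [jacobiLeft, Ring.choose_zero_pos ℤ (Nat.pos_of_ne_zero hi), zero_smul]

/-- The Jacobi identity with r = t = -1 and v = w = 𝟏, where all signed binomial coefficients are 1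
and creativity leaves one term on the left. It is used first with u = 𝟏, then with arbitrary u, to
show that Y(𝟏, z) is the identity. -/
theorem apply_vac_eq (h : IsVertexAlgebra Y vac) (s : ℤ) (u : M) :
    Y (s - 1) u vac = ∑ᶠ i : ℕ, Y (-2 - i) u (Y (s + i) vac vac) + Y (s - 1) vac u := by
  have key := h.jacobi (-1) s (-1) u vac vac
  rw [finsum_eq_single _ 0] at key
  swap
  · intro i hi
    rw [jacobiLeft, h.creative_nonneg u (-1 + i) (by omega), map_zero, LinearMap.zero_apply,
      smul_zero]
  have hL : jacobiLeft Y (-1) s (-1) u vac vac 0 = Y (s - 1) u vac := by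
    simp only [jacobiLeft, Nat.cast_zero, add_zero, h.creative, Ring.choose_zero_right, one_smul,
      sub_zero]
    rw [neg_add_eq_sub]
  have hR : ∀ i, jacobiRight Y (-1) s (-1) u vac vac i =
      Y (-2 - i) u (Y (s + i) vac vac) + Y (s - 1 - i) vac (Y (-1 + i) u vac) := by
    intro i
    rw [jacobiRight, neg_one_pow_mul_choose_neg_one, one_smul, Int.negOnePow_neg,
      Int.negOnePow_one, Units.val_neg,
      Units.val_one, neg_smul, one_smul, sub_neg_eq_add]
    rfl
  rw [hL, finsum_congr hR, finsum_add_distrib] at key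
  · rw [key]
    congr 1
    rw [finsum_eq_single _ 0]
    · simp [h.creative]
    · intro i hi
      rw [h.creative_nonneg _ _ (by omega), map_zero]
  · refine (Set.finite_Iio (-s).toNat).subset fun i hi => ?_
    by_contra hn
    rw [Set.mem_Iio, not_lt] at hn
    exact hi (by simp only; rw [h.creative_nonneg _ _ (by omega), map_zero])
  · refine (Set.finite_Iio 1).subset fun i hi => ?_
    by_contra hn
    rw [Set.mem_Iio, not_lt] at hn
    exact hi (by simp only; rw [h.creative_nonneg _ _ (by omega), map_zero])

/-- In `apply_vac_eq` with u = 𝟏 the left side cancels the last term, so the sum is zero. Its term i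
= k is the vector in question, the terms i < k vanish by induction and the terms i > k by
creativity. -/
theorem vac_vac (h : IsVertexAlgebra Y vac) (k : ℕ) : Y (-2 - k) vac vac = 0 := by
  induction k using Nat.strong_induction_on with
  | _ k ih =>
    have := h.apply_vac_eq (-1 - k) vac
    rw [right_eq_add, finsum_eq_single _ k] at this
    · rwa [show (-1 : ℤ) - k + k = -1 by ring, h.creative] at this
    · intro i hi
      rcases lt_or_gt_of_ne hi with hlt | hgt
      · have := ih (k - i - 1) (by omega)
        rw [show (-2 : ℤ) - ((k - i - 1 : ℕ) : ℤ) = -1 - k + i by omega] at this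
        rw [this, map_zero]
      · rw [h.creative_nonneg _ _ (by omega), map_zero]

/-- The field of the vacuum vector is the identity. -/
theorem vac_apply (h : IsVertexAlgebra Y vac) (n : ℤ) (u : M) :
    Y n vac u = if n = -1 then u else 0 := by
  have hv : ∀ m : ℤ, m ≠ -1 → Y m vac vac = 0 := by
    intro m hm
    by_cases h0 : 0 ≤ m
    · exact h.creative_nonneg _ _ h0
    · have := h.vac_vac (-2 - m).toNat
      rwa [show (-2 : ℤ) - ((-2 - m).toNat : ℤ) = m by omega] at this
  have key := h.apply_vac_eq (n + 1) u
  rw [add_sub_cancel_right] at key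
  -- For n ≤ -2 the only surviving term of the sum is Y n u 𝟏, which cancels the left side; for n ≥
  -- -1 the sum is zero and creativity gives the value.
  by_cases hn : n ≤ -2
  · rw [finsum_eq_single _ (-2 - n).toNat] at key
    · rw [show n + 1 + ((-2 - n).toNat : ℤ) = -1 by omega, h.creative,
        show (-2 : ℤ) - ((-2 - n).toNat : ℤ) = n by omega, left_eq_add] at key
      rw [key, if_neg (by omega)]
    · intro i hi
      rw [hv _ (by omega), map_zero]
  · rw [finsum_congr (g := fun _ => 0) fun i => by rw [hv _ (by omega), map_zero], finsum_zero,
      zero_add] at key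
    rw [← key]
    split_ifs with h₁
    · rw [h₁, h.creative]
    · exact h.creative_nonneg _ _ (by omega)

/-- A vertex algebra structure is determined by the fields of a set of generators. -/
theorem eq_of_generators (hY : IsVertexAlgebra Y vac) (hZ : IsVertexAlgebra Z vac) {ι : Type*}
    (g : ι → M) (hg : ∀ i n, Y n (g i) = Z n (g i))
    (hspan : ∀ N : Submodule R M, vac ∈ N → (∀ i n, ∀ v ∈ N, Y n (g i) v ∈ N) → N = ⊤) :
    Y = Z := by
  let N : Submodule R M := ⨅ n, LinearMap.ker (Y n - Z n)
  have hN : ∀ v, v ∈ N ↔ ∀ n, Y n v = Z n v := fun v => by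
    simp [N, Submodule.mem_iInf, sub_eq_zero]
  have : N = ⊤ := by
    refine hspan N ((hN _).2 fun n => ?_) fun i t v hv => (hN _).2 fun s => ?_
    · ext u
      rw [hY.vac_apply, hZ.vac_apply]
    · ext w
      -- The associator formula involves only the fields of `g i` and `v`, on which the two
      -- structures agree.
      have hR : jacobiRight Y 0 s t (g i) v w = jacobiRight Z 0 s t (g i) v w := by
        funext k
        simp only [jacobiRight, hg, (hN v).1 hv]
      rw [hY.apply_apply, hR, ← hZ.apply_apply, hg]
  funext n
  ext1 v
  exact (hN v).1 (this ▸ Submodule.mem_top) n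

end IsVertexAlgebra

end Uniqueness

/-! ## Representations of the Virasoro algebra -/

section VirasoroRep

variable {R M : Type*} [CommRing R] [AddCommGroup M] [Module R M]

/-- The operators `L n` satisfy the Virasoro relations with quasicentral charge `c'`. -/
def IsVirasoroRep (c' : R) (L : ℤ → Module.End R M) : Prop :=
  ∀ m n v, L m (L n v) = L n (L m v) + ((m - n : ℤ) : R) • L (m + n) v +
    (if m + n = 0 then ((Ring.choose (m + 1) 3 : ℤ) : R) * c' else 0) • v

namespace IsVirasoroRep

variable {c' : R} {L : ℤ → Module.End R M}

theorem truncated (h : IsVirasoroRep c' L) {vac : M} (hvac : ∀ n, -1 ≤ n → L n vac = 0)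
    (hspan : ∀ N : Submodule R M, vac ∈ N → (∀ n, ∀ v ∈ N, L n v ∈ N) → N = ⊤) (w : M) :
    ∃ n₀ : ℤ, ∀ n, n₀ < n → L n w = 0 := by
  let N : Submodule R M :=
    { carrier := {v | ∃ n₀ : ℤ, ∀ n, n₀ < n → L n v = 0}
      zero_mem' := ⟨0, fun n _ => map_zero _⟩
      add_mem' := fun {v w} ⟨m, hm⟩ ⟨n, hn⟩ => ⟨max m n, fun k hk => by
        rw [map_add, hm k (by omega), hn k (by omega), add_zero]⟩
      smul_mem' := fun c v ⟨m, hm⟩ => ⟨m, fun k hk => by rw [map_smul, hm k hk, smul_zero]⟩ }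
  have hN : N = ⊤ := by
    refine hspan N ⟨-1, fun n hn => hvac n hn.le⟩ ?_
    rintro m v ⟨n₀, hn₀⟩
    -- The three bounds kill L(n)v, L(n+m)v and the central term of [L(n), L(m)].
    refine ⟨max (max n₀ (n₀ - m)) (-m), fun n hn => ?_⟩
    rw [h, hn₀ n (by omega), hn₀ (n + m) (by omega), if_neg (by omega)]
    simp
  have hw : w ∈ N := hN ▸ Submodule.mem_top
  exact hw

variable {A : fieldSubmodule R M}

theorem modeComm_zero (h : IsVirasoroRep c' L) (hA : ∀ n, A.1 n = L (n - 1)) (r s : ℤ) :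
    modeComm A A 0 r s = ((r - s : ℤ) : R) • A.1 (r + s - 1) +
      (if r + s = 2 then ((Ring.choose r 3 : ℤ) : R) * c' else 0) • 1 := by
  ext v
  rw [_root_.modeComm_zero, hA, hA, hA]
  simp only [LinearMap.sub_apply, Module.End.mul_apply, h (r - 1) (s - 1) v, LinearMap.add_apply,
    LinearMap.smul_apply, Module.End.one_apply]
  rw [show r - 1 + (s - 1) = r + s - 1 - 1 by ring, sub_add_cancel,
    show r - 1 - (s - 1) = r - s by ring, add_assoc, add_sub_cancel_left]
  congr 2
  exact if_congr (by omega) rfl rfl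

/-- By Pascal's rule each factor x - z lowers the central coefficient by one degree, through
binom(r, 3), binom(r, 2), r, 1, 0. The noncentral coefficient r - s becomes 2 and then 0. Four
factors therefore suffice over any ring. -/
theorem isLocal (h : IsVirasoroRep c' L) (hA : ∀ n, A.1 n = L (n - 1)) : IsLocal A A := by
  have ch : ∀ (r : ℤ) (k : ℕ), Ring.choose (r + 1) (k + 1) - Ring.choose r (k + 1) =
      Ring.choose r k := fun r k => by rw [Ring.choose_succ_succ]; ring
  have h1 : ∀ r s, modeComm A A 1 r s = (2 : R) • A.1 (r + s) +
      (if r + s = 1 then ((Ring.choose r 2 : ℤ) : R) * c' else 0) • 1 := by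
    intro r s
    have := modeComm_succ A A 0 r s
    rw [zero_add] at this
    rw [this, h.modeComm_zero hA, h.modeComm_zero hA, add_sub_add_comm,
      show r + 1 + s - 1 = r + s by ring, show r + (s + 1) - 1 = r + s by ring, ← sub_smul,
      ← sub_smul]
    congr 2
    · push_cast; ring
    · rw [← ch r 2]
      split_ifs <;> first | omega | (push_cast; ring)
  have h2 : ∀ r s, modeComm A A 2 r s =
      (if r + s = 0 then ((Ring.choose r 1 : ℤ) : R) * c' else 0) • 1 := by
    intro r s
    rw [show (2 : ℤ) = 1 + 1 from rfl, modeComm_succ, h1, h1, add_sub_add_comm,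
      show r + (s + 1) = r + 1 + s by ring, sub_self, zero_add, ← sub_smul]
    congr 1
    rw [← ch r 1]
    split_ifs <;> first | omega | (push_cast; ring)
  have h3 : ∀ r s, modeComm A A 3 r s = (if r + s = -1 then c' else 0) • 1 := by
    intro r s
    rw [show (3 : ℤ) = 2 + 1 from rfl, modeComm_succ, h2, h2, ← sub_smul]
    congr 1
    simp only [Ring.choose_one_right]
    split_ifs <;> first | omega | (push_cast; ring)
  refine ⟨4, fun r s => ?_⟩
  rw [show ((4 : ℕ) : ℤ) = 3 + 1 from rfl, modeComm_succ, h3, h3, ← sub_smul]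
  split_ifs <;> first | omega | simp

theorem isCovariant (h : IsVirasoroRep c' L) (hA : ∀ n, A.1 n = L (n - 1)) :
    IsCovariant (L (-1)) A.1 := by
  intro n
  have h₁ := h.modeComm_zero hA 0 n
  rw [_root_.modeComm_zero, Ring.choose_zero_pos ℤ (by omega)] at h₁
  rw [show L (-1) = A.1 0 by rw [hA, zero_sub], h₁, zero_sub, Int.cast_smul_eq_zsmul, zero_add]
  simp

theorem isGenerating (h : IsVirasoroRep c' L) (hA : ∀ n, A.1 n = L (n - 1)) {vac : M}
    (hvac : ∀ n, -1 ≤ n → L n vac = 0)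
    (hspan : ∀ N : Submodule R M, vac ∈ N → (∀ n, ∀ v ∈ N, L n v ∈ N) → N = ⊤)
    (htf : ∀ (n : ℤ) (v : M), n ≠ 0 → n • v = 0 → v = 0) :
    IsGenerating (L (-1)) vac (fun _ : Unit => A) where
  vac_eq := hvac _ le_rfl
  covariant _ := h.isCovariant hA
  creative _ n hn := by rw [hA]; exact hvac _ (by omega)
  isLocal _ _ := h.isLocal hA
  span N h₁ h₂ := hspan N h₁ fun n v hv => by
    have := h₂ () (n + 1) v hv
    rwa [hA, add_sub_cancel_right] at this
  torsion_free := htf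

end IsVirasoroRep

end VirasoroRep

/-! ## The Virasoro Fock space -/

section VirasoroFock

variable {R : Type*} [CommRing R] (c' : R)

attribute [local instance] LieRing.ofAssociativeRing

theorem envL_comm (m n : ℤ) : envL c' m * envL c' n - envL c' n * envL c' m =
    ((m - n : ℤ) : R) • envL c' (m + n) +
      (if m + n = 0 then ((Ring.choose (m + 1) 3 : ℤ) : R) * c' else 0) • envK c' := by
  have h : ⁅VirasoroAlgebra.L c' m, VirasoroAlgebra.L c' n⁆ = VirasoroAlgebra.bracketLL c' m n := by
    rw [VirasoroAlgebra.lie_def]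
    change VirasoroAlgebra.bracketAux c' (Finsupp.single m 1) (Finsupp.single n 1) = _
    rw [VirasoroAlgebra.bracketAux_single, one_mul, one_smul]
  have h₁ := LieHom.map_lie (UniversalEnvelopingAlgebra.ι R) (VirasoroAlgebra.L c' m)
    (VirasoroAlgebra.L c' n)
  rw [h, LieRing.of_associative_ring_bracket] at h₁
  rw [envL, envL, ← h₁, VirasoroAlgebra.bracketLL, map_add, map_smul, map_smul]
  rfl

theorem virasoroAlgebra_mem (N : Submodule R (VirasoroAlgebra R c'))
    (hL : ∀ n, VirasoroAlgebra.L c' n ∈ N) (hK : VirasoroAlgebra.kappa c' ∈ N)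
    (x : VirasoroAlgebra R c') : x ∈ N := by
  let N' : Submodule R ((ℤ →₀ R) × R) := N
  have h₁ : ∀ f : ℤ →₀ R, (f, (0 : R)) ∈ N' := by
    intro f
    induction f using Finsupp.induction_linear with
    | zero => exact N'.zero_mem
    | add f g hf hg => simpa using N'.add_mem hf hg
    | single n a =>
      have h := N'.smul_mem a (hL n)
      rwa [VirasoroAlgebra.L, Prod.smul_mk, Finsupp.smul_single, smul_eq_mul, mul_one,
        smul_zero] at h
  have h₂ : (0, x.2) ∈ N' := by
    have h := N'.smul_mem x.2 hK
    rwa [VirasoroAlgebra.kappa, Prod.smul_mk, smul_eq_mul, mul_one, smul_zero] at h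
  have h := N'.add_mem (h₁ x.1) h₂
  rw [Prod.mk_add_mk, add_zero, zero_add] at h
  exact h

/-- The canonical map from the Lie algebra factors through `S`. Its lift followed by the inclusion
of `S` is the identity by the universal property. -/
theorem envSubalgebra_eq_top (S : Subalgebra R (VirU R c')) (hL : ∀ n, envL c' n ∈ S)
    (hK : envK c' ∈ S) : S = ⊤ := by
  have hx : ∀ x : VirasoroAlgebra R c', UniversalEnvelopingAlgebra.ι R x ∈ S :=
    virasoroAlgebra_mem c' ((Subalgebra.toSubmodule S).comap
      (UniversalEnvelopingAlgebra.ι R : VirasoroAlgebra R c' →ₗ⁅R⁆ VirU R c').toLinearMap) hL hK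
  let φ : VirasoroAlgebra R c' →ₗ⁅R⁆ S :=
    { toFun := fun x => ⟨UniversalEnvelopingAlgebra.ι R x, hx x⟩
      map_add' := fun x y => Subtype.ext (map_add _ x y)
      map_smul' := fun a x => Subtype.ext (map_smul _ a x)
      map_lie' := fun {x y} => Subtype.ext (LieHom.map_lie _ x y) }
  have h : S.val.comp (UniversalEnvelopingAlgebra.lift R φ) = AlgHom.id R _ := by
    apply UniversalEnvelopingAlgebra.hom_ext
    ext x
    change (UniversalEnvelopingAlgebra.lift R φ (UniversalEnvelopingAlgebra.ι R x) : VirU R c') = _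
    rw [UniversalEnvelopingAlgebra.lift_ι_apply]
    rfl
  rw [eq_top_iff]
  intro x _
  rw [show x = S.val (UniversalEnvelopingAlgebra.lift R φ x) from
    (congrArg (fun f => f x) h).symm]
  exact Subtype.property _

theorem envK_comm (u : VirU R c') : envK c' * u = u * envK c' := by
  have h : ∀ x : VirasoroAlgebra R c', UniversalEnvelopingAlgebra.ι R x * envK c' =
      envK c' * UniversalEnvelopingAlgebra.ι R x := by
    intro x
    have h₁ := LieHom.map_lie (UniversalEnvelopingAlgebra.ι R) x (VirasoroAlgebra.kappa c')
    have h₂ : ⁅x, VirasoroAlgebra.kappa c'⁆ = 0 := map_zero (VirasoroAlgebra.bracketAux c' x.1)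
    rw [h₂, map_zero, LieRing.of_associative_ring_bracket] at h₁
    exact (sub_eq_zero.1 h₁.symm)
  have : Subalgebra.centralizer R {envK c'} = ⊤ := by
    refine envSubalgebra_eq_top c' _ (fun n => ?_) ?_
    · rw [Subalgebra.mem_centralizer_iff]
      rintro _ rfl
      exact (h _).symm
    · rw [Subalgebra.mem_centralizer_iff]
      rintro _ rfl
      rfl
  have hu : u ∈ Subalgebra.centralizer R {envK c'} := this ▸ Algebra.mem_top
  exact (Subalgebra.mem_centralizer_iff R).1 hu _ rfl

theorem exists_smul_virVac (v : VirV c') : ∃ u : VirU R c', u • virVac c' = v := by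
  obtain ⟨w, rfl⟩ := Submodule.Quotient.mk_surjective _ v
  obtain ⟨u, rfl⟩ := Submodule.Quotient.mk_surjective _ w
  refine ⟨u, ?_⟩
  rw [virVac, virV0, ← Submodule.Quotient.mk_smul, ← Submodule.Quotient.mk_smul, smul_eq_mul,
    mul_one]

theorem envK_smul (v : VirV c') : envK c' • v = v := by
  have h : envK c' • virVac c' = virVac c' := by
    rw [← sub_eq_zero]
    nth_rewrite 2 [← one_smul (VirU R c') (virVac c')]
    rw [← sub_smul, virVac, virV0, ← Submodule.Quotient.mk_smul, ← Submodule.Quotient.mk_smul,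
      smul_eq_mul, mul_one, (Submodule.Quotient.mk_eq_zero (vermaIdeal c')).2,
      Submodule.Quotient.mk_zero]
    exact Submodule.subset_span (Or.inr rfl)
  obtain ⟨u, rfl⟩ := exists_smul_virVac c' v
  rw [smul_smul, envK_comm, ← smul_smul, h]

theorem virL_apply (n : ℤ) (v : VirV c') : virL c' n v = envL c' n • v := rfl

theorem virL_isVirasoroRep : IsVirasoroRep c' (virL c') := by
  intro m n v
  have h := congrArg (fun u => u • v) (envL_comm c' m n)
  simp only [sub_smul, add_smul, smul_assoc, envK_smul, mul_smul] at h
  rw [sub_eq_iff_eq_add'] at h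
  simp only [virL_apply]
  rw [h, add_assoc]

theorem virL_virVac {n : ℤ} (hn : -1 ≤ n) : virL c' n (virVac c') = 0 := by
  rw [virL_apply, virVac, ← Submodule.Quotient.mk_smul, Submodule.Quotient.mk_eq_zero]
  rcases hn.eq_or_lt with rfl | hn
  · exact Submodule.subset_span rfl
  · rw [virV0, ← Submodule.Quotient.mk_smul, smul_eq_mul, mul_one,
      (Submodule.Quotient.mk_eq_zero (vermaIdeal c')).2]
    · exact Submodule.zero_mem _
    · exact Submodule.subset_span (Or.inl ⟨n, by simp; omega, rfl⟩)

/-- The elements of the enveloping algebra that preserve `N` form a subalgebra containing all L(n),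
and also κ, which acts as 1. Cyclicity of V then finishes the proof. -/
theorem virV_submodule_eq_top (N : Submodule R (VirV c')) (h₁ : virVac c' ∈ N)
    (h₂ : ∀ n, ∀ v ∈ N, virL c' n v ∈ N) : N = ⊤ := by
  let S : Subalgebra R (VirU R c') :=
    { carrier := {u | ∀ v ∈ N, u • v ∈ N}
      mul_mem' := fun {a b} ha hb v hv => by rw [mul_smul]; exact ha _ (hb _ hv)
      add_mem' := fun {a b} ha hb v hv => by rw [add_smul]; exact N.add_mem (ha _ hv) (hb _ hv)
      algebraMap_mem' := fun r v hv => by rw [algebraMap_smul]; exact N.smul_mem r hv }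
  have hS : S = ⊤ := envSubalgebra_eq_top c' S h₂ fun v hv => by rwa [envK_smul]
  rw [eq_top_iff]
  intro v _
  obtain ⟨u, rfl⟩ := exists_smul_virVac c' v
  exact (hS ▸ Algebra.mem_top : u ∈ S) _ h₁

/-- The field `L(z)` on the Virasoro Fock space. -/
def virField : fieldSubmodule R (VirV c') :=
  ⟨fun n => virL c' (n - 1), fun w => by
    obtain ⟨n₀, h⟩ := (virL_isVirasoroRep c').truncated (fun _ => virL_virVac c')
      (virV_submodule_eq_top c') w
    exact ⟨n₀ + 1, fun n hn => h _ (by omega)⟩⟩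

theorem virField_apply (n : ℤ) : (virField c').1 n = virL c' (n - 1) := rfl

/-- The covariance of all state fields is recorded because it yields the translation axiom of the
completion. -/
theorem exists_isVirasoroVertexOperator
    (h : ∀ (n : ℤ) (v : VirV c'), n ≠ 0 → n • v = 0 → v = 0) :
    ∃ Y : ModeMap R (VirV c'),
      (IsVirasoroVertexOperator c' Y ∧ ∀ Z, IsVirasoroVertexOperator c' Z → Z = Y) ∧
        ∀ u, IsCovariant (virL c' (-1)) (fun n => Y n u) := by
  have hg := (virL_isVirasoroRep c').isGenerating (virField_apply c') (fun _ => virL_virVac c')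
    (virV_submodule_eq_top c') h
  have hω : ∀ n, hg.modeMap (n + 1) (virOmega c') = virL c' n := fun n => by
    have := hg.modeMap_generator () (n + 1)
    rwa [virField_apply, virField_apply, add_sub_cancel_right] at this
  refine ⟨hg.modeMap, ⟨⟨hg.isVertexAlgebra, hω⟩, fun Z hZ => ?_⟩, fun u => (hg.stateField u).2.1⟩
  refine hZ.vertexAlgebra.eq_of_generators hg.isVertexAlgebra (fun _ : Unit => virOmega c')
    (fun _ n => ?_) fun N h₁ h₂ => ?_
  · have h₁ := hZ.omega (n - 1)
    have h₂ := hω (n - 1)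
    rw [sub_add_cancel] at h₁ h₂
    rw [h₁, h₂]
  · refine virV_submodule_eq_top c' N h₁ fun n v hv => ?_
    rw [← hZ.omega]
    exact h₂ () (n + 1) v hv

end VirasoroFock
end

noncomputable section

/-! ## A free field realization of the Virasoro algebra -/

section FreeField

open MvPolynomial

theorem MvPolynomial.pderiv_comm {σ K : Type*} [CommRing K] (i j : σ) (f : MvPolynomial σ K) :
    pderiv i (pderiv j f) = pderiv j (pderiv i f) := by
  classical
  have h : ⁅(pderiv i : Derivation K (MvPolynomial σ K) (MvPolynomial σ K)),
      (pderiv j : Derivation K (MvPolynomial σ K) (MvPolynomial σ K))⁆ = 0 := by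
    refine MvPolynomial.derivation_ext (fun k => ?_)
    rw [Derivation.commutator_apply, pderiv_X, pderiv_X, Pi.single_apply, Pi.single_apply]
    split_ifs <;> simp
  have := congrArg (fun D => D f) h
  rwa [Derivation.commutator_apply, Derivation.zero_apply, sub_eq_zero] at this

theorem MvPolynomial.eq_C_of_pderiv_eq_zero {σ K : Type*} [CommRing K] [IsDomain K] [CharZero K]
    {f : MvPolynomial σ K} (h : ∀ i, pderiv i f = 0) : f = C (constantCoeff f) := by
  classical
  ext m
  rw [coeff_C]
  split_ifs with hm
  · rw [← hm, constantCoeff_eq]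
  · obtain ⟨i, hi⟩ := Finsupp.ne_iff.1 (Ne.symm hm)
    have h₁ := coeff_pderiv (i := i) f (m - Finsupp.single i 1)
    rw [h, coeff_zero, tsub_add_cancel_of_le] at h₁
    · refine (mul_eq_zero.1 h₁.symm).resolve_right ?_
      exact Nat.cast_add_one_ne_zero _
    · rw [Finsupp.single_le_iff]
      exact Nat.one_le_iff_ne_zero.2 hi

variable (K : Type*) [Field K]

/-- The Fock space of a pair of free fields. -/
abbrev FockSpace : Type _ := MvPolynomial (Bool × ℕ) K

variable {K}

/-- The modes of the two free fields: creation operators in negative degree and annihilation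
operators in positive degree. -/
def fockMode (ε : Bool) : ℤ → Module.End K (FockSpace K)
  | Int.negSucc j => LinearMap.mulLeft K (X (ε, j))
  | Int.ofNat 0 => 0
  | Int.ofNat (j + 1) => ((j + 1 : ℕ) : K) • (pderiv (!ε, j)).toLinearMap

theorem fockMode_negSucc (ε : Bool) (j : ℕ) (f : FockSpace K) :
    fockMode ε (Int.negSucc j) f = X (ε, j) * f := rfl

theorem fockMode_zero (ε : Bool) : fockMode ε 0 = (0 : Module.End K (FockSpace K)) := rfl

theorem fockMode_succ (ε : Bool) (j : ℕ) (f : FockSpace K) :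
    fockMode ε ((j + 1 : ℕ) : ℤ) f = ((j + 1 : ℕ) : K) • pderiv (!ε, j) f := rfl

theorem int_cases (n : ℤ) :
    (∃ j : ℕ, n = Int.negSucc j) ∨ n = 0 ∨ ∃ j : ℕ, n = ((j + 1 : ℕ) : ℤ) := by
  rcases n with (_ | j) | j
  · exact .inr (.inl rfl)
  · exact .inr (.inr ⟨j, rfl⟩)
  · exact .inl ⟨j, rfl⟩

theorem fockMode_comm (ε ε' : Bool) (m n : ℤ) (f : FockSpace K) :
    fockMode ε m (fockMode ε' n f) = fockMode ε' n (fockMode ε m f) +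
      (if m + n = 0 ∧ ε' = !ε then (m : K) else 0) • f := by
  rcases int_cases m with ⟨i, rfl⟩ | rfl | ⟨i, rfl⟩ <;>
    rcases int_cases n with ⟨j, rfl⟩ | rfl | ⟨j, rfl⟩ <;>
      simp only [fockMode_negSucc, fockMode_zero, fockMode_succ, LinearMap.zero_apply, map_zero,
        zero_add]
  · rw [if_neg (by rintro ⟨h, -⟩; omega), zero_smul]; ring
  · rw [if_neg (by rintro ⟨h, -⟩; omega), zero_smul]
  · rw [pderiv_mul]
    by_cases h : i = j ∧ ε' = !ε
    · obtain ⟨rfl, rfl⟩ := h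
      rw [if_pos ⟨by omega, rfl⟩, Bool.not_not, pderiv_X_self, one_mul, smul_add, mul_smul_comm,
        Int.cast_negSucc, neg_smul]
      abel
    · rw [if_neg, pderiv_X_of_ne, zero_mul, zero_add, zero_smul, add_zero, mul_smul_comm]
      · rintro h'
        rw [Prod.mk.injEq] at h'
        exact h ⟨h'.2, by rw [h'.1, Bool.not_not]⟩
      · rintro ⟨h₁, h₂⟩
        exact h ⟨by omega, h₂⟩
  · simp
  · simp
  · rw [if_neg (by rintro ⟨h, -⟩; omega), zero_smul]
  · rw [pderiv_mul]
    by_cases h : i = j ∧ ε' = !ε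
    · obtain ⟨rfl, rfl⟩ := h
      rw [if_pos ⟨by omega, rfl⟩, pderiv_X_self, one_mul, smul_add, mul_smul_comm, Int.cast_natCast]
      abel
    · rw [if_neg, pderiv_X_of_ne, zero_mul, zero_add, zero_smul, add_zero, mul_smul_comm]
      · rintro h'
        rw [Prod.mk.injEq] at h'
        exact h ⟨h'.2.symm, h'.1⟩
      · rintro ⟨h₁, h₂⟩
        exact h ⟨by omega, h₂⟩
  · rw [if_neg (by rintro ⟨h, -⟩; omega), zero_smul]
  · rw [if_neg (by rintro ⟨h, -⟩; omega), zero_smul, add_zero, Derivation.map_smul,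
      Derivation.map_smul,
      smul_comm, MvPolynomial.pderiv_comm]

/-- The free fields. -/
def fockField (ε : Bool) : fieldSubmodule K (FockSpace K) :=
  ⟨fockMode ε, fun f => by
    classical
    refine ⟨(f.vars.image Prod.snd).sup id + 1, fun n hn => ?_⟩
    rcases int_cases n with ⟨j, rfl⟩ | rfl | ⟨j, rfl⟩
    · omega
    · rfl
    · rw [fockMode_succ, pderiv_eq_zero_of_notMem_vars, smul_zero]
      intro h
      have := Finset.le_sup (f := id) (Finset.mem_image_of_mem Prod.snd h)
      simp only [id] at this
      omega⟩

theorem fockField_apply (ε : Bool) (n : ℤ) :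
    (fockField ε : fieldSubmodule K (FockSpace K)).1 n = fockMode ε n := rfl

theorem contractTerm_neg_one {R M : Type*} [CommRing R] [AddCommGroup M] [Module R M]
    (A B : ℤ → Module.End R M) (r s : ℤ) (w : M) (i : ℕ) :
    contractTerm A B (-1) r s w i = A (r - 1 - i) (B (s + i) w) := by
  rw [contractTerm, neg_one_pow_mul_choose_neg_one, one_smul]
  rfl

/-- The operators of the Virasoro algebra on the Fock space. -/
def fockL (μ : K) (n : ℤ) : Module.End K (FockSpace K) :=
  (fieldProd (-1) (fockField false) (fockField true)).1 (n + 1) -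
    ((n + 1 : ℤ) : K) • (fockMode false n + μ • fockMode true n)

theorem fockL_apply (μ : K) (n : ℤ) (f : FockSpace K) : fockL μ n f =
    ∑ᶠ i : ℕ, fockMode false (-1 - i) (fockMode true (n + 1 + i) f) +
      ∑ᶠ i : ℕ, fockMode true (n - i) (fockMode false i f) -
        ((n + 1 : ℤ) : K) • (fockMode false n f + μ • fockMode true n f) := by
  rw [fockL, LinearMap.sub_apply, fieldProd_apply, modeComm, LinearMap.sub_apply,
    LinearMap.smul_apply, contract_apply, contract_apply, Int.negOnePow_neg, Int.negOnePow_one,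
    Units.val_neg, Units.val_one, neg_smul, one_smul, sub_neg_eq_add]
  simp only [contractTerm_neg_one, fockField_apply, zero_sub, zero_add, add_sub_cancel_right]
  rfl

theorem finite_support_fock (ε : Bool) (A : ℤ → Module.End K (FockSpace K)) (s : ℤ)
    (f : FockSpace K) :
    (Function.support fun i : ℕ => A i (fockMode ε (s + i) f)).Finite := by
  obtain ⟨n, hn⟩ := (fockField ε).2 f
  refine (Set.finite_Iio (n - s + 1).toNat).subset fun i hi => ?_
  by_contra h
  rw [Set.mem_Iio, not_lt] at h
  exact hi (by
    simp only
    rw [← fockField_apply, hn _ (by omega), map_zero])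

/-- The normally ordered product of two modes, summed over half of the indices. -/
def fockSum (ε : Bool) (d s : ℤ) (f : FockSpace K) : FockSpace K :=
  ∑ᶠ i : ℕ, fockMode (!ε) (d - i) (fockMode ε (s + i) f)

/-- A mode contracts only with the factor of the opposite kind, hence for at most one index of the
sum. Here this is the outer factor, at i = d + m, and the condition says that this index is in
range. In `fockSum_fockMode_not` it is the inner factor, at i = -s - m. -/
theorem fockSum_fockMode_self (ε : Bool) (d s m : ℤ) (f : FockSpace K) :
    fockSum ε d s (fockMode ε m f) = fockMode ε m (fockSum ε d s f) +
      if 0 ≤ d + m then (-m : K) • fockMode ε (d + s + m) f else 0 := by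
  have h : ∀ i : ℕ, fockMode (!ε) (d - i) (fockMode ε (s + i) (fockMode ε m f)) =
      fockMode ε m (fockMode (!ε) (d - i) (fockMode ε (s + i) f)) +
        if d - i + m = 0 then (-m : K) • fockMode ε (s + i) f else 0 := by
    intro i
    rw [fockMode_comm ε ε (s + i) m, if_neg (by simp), zero_smul, add_zero,
      fockMode_comm (!ε) ε _ m]
    congr 1
    simp only [Bool.not_not, and_true, ite_smul, zero_smul]
    split_ifs with h0
    · rw [show d - (i : ℤ) = -m by omega, Int.cast_neg]
    · rfl
  rw [fockSum, finsum_congr h, finsum_add_distrib, fockSum]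
  · congr 1
    · exact ((fockMode ε m).toAddMonoidHom.map_finsum
        (finite_support_fock ε (fun i => fockMode (!ε) (d - i)) s f)).symm
    · split_ifs with h0
      · rw [finsum_eq_single _ (d + m).toNat, if_pos (by omega),
          show s + ((d + m).toNat : ℤ) = d + s + m by omega]
        · exact fun i hi => if_neg (by omega)
      · exact (finsum_congr fun i : ℕ => if_neg (show ¬ d - (i : ℤ) + m = 0 by omega)).trans
          finsum_zero
  · exact finite_support_fock ε (fun i => fockMode ε m * fockMode (!ε) (d - i)) s f
  · refine (Set.finite_singleton (d + m).toNat).subset fun i hi => ?_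
    by_contra hn
    rw [Set.mem_singleton_iff] at hn
    exact hi (if_neg (by omega))

theorem fockSum_fockMode_not (ε : Bool) (d s m : ℤ) (f : FockSpace K) :
    fockSum ε d s (fockMode (!ε) m f) = fockMode (!ε) m (fockSum ε d s f) +
      if s + m ≤ 0 then (-m : K) • fockMode (!ε) (d + s + m) f else 0 := by
  have h : ∀ i : ℕ, fockMode (!ε) (d - i) (fockMode ε (s + i) (fockMode (!ε) m f)) =
      fockMode (!ε) m (fockMode (!ε) (d - i) (fockMode ε (s + i) f)) +
        if s + i + m = 0 then (-m : K) • fockMode (!ε) (d - i) f else 0 := by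
    intro i
    rw [fockMode_comm ε (!ε) (s + i) m, map_add, fockMode_comm (!ε) (!ε) _ m, if_neg (by simp),
      zero_smul, add_zero, map_smul]
    congr 1
    simp only [and_true, ite_smul, zero_smul]
    split_ifs with h0
    · rw [show s + (i : ℤ) = -m by omega, Int.cast_neg]
    · rfl
  rw [fockSum, finsum_congr h, finsum_add_distrib, fockSum]
  · congr 1
    · exact ((fockMode (!ε) m).toAddMonoidHom.map_finsum
        (finite_support_fock ε (fun i => fockMode (!ε) (d - i)) s f)).symm
    · split_ifs with h0
      · rw [finsum_eq_single _ (-s - m).toNat, if_pos (by omega),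
          show d - ((-s - m).toNat : ℤ) = d + s + m by omega]
        · exact fun i hi => if_neg (by omega)
      · exact (finsum_congr fun i : ℕ => if_neg (show ¬ s + (i : ℤ) + m = 0 by omega)).trans
          finsum_zero
  · exact finite_support_fock ε (fun i => fockMode (!ε) m * fockMode (!ε) (d - i)) s f
  · refine (Set.finite_singleton (-s - m).toNat).subset fun i hi => ?_
    by_contra hn
    rw [Set.mem_singleton_iff] at hn
    exact hi (if_neg (by omega))

theorem fockL_eq (μ : K) (n : ℤ) (f : FockSpace K) : fockL μ n f =
    fockSum true (-1) (n + 1) f + fockSum false n 0 f -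
      ((n + 1 : ℤ) : K) • (fockMode false n f + μ • fockMode true n f) := by
  rw [fockL_apply, fockSum, fockSum]
  simp

/-- The anomaly in the commutator of the Virasoro operators with the modes. -/
def fockAnomaly (μ : K) (ε : Bool) (n m : ℤ) : K :=
  if n + m = 0 then ((n * (n + 1) : ℤ) : K) * cond ε 1 μ else 0

/-- The contraction conditions for the two half-sums are complementary, so exactly one of them
contributes the term of a primary field of weight one. The background charge is linear in the modes
and adds only a scalar. -/
theorem fockL_fockMode (μ : K) (ε : Bool) (n m : ℤ) (f : FockSpace K) :
    fockL μ n (fockMode ε m f) = fockMode ε m (fockL μ n f) - (m : K) • fockMode ε (n + m) f -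
      fockAnomaly μ ε n m • f := by
  have key : fockSum true (-1) (n + 1) (fockMode ε m f) + fockSum false n 0 (fockMode ε m f) =
      fockMode ε m (fockSum true (-1) (n + 1) f + fockSum false n 0 f) -
        (m : K) • fockMode ε (n + m) f := by
    cases ε
    · have h₁ := fockSum_fockMode_not true (-1) (n + 1) m f
      have h₂ := fockSum_fockMode_self false n 0 m f
      rw [Bool.not_true] at h₁
      rw [h₁, h₂, map_add, show -1 + (n + 1) + m = n + m by ring, show n + 0 + m = n + m by ring]
      by_cases h : 0 ≤ n + m
      · rw [if_neg (by omega), if_pos h]; module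
      · rw [if_pos (by omega), if_neg h]; module
    · have h₁ := fockSum_fockMode_self true (-1) (n + 1) m f
      have h₂ := fockSum_fockMode_not false n 0 m f
      rw [Bool.not_false] at h₂
      rw [h₁, h₂, map_add, show -1 + (n + 1) + m = n + m by ring, show n + 0 + m = n + m by ring]
      by_cases h : 0 ≤ -1 + m
      · rw [if_neg (show ¬ 0 + m ≤ 0 by omega), if_pos h]; module
      · rw [if_pos (show 0 + m ≤ 0 by omega), if_neg h]; module
  rw [fockL_eq, fockL_eq, key, fockMode_comm false ε n m, fockMode_comm true ε n m, map_sub,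
    LinearMap.map_smul _ _ (_ + _), map_add _ (fockMode false n f), LinearMap.map_smul _ μ,
    fockAnomaly]
  by_cases h : n + m = 0
  · cases ε
    · simp only [h, Bool.not_false, Bool.not_true, cond_false]
      simp
      module
    · simp only [h, Bool.not_false, Bool.not_true, cond_true]
      simp
      module
  · simp only [h, false_and, if_false]
    module

theorem fockMode_one (ε : Bool) {m : ℤ} (hm : 0 ≤ m) : fockMode ε m (1 : FockSpace K) = 0 := by
  rcases int_cases m with ⟨j, rfl⟩ | rfl | ⟨j, rfl⟩
  · omega
  · rfl
  · rw [fockMode_succ, pderiv_one, smul_zero]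

theorem fockSum_one (ε : Bool) (d : ℤ) {s : ℤ} (hs : 0 ≤ s) :
    fockSum ε d s (1 : FockSpace K) = 0 := by
  rw [fockSum, ← finsum_zero (α := ℕ)]
  exact finsum_congr fun i => by rw [fockMode_one _ (by omega), map_zero]

theorem fockL_one {n : ℤ} (μ : K) (hn : -1 ≤ n) : fockL μ n 1 = 0 := by
  rw [fockL_eq, fockSum_one _ _ (by omega), fockSum_one _ _ le_rfl, add_zero, zero_sub, neg_eq_zero]
  rcases hn.eq_or_lt with rfl | hn
  · simp
  · rw [fockMode_one _ (by omega), fockMode_one _ (by omega), smul_zero, add_zero, smul_zero]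

theorem constantCoeff_fockMode (ε : Bool) {m : ℤ} (hm : m ≤ 0) (f : FockSpace K) :
    constantCoeff (fockMode ε m f) = 0 := by
  rcases int_cases m with ⟨j, rfl⟩ | rfl | ⟨j, rfl⟩
  · rw [fockMode_negSucc, map_mul, constantCoeff_X, zero_mul]
  · rw [fockMode_zero, LinearMap.zero_apply, map_zero]
  · omega

/-- The difference of the two sides of the Virasoro relation without central term. -/
def fockDefect (μ : K) (k n : ℤ) : Module.End K (FockSpace K) :=
  fockL μ k * fockL μ n - fockL μ n * fockL μ k - ((k - n : ℤ) : K) • fockL μ (k + n)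

theorem fockDefect_apply (μ : K) (k n : ℤ) (f : FockSpace K) : fockDefect μ k n f =
    fockL μ k (fockL μ n f) - fockL μ n (fockL μ k f) - ((k - n : ℤ) : K) • fockL μ (k + n) f := rfl

/-- The commutators with a mode satisfy the Virasoro relations: the coefficients -m do so directly,
and the anomalies cancel because n(n+1) satisfies the matching cocycle identity. -/
theorem fockDefect_fockMode (μ : K) (k n : ℤ) (ε : Bool) (m : ℤ) (f : FockSpace K) :
    fockDefect μ k n (fockMode ε m f) = fockMode ε m (fockDefect μ k n f) := by
  simp only [fockDefect_apply, fockL_fockMode, map_sub, LinearMap.map_smul]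
  rw [show k + (n + m) = n + (k + m) by ring, show k + n + m = n + (k + m) by ring]
  by_cases h : k + n + m = 0
  · rw [fockAnomaly.eq_1 μ ε k (n + m), fockAnomaly.eq_1 μ ε n (k + m),
      fockAnomaly.eq_1 μ ε (k + n) m, if_pos (by omega), if_pos (by omega), if_pos h]
    obtain rfl : m = -k - n := by omega
    push_cast
    module
  · rw [fockAnomaly.eq_1 μ ε k (n + m), fockAnomaly.eq_1 μ ε n (k + m),
      fockAnomaly.eq_1 μ ε (k + n) m, if_neg (by omega), if_neg (by omega), if_neg (by omega)]
    push_cast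
    module

/-- A form of Schur's lemma. Commuting with annihilation operators makes the image of 1 constant, by
characteristic zero, and commuting with multiplication by the variables makes the operator that
constant. -/
theorem fockDefect_eq [CharZero K] (μ : K) (k n : ℤ) (f : FockSpace K) :
    fockDefect μ k n f = constantCoeff (fockDefect μ k n 1) • f := by
  have h : fockDefect μ k n (1 : FockSpace K) = C (constantCoeff (fockDefect μ k n 1)) := by
    refine MvPolynomial.eq_C_of_pderiv_eq_zero ?_
    rintro ⟨ε, j⟩
    have h₁ := fockDefect_fockMode μ k n (!ε) ((j + 1 : ℕ) : ℤ) 1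
    rw [fockMode_succ, fockMode_succ, pderiv_one, smul_zero, map_zero, Bool.not_not] at h₁
    exact (smul_eq_zero.1 h₁.symm).resolve_left (Nat.cast_ne_zero.2 (Nat.succ_ne_zero j))
  induction f using MvPolynomial.induction_on with
  | C a =>
    rw [C_eq_smul_one, LinearMap.map_smul, smul_comm]
    nth_rewrite 1 [h]
    rw [C_eq_smul_one]
  | add f g hf hg => rw [map_add, hf, hg, smul_add]
  | mul_X f i hf =>
    have h₁ := fockDefect_fockMode μ k n i.1 (Int.negSucc i.2) f
    rw [fockMode_negSucc, fockMode_negSucc, hf] at h₁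
    rw [mul_comm, h₁, mul_smul_comm]

theorem constantCoeff_fockMode_fockMode (ε ε' : Bool) (m : ℤ) {n : ℤ} (hn : n ≤ 0) :
    constantCoeff (fockMode ε m (fockMode ε' n (1 : FockSpace K))) =
      if m + n = 0 ∧ ε' = !ε then (m : K) else 0 := by
  rw [fockMode_comm, map_add, constantCoeff_fockMode _ hn, zero_add, smul_eq_C_mul, mul_one,
    constantCoeff_C]

theorem constantCoeff_fockMode_one (ε : Bool) (m : ℤ) :
    constantCoeff (fockMode ε m (1 : FockSpace K)) = 0 := by
  rcases int_cases m with ⟨j, rfl⟩ | rfl | ⟨j, rfl⟩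
  · rw [fockMode_negSucc, map_mul, constantCoeff_X, zero_mul]
  · rw [fockMode_zero, LinearMap.zero_apply, map_zero]
  · rw [fockMode_succ, pderiv_one, smul_zero, map_zero]

theorem constantCoeff_fockSum (ε : Bool) {d : ℤ} (hd : d ≤ 0) (s : ℤ) (f : FockSpace K) :
    constantCoeff (fockSum ε d s f) = 0 := by
  have h := (constantCoeff (R := K) (σ := Bool × ℕ)).toAddMonoidHom.map_finsum
    (finite_support_fock ε (fun i => fockMode (!ε) (d - i)) s f)
  refine h.trans ?_
  rw [← finsum_zero (α := ℕ)]
  exact finsum_congr fun i => constantCoeff_fockMode _ (by omega) _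

theorem constantCoeff_fockL (μ : K) {n : ℤ} (hn : n ≤ 0) (f : FockSpace K) :
    constantCoeff (fockL μ n f) = 0 := by
  rw [fockL_eq, map_sub, map_add, constantCoeff_fockSum _ (by omega),
    constantCoeff_fockSum _ hn, smul_eq_C_mul, map_mul, map_add, constantCoeff_fockMode _ hn,
    smul_eq_C_mul, map_mul, constantCoeff_fockMode _ hn]
  simp

theorem constantCoeff_fockL_fockMode (μ : K) (k : ℤ) (ε : Bool) {m : ℤ} (hm : m ≤ 0)
    (f : FockSpace K) : constantCoeff (fockL μ k (fockMode ε m f)) =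
      -(m * constantCoeff (fockMode ε (k + m) f)) - fockAnomaly μ ε k m * constantCoeff f := by
  rw [fockL_fockMode, map_sub, map_sub, constantCoeff_fockMode _ hm, smul_eq_C_mul, map_mul,
    smul_eq_C_mul, map_mul, constantCoeff_C, constantCoeff_C, zero_sub]

theorem six_mul_sum_range (c : K) (n : ℕ) :
    6 * ∑ i ∈ Finset.range n, ((i : K) + 1) * (c - i) = n * (n + 1) * (3 * c - 2 * n + 2) := by
  induction n with
  | zero => simp
  | succ n ih => rw [Finset.sum_range_succ, mul_add, ih]; push_cast; ring

/-- Only full contractions contribute. The quadratic part gives ∑ (i+1)(q+1-i) = binom(q+3, 3) at k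
= q + 2, and the background charge gives -12μ times the same binomial. -/
theorem constantCoeff_fockL_fockL [CharZero K] (μ : K) {k n : ℤ} (hn : n ≤ -2) :
    constantCoeff (fockL μ k (fockL μ n 1)) =
      if k + n = 0 then ((Ring.choose (k + 1) 3 : ℤ) : K) * (1 - 12 * μ) else 0 := by
  obtain ⟨q, rfl⟩ : ∃ q : ℕ, n = -(q + 2 : ℤ) := ⟨(-n - 2).toNat, by omega⟩
  have h₁ : fockSum true (-1) (-(q + 2 : ℤ) + 1) (1 : FockSpace K) =
      ∑ i ∈ Finset.range (q + 1),
        fockMode false (-1 - i) (fockMode true (-(q + 2 : ℤ) + 1 + i) 1) :=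
    finsum_eq_sum_range fun i hi => by rw [fockMode_one _ (by omega), map_zero]
  have h₂ : ∀ i ∈ Finset.range (q + 1), constantCoeff (fockL μ k
      (fockMode false (-1 - i) (fockMode true (-(q + 2 : ℤ) + 1 + i) 1))) =
        if k + -(q + 2 : ℤ) = 0 then ((i : K) + 1) * (((q + 1 : ℕ) : K) - i) else 0 := by
    intro i hi
    rw [Finset.mem_range] at hi
    rw [constantCoeff_fockL_fockMode _ _ _ (by omega), constantCoeff_fockMode_one, mul_zero,
      sub_zero, constantCoeff_fockMode_fockMode _ _ _ (by omega)]
    by_cases h : k + -(q + 2 : ℤ) = 0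
    · rw [if_pos h, if_pos ⟨by omega, rfl⟩, show k = q + 2 by omega]
      push_cast; ring
    · rw [if_neg h, if_neg (by rintro ⟨h', -⟩; omega), mul_zero, neg_zero]
  rw [fockL_eq μ (-(q + 2 : ℤ)), fockSum_one _ _ le_rfl, add_zero, h₁, map_sub, map_sub, map_sum,
    map_sum, Finset.sum_congr rfl h₂, LinearMap.map_smul, map_add, LinearMap.map_smul,
    smul_eq_C_mul, smul_eq_C_mul, map_mul, map_add, map_mul, constantCoeff_C, constantCoeff_C,
    constantCoeff_fockL_fockMode _ _ _ (by omega), constantCoeff_fockL_fockMode _ _ _ (by omega),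
    constantCoeff_fockMode_one, constantCoeff_fockMode_one, map_one, fockAnomaly, fockAnomaly]
  by_cases h : k + -(q + 2 : ℤ) = 0
  · obtain rfl : k = q + 2 := by omega
    simp only [if_pos h, cond_false, cond_true]
    have h₃ := six_mul_sum_range (((q + 1 : ℕ) : K)) (q + 1)
    have h₄ := congrArg (Int.cast : ℤ → K) (VirasoroAlgebra.six_mul_choose (q + 2))
    push_cast at h₃ h₄ ⊢
    have h6 : (6 : K) ≠ 0 := by norm_num
    apply mul_left_cancel₀ h6
    linear_combination h₃ - (1 - 12 * μ) * h₄
  · simp only [if_neg h]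
    simp

/-- Since the defect is a scalar, its value at 1 decides. For n ≤ -2 this is
`constantCoeff_fockL_fockL`, and for k ≤ -2 it follows by antisymmetry. -/
theorem fockL_isVirasoroRep [CharZero K] (c' : K) : IsVirasoroRep c' (fockL ((1 - c') / 12)) := by
  have hμ : 1 - 12 * ((1 - c') / 12) = c' := by
    have : (12 : K) ≠ 0 := by norm_num
    field_simp
    ring
  set μ := (1 - c') / 12
  have zero_one : ∀ j, constantCoeff (fockL μ j (1 : FockSpace K)) = 0 := by
    intro j
    by_cases hj : j ≤ 0
    · exact constantCoeff_fockL μ hj 1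
    · rw [fockL_one μ (by omega), map_zero]
  have main : ∀ k n, constantCoeff (fockDefect μ k n (1 : FockSpace K)) =
      if k + n = 0 then ((Ring.choose (k + 1) 3 : ℤ) : K) * c' else 0 := by
    intro k n
    have h6 : (6 : K) ≠ 0 := by norm_num
    rw [fockDefect_apply, map_sub, map_sub, smul_eq_C_mul, map_mul, zero_one, mul_zero, sub_zero]
    by_cases h₁ : n ≤ -2
    · rw [constantCoeff_fockL_fockL μ h₁, hμ]
      by_cases h : k + n = 0
      · rw [constantCoeff_fockL μ (show n ≤ 0 by omega), sub_zero]
      · rw [constantCoeff_fockL μ (show n ≤ 0 by omega), sub_zero]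
    · rw [fockL_one μ (by omega), map_zero, map_zero, zero_sub]
      by_cases h₂ : k ≤ -2
      · rw [constantCoeff_fockL_fockL μ h₂, hμ]
        by_cases h : k + n = 0
        · rw [if_pos (by omega), if_pos h, VirasoroAlgebra.choose_neg k n h]
          push_cast; ring
        · rw [if_neg (by omega), if_neg h, neg_zero]
      · rw [fockL_one μ (by omega), map_zero, map_zero, neg_zero]
        -- Here k, n ≥ -1 with k + n = 0 leave k = -1, 0, 1, where the binomial coefficient is zero.
        split_ifs with h
        · have := congrArg (Int.cast : ℤ → K) (VirasoroAlgebra.six_mul_choose k)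
          have hz : (k + 1) * k * (k - 1) = 0 := by
            have : k = -1 ∨ k = 0 ∨ k = 1 := by omega
            rcases this with rfl | rfl | rfl <;> rfl
          rw [hz, Int.cast_zero, Int.cast_mul] at this
          rw [(mul_eq_zero.1 this).resolve_left (by exact_mod_cast h6), zero_mul]
        · rfl
  intro m n v
  have h := fockDefect_eq μ m n v
  rw [main, fockDefect_apply] at h
  rw [← h]
  abel

end FreeField
end

noncomputable section

/-! ## Monomials in a highest weight representation -/

section Monomials

variable {R M : Type*} [CommRing R] [AddCommGroup M] [Module R M]

/-- The monomial `L(-n₁ - 2) ⋯ L(-nₛ - 2) v`. -/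
def virMono (L : ℤ → Module.End R M) (vac : M) (l : List ℕ) : M :=
  l.foldr (fun (n : ℕ) v => L (-((n : ℤ) + 2)) v) vac

theorem virMono_cons (L : ℤ → Module.End R M) (vac : M) (n : ℕ) (l : List ℕ) :
    virMono L vac (n :: l) = L (-(n + 2 : ℤ)) (virMono L vac l) := rfl

/-- The span of the monomials of length less than `s`. -/
def monoSpan (L : ℤ → Module.End R M) (vac : M) (s : ℕ) : Submodule R M :=
  Submodule.span R (virMono L vac '' {l | l.length < s})

/-- The span of the monomials indexed by multisets. -/
def multisetSpan (L : ℤ → Module.End R M) (vac : M) : Submodule R M :=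
  Submodule.span R (Set.range fun m : Multiset ℕ => virMono L vac m.toList)

variable {c' : R} {L : ℤ → Module.End R M} {vac : M}

theorem virMono_mem_monoSpan {l : List ℕ} {s : ℕ} (h : l.length < s) :
    virMono L vac l ∈ monoSpan L vac s :=
  Submodule.subset_span ⟨l, h, rfl⟩

theorem apply_mem_monoSpan (n : ℕ) {s : ℕ} {v : M} (hv : v ∈ monoSpan L vac s) :
    L (-(n + 2 : ℤ)) v ∈ monoSpan L vac (s + 1) := by
  refine (Submodule.span_le (p := (monoSpan L vac (s + 1)).comap (L (-(n + 2 : ℤ))))).2 ?_ hv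
  rintro _ ⟨l, hl, rfl⟩
  exact virMono_mem_monoSpan (l := n :: l) (Nat.succ_lt_succ hl)

namespace IsVirasoroRep

/-- A transposition costs a commutator, which merges two factors into one and so is a shorter
monomial. Its index is again at most -2, and no central term occurs because both indices are
negative. -/
theorem virMono_perm (h : IsVirasoroRep c' L) {l l' : List ℕ} (hl : l.Perm l') :
    virMono L vac l - virMono L vac l' ∈ monoSpan L vac l.length := by
  induction hl with
  | nil => rw [sub_self]; exact Submodule.zero_mem _
  | cons x _ ih =>
    rw [virMono_cons, virMono_cons, ← map_sub]
    exact apply_mem_monoSpan x ih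
  | swap x y l =>
    rw [virMono_cons, virMono_cons, virMono_cons, virMono_cons, h, if_neg (by omega), zero_smul,
      add_zero, add_sub_cancel_left,
      show -(y + 2 : ℤ) + -(x + 2 : ℤ) = -((x + y + 2 : ℕ) + 2 : ℤ) by push_cast; ring,
      ← virMono_cons]
    exact Submodule.smul_mem _ _ (virMono_mem_monoSpan (by simp))
  | trans h₁ _ ih₁ ih₂ =>
    rw [← h₁.length_eq] at ih₂
    rw [← sub_add_sub_cancel]
    exact Submodule.add_mem _ ih₁ ih₂

theorem virMono_mem (h : IsVirasoroRep c' L) (l : List ℕ) :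
    virMono L vac l ∈ multisetSpan L vac := by
  induction hs : l.length using Nat.strong_induction_on generalizing l with
  | _ s ih =>
    have h₁ := h.virMono_perm (vac := vac)
      (Multiset.coe_eq_coe.1 (Multiset.coe_toList (l : Multiset ℕ))).symm
    have h₂ : monoSpan L vac l.length ≤ multisetSpan L vac := by
      refine Submodule.span_le.2 ?_
      rintro _ ⟨l', hl', rfl⟩
      exact ih _ (hs ▸ hl') l' rfl
    have h₃ : virMono L vac (l : Multiset ℕ).toList ∈ multisetSpan L vac :=
      Submodule.subset_span ⟨(l : Multiset ℕ), rfl⟩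
    rw [← sub_add_cancel (virMono L vac l) (virMono L vac (l : Multiset ℕ).toList)]
    exact Submodule.add_mem _ (h₂ h₁) h₃

theorem apply_mem_of_virMono_mem (N : Submodule R M) (n : ℤ)
    (hn : ∀ l, L n (virMono L vac l) ∈ N) {v : M} (hv : v ∈ multisetSpan L vac) : L n v ∈ N := by
  refine (Submodule.span_le (p := N.comap (L n))).2 ?_ hv
  rintro _ ⟨m, rfl⟩
  exact hn _

/-- L(n) is moved past the first factor. The commutator is another L applied to a shorter monomial,
which is why the induction on the list keeps `n` arbitrary. -/
theorem apply_virMono_mem (h : IsVirasoroRep c' L) (hvac : ∀ n, -1 ≤ n → L n vac = 0) (n : ℤ)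
    (l : List ℕ) : L n (virMono L vac l) ∈ multisetSpan L vac := by
  have hneg : ∀ (k : ℕ) (l : List ℕ), L (-(k + 2 : ℤ)) (virMono L vac l) ∈ multisetSpan L vac :=
    fun k l => h.virMono_mem (k :: l)
  induction l generalizing n with
  | nil =>
    by_cases hn : -1 ≤ n
    · change L n vac ∈ _
      rw [hvac n hn]
      exact Submodule.zero_mem _
    · have := hneg (-2 - n).toNat []
      rwa [show -(((-2 - n).toNat : ℤ) + 2) = n by omega] at this
  | cons k l ih =>
    rw [virMono_cons, h]
    refine Submodule.add_mem _ (Submodule.add_mem _ ?_ (Submodule.smul_mem _ _ (ih _)))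
      (Submodule.smul_mem _ _ (h.virMono_mem l))
    exact apply_mem_of_virMono_mem _ _ (hneg k) (ih n)

theorem multisetSpan_eq_top (h : IsVirasoroRep c' L) (hvac : ∀ n, -1 ≤ n → L n vac = 0)
    (hspan : ∀ N : Submodule R M, vac ∈ N → (∀ n, ∀ v ∈ N, L n v ∈ N) → N = ⊤) :
    multisetSpan L vac = ⊤ :=
  hspan _ (h.virMono_mem []) fun n _ hv =>
    apply_mem_of_virMono_mem _ n (h.apply_virMono_mem hvac n) hv

theorem apply_zero_virMono (h : IsVirasoroRep c' L) (hvac : ∀ n, -1 ≤ n → L n vac = 0)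
    (l : List ℕ) : L 0 (virMono L vac l) = (((l.map (· + 2)).sum : ℕ) : R) • virMono L vac l := by
  induction l with
  | nil =>
    change L 0 vac = _
    rw [hvac 0 (by omega)]
    simp
  | cons k l ih =>
    rw [virMono_cons, h, ih, if_neg (by omega), zero_smul, add_zero, LinearMap.map_smul, zero_add,
      ← add_smul, List.map_cons, List.sum_cons]
    congr 1
    push_cast; ring

end IsVirasoroRep

end Monomials

/-! ## Linear independence of the monomials in the Fock space -/

section Independence

open MvPolynomial

variable {K : Type*} [Field K]

/-- The polynomials all of whose monomials have degree less than `d`. -/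
def degLT {σ : Type*} (K : Type*) [Field K] (d : ℕ) : Submodule K (MvPolynomial σ K) where
  carrier := {f | ∀ m : σ →₀ ℕ, d ≤ m.degree → coeff m f = 0}
  zero_mem' _ _ := coeff_zero _
  add_mem' hf hg m hm := by rw [coeff_add, hf m hm, hg m hm, add_zero]
  smul_mem' c f hf m hm := by rw [coeff_smul, hf m hm, smul_zero]

theorem degLT_mono {σ : Type*} {d e : ℕ} (h : d ≤ e) :
    (degLT K d : Submodule K (MvPolynomial σ K)) ≤ degLT K e :=
  fun _ hf m hm => hf m (h.trans hm)

theorem X_mul_mem_degLT {σ : Type*} {d : ℕ} {f : MvPolynomial σ K} (i : σ) (hf : f ∈ degLT K d) :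
    X i * f ∈ degLT K (d + 1) := by
  classical
  intro m hm
  rw [coeff_X_mul']
  split_ifs with h
  · refine hf _ ?_
    have h₁ : Finsupp.single i 1 ≤ m := by
      rw [Finsupp.single_le_iff]
      exact Nat.one_le_iff_ne_zero.2 (Finsupp.mem_support_iff.1 h)
    have h₂ := congrArg Finsupp.degree (tsub_add_cancel_of_le h₁)
    rw [map_add, Finsupp.degree_single] at h₂
    omega
  · rfl

theorem pderiv_mem_degLT {σ : Type*} {d : ℕ} {f : MvPolynomial σ K} (i : σ)
    (hf : f ∈ degLT K (d + 1)) : pderiv i f ∈ degLT K d := by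
  intro m hm
  rw [coeff_pderiv, hf, zero_mul]
  rw [map_add, Finsupp.degree_single]
  omega

theorem eq_zero_of_mem_degLT_zero {σ : Type*} {f : MvPolynomial σ K} (hf : f ∈ degLT K 0) :
    f = 0 := by
  ext m
  exact hf m (Nat.zero_le _)

theorem fockMode_mem_degLT_of_nonneg (ε : Bool) {n : ℤ} (hn : 0 ≤ n) {d : ℕ} {f : FockSpace K}
    (hf : f ∈ degLT K (d + 1)) : fockMode ε n f ∈ degLT K d := by
  rcases int_cases n with ⟨j, rfl⟩ | rfl | ⟨j, rfl⟩
  · omega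
  · exact Submodule.zero_mem _
  · exact Submodule.smul_mem _ _ (pderiv_mem_degLT _ hf)

theorem fockMode_mem_degLT (ε : Bool) (n : ℤ) {d : ℕ} {f : FockSpace K}
    (hf : f ∈ degLT K d) : fockMode ε n f ∈ degLT K (d + 1) := by
  rcases lt_or_ge n 0 with hn | hn
  · obtain ⟨j, rfl⟩ := Int.eq_negSucc_of_lt_zero hn
    exact X_mul_mem_degLT _ hf
  · exact degLT_mono (Nat.le_succ d)
      (fockMode_mem_degLT_of_nonneg ε hn (degLT_mono (Nat.le_succ d) hf))

/-- The inner mode lowers the degree by at least one, which pays for what the outer mode may add. -/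
theorem fockMode_fockMode_mem_degLT (ε ε' : Bool) (m : ℤ) {n : ℤ} (hn : 0 ≤ n) {d : ℕ}
    {f : FockSpace K} (hf : f ∈ degLT K d) : fockMode ε m (fockMode ε' n f) ∈ degLT K d := by
  cases d with
  | zero =>
    rw [eq_zero_of_mem_degLT_zero hf, map_zero, map_zero]
    exact Submodule.zero_mem _
  | succ d => exact fockMode_mem_degLT _ _ (fockMode_mem_degLT_of_nonneg _ hn hf)

/-- The leading symbol of `L(-n - 2)` on the Fock space. -/
def fockSymbol (K : Type*) [Field K] (n : ℕ) : FockSpace K :=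
  ∑ i ∈ Finset.range (n + 1), X (false, i) * X (true, n - i)

theorem fockSymbol_mul_mem_degLT (n : ℕ) {d : ℕ} {f : FockSpace K} (hf : f ∈ degLT K d) :
    fockSymbol K n * f ∈ degLT K (d + 2) := by
  rw [fockSymbol, Finset.sum_mul]
  refine Submodule.sum_mem _ fun i _ => ?_
  rw [mul_assoc]
  exact X_mul_mem_degLT _ (X_mul_mem_degLT _ hf)

/-- The first n + 1 terms of the first half-sum are products of two creation operators and give the
symbol. All other quadratic terms have an inner mode of nonnegative index and do not raise the
degree; the linear terms raise it by at most one. -/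
theorem fockL_sub_mem_degLT (μ : K) (n : ℕ) {d : ℕ} {f : FockSpace K} (hf : f ∈ degLT K d) :
    fockL μ (-(n + 2 : ℤ)) f - fockSymbol K n * f ∈ degLT K (d + 1) := by
  have h₁ : fockSum true (-1) (-(n + 2 : ℤ) + 1) f - fockSymbol K n * f ∈ degLT K (d + 1) := by
    obtain ⟨N, hN⟩ := (finite_support_fock true (fun i => fockMode false (-1 - i))
      (-(n + 2 : ℤ) + 1) f).bddAbove
    rw [fockSum, finsum_eq_sum_range (n := n + 1 + (N + 1)), Finset.sum_range_add, fockSymbol,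
      Finset.sum_mul, add_sub_right_comm, ← Finset.sum_sub_distrib]
    · refine Submodule.add_mem _ (Submodule.sum_mem _ fun i hi => ?_)
        (Submodule.sum_mem _ fun i _ => ?_)
      · rw [Finset.mem_range] at hi
        rw [show (-1 : ℤ) - i = Int.negSucc i by omega,
          show -(n + 2 : ℤ) + 1 + i = Int.negSucc (n - i) by omega, fockMode_negSucc,
          fockMode_negSucc, Bool.not_true, mul_assoc, sub_self]
        exact Submodule.zero_mem _
      · exact degLT_mono (by omega) (fockMode_fockMode_mem_degLT _ _ _ (by push_cast; omega) hf)
    · intro i hi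
      by_contra h
      have := hN h
      omega
  have h₂ : fockSum false (-(n + 2 : ℤ)) 0 f ∈ degLT K (d + 1) := by
    obtain ⟨N, hN⟩ := (finite_support_fock false (fun i => fockMode true (-(n + 2 : ℤ) - i))
      0 f).bddAbove
    rw [fockSum, finsum_eq_sum_range (n := N + 1)]
    · exact Submodule.sum_mem _ fun i _ => degLT_mono (by omega)
        (fockMode_fockMode_mem_degLT _ _ _ (by omega) hf)
    · intro i hi
      by_contra h
      have := hN h
      omega
  rw [fockL_eq, add_sub_assoc, add_sub_right_comm]
  refine Submodule.add_mem _ h₁ (Submodule.sub_mem _ h₂ (Submodule.smul_mem _ _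
    (Submodule.add_mem _ (fockMode_mem_degLT _ _ hf)
      (Submodule.smul_mem _ _ (fockMode_mem_degLT _ _ hf)))))

/-- The leading symbol of a monomial. -/
def fockMonoSymbol (K : Type*) [Field K] (l : List ℕ) : FockSpace K := (l.map (fockSymbol K)).prod

theorem fockMonoSymbol_isHomogeneous (l : List ℕ) :
    (fockMonoSymbol K l).IsHomogeneous (2 * l.length) := by
  induction l with
  | nil => exact isHomogeneous_one _ _
  | cons n l ih =>
    rw [fockMonoSymbol, List.map_cons, List.prod_cons, List.length_cons,
      show 2 * (l.length + 1) = 2 + 2 * l.length by ring]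
    refine IsHomogeneous.mul (IsHomogeneous.sum _ _ _ fun i _ => ?_) ih
    exact (isHomogeneous_X _ _).mul (isHomogeneous_X _ _)

theorem mem_degLT_of_isHomogeneous {σ : Type*} {d : ℕ} {f : MvPolynomial σ K}
    (hf : f.IsHomogeneous d) : f ∈ degLT K (d + 1) := by
  intro m hm
  exact hf.coeff_eq_zero (by omega)

theorem eq_zero_of_isHomogeneous_of_mem_degLT {σ : Type*} {d : ℕ} {f : MvPolynomial σ K}
    (hf : f.IsHomogeneous d) (hf' : f ∈ degLT K d) : f = 0 := by
  ext m
  by_cases h : m.degree = d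
  · exact hf' m h.ge
  · exact hf.coeff_eq_zero h

theorem virMono_sub_mem_degLT (μ : K) (l : List ℕ) :
    virMono (fockL μ) 1 l - fockMonoSymbol K l ∈ degLT K (2 * l.length) ∧
      virMono (fockL μ) 1 l ∈ degLT K (2 * l.length + 1) := by
  have key : ∀ l : List ℕ, virMono (fockL μ) 1 l - fockMonoSymbol K l ∈ degLT K (2 * l.length) →
      virMono (fockL μ) 1 l ∈ degLT K (2 * l.length + 1) := fun l h => by
    rw [← sub_add_cancel (virMono (fockL μ) 1 l) (fockMonoSymbol K l)]
    exact Submodule.add_mem _ (degLT_mono (by omega) h)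
      (mem_degLT_of_isHomogeneous (fockMonoSymbol_isHomogeneous l))
  suffices h : virMono (fockL μ) 1 l - fockMonoSymbol K l ∈ degLT K (2 * l.length) from
    ⟨h, key l h⟩
  induction l with
  | nil =>
    rw [virMono, fockMonoSymbol, List.foldr_nil, List.map_nil, List.prod_nil, sub_self]
    exact Submodule.zero_mem _
  | cons n l ih =>
    rw [virMono_cons, fockMonoSymbol, List.map_cons, List.prod_cons, ← fockMonoSymbol,
      ← sub_add_sub_cancel _ (fockSymbol K n * virMono (fockL μ) 1 l), ← mul_sub]
    exact Submodule.add_mem _ (fockL_sub_mem_degLT μ n (key l ih)) (fockSymbol_mul_mem_degLT n ih)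

/-- A substitution that maps the symbols to independent variables. -/
def fockEval (K : Type*) [Field K] : FockSpace K →ₐ[K] MvPolynomial ℕ K :=
  aeval fun i => cond i.1 (X i.2) (if i.2 = 0 then 1 else 0)

theorem fockEval_fockSymbol (n : ℕ) : fockEval K (fockSymbol K n) = X n := by
  rw [fockSymbol, map_sum, Finset.sum_eq_single 0]
  · simp [fockEval]
  · intro i _ hi
    simp [fockEval, hi]
  · simp

theorem fockEval_fockMonoSymbol (m : Multiset ℕ) :
    fockEval K (fockMonoSymbol K m.toList) = monomial (Multiset.toFinsupp m) 1 := by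
  have : ∀ l : List ℕ, fockEval K (fockMonoSymbol K l) =
      monomial (Multiset.toFinsupp (l : Multiset ℕ)) 1 := by
    intro l
    induction l with
    | nil => simp [fockMonoSymbol]
    | cons n l ih =>
      rw [fockMonoSymbol, List.map_cons, List.prod_cons, map_mul, ← fockMonoSymbol, ih,
        fockEval_fockSymbol, ← Multiset.cons_coe, ← Multiset.singleton_add, map_add,
        Multiset.toFinsupp_singleton, X, monomial_mul, one_mul]
  rw [this, Multiset.coe_toList]

/-- In a relation, the symbols of the monomials of maximal length s combine to a form of degree 2s.
By the relation this form is also of degree less than 2s, so it is zero. The substitution `fockEval`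
sends the symbols to distinct monomials, so the top coefficients vanish. -/
theorem linearIndependent_fock (μ : K) :
    LinearIndependent K fun m : Multiset ℕ => virMono (fockL μ) 1 m.toList := by
  rw [linearIndependent_iff]
  intro c hc
  by_contra hne
  obtain ⟨m₀, hm₀, hmax⟩ := c.support.exists_max_image Multiset.card
    (Finsupp.support_nonempty_iff.2 hne)
  set s := m₀.card
  set T := c.support.filter (fun m => m.card = s)
  set f : FockSpace K := ∑ m ∈ T, c m • fockMonoSymbol K m.toList with hf
  have h₁ : f.IsHomogeneous (2 * s) := by
    refine IsHomogeneous.sum _ _ _ fun m hm => ?_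
    have := fockMonoSymbol_isHomogeneous (K := K) m.toList
    rw [Multiset.length_toList, (Finset.mem_filter.1 hm).2] at this
    rw [smul_eq_C_mul]
    exact this.C_mul _
  have h₂ : f ∈ degLT K (2 * s) := by
    rw [Finsupp.linearCombination_apply, Finsupp.sum,
      ← Finset.sum_filter_add_sum_filter_not _ (fun m => m.card = s)] at hc
    have e : f = -(∑ m ∈ T, c m • (virMono (fockL μ) 1 m.toList - fockMonoSymbol K m.toList) +
        ∑ m ∈ c.support.filter (fun m => ¬ m.card = s), c m • virMono (fockL μ) 1 m.toList) := by
      simp only [smul_sub, Finset.sum_sub_distrib]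
      rw [sub_add_eq_add_sub, hc]
      simp [hf]
    rw [e]
    refine Submodule.neg_mem _ (Submodule.add_mem _ (Submodule.sum_mem _ fun m hm => ?_)
      (Submodule.sum_mem _ fun m hm => ?_))
    · have := (virMono_sub_mem_degLT μ m.toList).1
      rw [Multiset.length_toList, (Finset.mem_filter.1 hm).2] at this
      exact Submodule.smul_mem _ _ this
    · have h₃ := (virMono_sub_mem_degLT μ m.toList).2
      rw [Multiset.length_toList] at h₃
      have h₄ := hmax m (Finset.mem_filter.1 hm).1
      have h₅ := (Finset.mem_filter.1 hm).2
      exact Submodule.smul_mem _ _ (degLT_mono (by omega) h₃)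
  have h₃ := congrArg (fun g => coeff (Multiset.toFinsupp m₀) (fockEval K g))
    (eq_zero_of_isHomogeneous_of_mem_degLT h₁ h₂)
  simp only [hf, map_sum, map_smul, map_zero, coeff_zero, coeff_sum, coeff_smul,
    fockEval_fockMonoSymbol] at h₃
  rw [Finset.sum_eq_single m₀] at h₃
  · rw [coeff_monomial, if_pos rfl, smul_eq_mul, mul_one] at h₃
    exact (Finsupp.mem_support_iff.1 hm₀) h₃
  · intro m _ hm
    rw [coeff_monomial, if_neg fun h => hm (Multiset.toFinsupp.injective h), smul_zero]
  · intro h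
    exact absurd (show m₀ ∈ T from Finset.mem_filter.2 ⟨hm₀, rfl⟩) h

end Independence

/-! ## The universal property of the Virasoro Fock space and its basis -/

section Basis

variable {R M : Type*} [CommRing R] [AddCommGroup M] [Module R M]

attribute [local instance] LieRing.ofAssociativeRing

/-- The linear map `L(n) ↦ L n`, `κ ↦ 1`. -/
def virRepMap (c' : R) (L : ℤ → Module.End R M) : VirasoroAlgebra R c' →ₗ[R] Module.End R M where
  toFun x := Finsupp.linearCombination R L x.1 + x.2 • 1
  map_add' x y := by
    change Finsupp.linearCombination R L (x.1 + y.1) + (x.2 + y.2) • 1 = _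
    rw [map_add, add_smul]; abel
  map_smul' a x := by
    change Finsupp.linearCombination R L (a • x.1) + (a • x.2) • 1 = _
    rw [map_smul, smul_assoc, smul_add]; rfl

theorem virRepMap_L (c' : R) (L : ℤ → Module.End R M) (n : ℤ) :
    virRepMap c' L (VirasoroAlgebra.L c' n) = L n := by
  change Finsupp.linearCombination R L (Finsupp.single n 1) + (0 : R) • 1 = _
  rw [Finsupp.linearCombination_single, one_smul, zero_smul, add_zero]

theorem virRepMap_kappa (c' : R) (L : ℤ → Module.End R M) :
    virRepMap c' L (VirasoroAlgebra.kappa c') = 1 := by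
  change Finsupp.linearCombination R L 0 + (1 : R) • 1 = _
  rw [map_zero, one_smul, zero_add]

namespace IsVirasoroRep

theorem virRepMap_bracketAux {c' : R} {L : ℤ → Module.End R M} (h : IsVirasoroRep c' L)
    (f g : ℤ →₀ R) : virRepMap c' L (VirasoroAlgebra.bracketAux c' f g) =
      Finsupp.linearCombination R L f * Finsupp.linearCombination R L g -
        Finsupp.linearCombination R L g * Finsupp.linearCombination R L f := by
  induction f using Finsupp.induction_linear with
  | zero => simp
  | add f₁ f₂ h₁ h₂ => simp only [map_add, LinearMap.add_apply, h₁, h₂, add_mul, mul_add]; abel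
  | single m a =>
  induction g using Finsupp.induction_linear with
  | zero => simp
  | add f₁ f₂ h₁ h₂ => simp only [map_add, h₁, h₂, add_mul, mul_add]; abel
  | single n b =>
    have e : L m * L n - L n * L m = ((m - n : ℤ) : R) • L (m + n) +
        (if m + n = 0 then ((Ring.choose (m + 1) 3 : ℤ) : R) * c' else 0) • 1 := by
      ext v
      change L m (L n v) - L n (L m v) = _
      rw [h, add_assoc, add_sub_cancel_left]
      rfl
    rw [VirasoroAlgebra.bracketAux_single, VirasoroAlgebra.bracketLL, map_smul, map_add, map_smul,
      map_smul, virRepMap_L, virRepMap_kappa, ← e, Finsupp.linearCombination_single,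
      Finsupp.linearCombination_single, smul_mul_smul_comm, smul_mul_smul_comm, mul_comm b a,
      smul_sub]

/-- The representation of the Virasoro algebra attached to operators that satisfy the Virasoro
relations. -/
def lieHom {c' : R} {L : ℤ → Module.End R M} (h : IsVirasoroRep c' L) :
    VirasoroAlgebra R c' →ₗ⁅R⁆ Module.End R M where
  __ := virRepMap c' L
  map_lie' {x y} := by
    change virRepMap c' L (VirasoroAlgebra.bracketAux c' x.1 y.1) = _
    rw [h.virRepMap_bracketAux]
    change _ = (Finsupp.linearCombination R L x.1 + x.2 • (1 : Module.End R M)) *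
      (Finsupp.linearCombination R L y.1 + y.2 • (1 : Module.End R M)) -
      (Finsupp.linearCombination R L y.1 + y.2 • (1 : Module.End R M)) *
      (Finsupp.linearCombination R L x.1 + x.2 • (1 : Module.End R M))
    simp only [add_mul, mul_add, smul_mul_assoc, mul_smul_comm, one_mul, mul_one,
      smul_add, smul_comm x.2 y.2 (1 : Module.End R M)]
    abel

/-- The universal properties of the enveloping algebra and of the two successive quotients. It
serves to compare V with the Fock space. -/
theorem exists_virV_lift {c' : R} {L : ℤ → Module.End R M} (h : IsVirasoroRep c' L) {v : M}
    (hv : ∀ n, -1 ≤ n → L n v = 0) :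
    ∃ φ : VirV c' →ₗ[R] M, φ (virVac c') = v ∧ ∀ n w, φ (virL c' n w) = L n (φ w) := by
  let Φ : VirU R c' →ₐ[R] Module.End R M := UniversalEnvelopingAlgebra.lift R h.lieHom
  let _ : Module (VirU R c') M := Module.compHom M Φ.toRingHom
  have : IsScalarTower R (VirU R c') M := ⟨fun r u m => by
    change Φ (r • u) m = r • Φ u m
    rw [map_smul]; rfl⟩
  have hL : ∀ n (w : M), envL c' n • w = L n w := fun n w => by
    change Φ (envL c' n) w = _
    rw [envL, UniversalEnvelopingAlgebra.lift_ι_apply]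
    exact congrArg (fun T : Module.End R M => T w) (virRepMap_L c' L n)
  have hK : ∀ w : M, envK c' • w = w := fun w => by
    change Φ (envK c') w = _
    rw [envK, UniversalEnvelopingAlgebra.lift_ι_apply]
    exact congrArg (fun T : Module.End R M => T w) (virRepMap_kappa c' L)
  let φ₁ : VirW c' →ₗ[VirU R c'] M := (vermaIdeal c').liftQ
    (LinearMap.toSpanSingleton (VirU R c') M v) (Submodule.span_le.2 (by
      rintro _ (⟨n, hn, rfl⟩ | rfl)
      · change envL c' n • v = 0
        rw [hL, hv n (le_trans (by norm_num) hn)]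
      · change (envK c' - 1) • v = 0
        rw [sub_smul, hK, one_smul, sub_self]))
  have h₁ : φ₁ (virV0 c') = v := one_smul (VirU R c') v
  let φ₂ : VirV c' →ₗ[VirU R c'] M := (virW1 c').liftQ φ₁ (Submodule.span_le.2 (by
    rintro _ rfl
    change φ₁ (envL c' (-1) • virV0 c') = 0
    rw [map_smul, h₁, hL, hv _ le_rfl]))
  exact ⟨φ₂.restrictScalars R, h₁, fun n w => (map_smul φ₂ (envL c' n) w).trans (hL n _)⟩

theorem map_virMono {N : Type*} [AddCommGroup N] [Module R N] {L : ℤ → Module.End R M}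
    {L' : ℤ → Module.End R N} (φ : M →ₗ[R] N) (hφ : ∀ n w, φ (L n w) = L' n (φ w)) (v : M)
    (l : List ℕ) : φ (virMono L v l) = virMono L' (φ v) l := by
  induction l with
  | nil => rfl
  | cons n l ih => rw [virMono_cons, virMono_cons, hφ, ih]

end IsVirasoroRep

/-- The images in the Fock space over `K` are independent over `K`, hence over `R`. This takes the
place of a Poincaré–Birkhoff–Witt theorem over `R`. -/
theorem linearIndependent_virMono {R : Type*} (K : Type*) [CommRing R] [Field K] [CharZero K]
    [Algebra R K] [FaithfulSMul R K] (c' : R) :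
    LinearIndependent R fun m : Multiset ℕ => virMono (virL c') (virVac c') m.toList := by
  set μ : K := (1 - algebraMap R K c') / 12
  have hrep : IsVirasoroRep c' fun n => (fockL μ n).restrictScalars R := fun m n v => by
    have := fockL_isVirasoroRep (algebraMap R K c') m n v
    simp only [LinearMap.coe_restrictScalars]
    rw [this, ← algebraMap_smul K (((m - n : ℤ) : R)), ← algebraMap_smul K (ite _ _ (0 : R)),
      apply_ite (algebraMap R K), map_mul, map_intCast, map_intCast, map_zero]
  obtain ⟨φ, h₁, h₂⟩ := hrep.exists_virV_lift (v := 1) fun n hn => fockL_one μ hn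
  refine LinearIndependent.of_comp φ ?_
  have : φ ∘ (fun m : Multiset ℕ => virMono (virL c') (virVac c') m.toList) =
      fun m : Multiset ℕ => virMono (fockL μ) 1 m.toList := by
    funext m
    refine (IsVirasoroRep.map_virMono φ h₂ _ _).trans ?_
    rw [h₁]
    rfl
  rw [this]
  exact (linearIndependent_fock μ).restrict_scalars' R

theorem IsVirasoroRep.exists_basis {c' : R} {L : ℤ → Module.End R M} (h : IsVirasoroRep c' L)
    {vac : M} (hvac : ∀ n, -1 ≤ n → L n vac = 0)
    (hspan : ∀ N : Submodule R M, vac ∈ N → (∀ n, ∀ v ∈ N, L n v ∈ N) → N = ⊤)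
    (hli : LinearIndependent R fun m : Multiset ℕ => virMono L vac m.toList) :
    ∃ b : Module.Basis (Multiset ℕ) R M,
      ∀ m, L 0 (b m) = (((m.map (· + 2)).sum : ℕ) : R) • b m := by
  have htop : ⊤ ≤ Submodule.span R (Set.range fun m : Multiset ℕ => virMono L vac m.toList) :=
    (h.multisetSpan_eq_top hvac hspan).ge
  refine ⟨Module.Basis.mk hli htop, fun m => ?_⟩
  rw [Module.Basis.mk_apply, h.apply_zero_virMono hvac]
  congr 2
  conv_rhs => rw [← Multiset.coe_toList m, Multiset.map_coe, Multiset.sum_coe]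

/-- The Virasoro Fock space has a basis of eigenvectors of `L(0)`. -/
theorem exists_virV_basis {R : Type*} (K : Type*) [CommRing R] [Field K] [CharZero K]
    [Algebra R K] [FaithfulSMul R K] (c' : R) :
    ∃ b : Module.Basis (Multiset ℕ) R (VirV c'),
      ∀ m, virL c' 0 (b m) = (((m.map (· + 2)).sum : ℕ) : R) • b m :=
  (virL_isVirasoroRep c').exists_basis (fun _ hn => virL_virVac c' hn)
    (virV_submodule_eq_top c') (linearIndependent_virMono K c')

theorem finite_multiset_weight (k : ℤ) :
    {m : Multiset ℕ | (((m.map (· + 2)).sum : ℕ) : ℤ) = k}.Finite := by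
  -- The weight bounds every member of the multiset and also its cardinality, hence all
  -- multiplicities.
  refine (Set.finite_Iic (k.toNat • (Multiset.range (k.toNat + 1)))).subset fun m hm => ?_
  rw [Set.mem_ofPred_eq] at hm
  have h₁ : ∀ n ∈ m, n + 2 ≤ (m.map (· + 2)).sum := fun n hn =>
    Multiset.single_le_sum (fun _ _ => Nat.zero_le _) _ (Multiset.mem_map_of_mem _ hn)
  have h₂ : m.card ≤ (m.map (· + 2)).sum := by
    rw [← Multiset.card_map (· + 2) m]
    refine (Multiset.card_nsmul_le_sum (a := 1) fun x hx => ?_).trans' (by simp)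
    obtain ⟨n, -, rfl⟩ := Multiset.mem_map.1 hx
    exact Nat.le_add_left 1 (n + 1)
  rw [Set.mem_Iic, Multiset.le_iff_count]
  intro n
  by_cases hn : n ∈ m
  · rw [Multiset.count_nsmul, Multiset.count_eq_one_of_mem (Multiset.nodup_range _)
      (Multiset.mem_range.2 (by have := h₁ n hn; omega)), mul_one]
    exact (Multiset.count_le_card n m).trans (by omega)
  · rw [Multiset.count_eq_zero_of_notMem hn]
    exact Nat.zero_le _

end Basis

end

noncomputable section

/-! ## The gauge of a complete torsion-free module -/

section Gauge

variable {p : ℕ} [Fact p.Prime] {N : Type*} [AddCommGroup N] [Module ℤ_[p] N]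

theorem mem_idealP_pow_smul_top {k : ℕ} {x : N} :
    x ∈ (idealP p ^ k • ⊤ : Submodule ℤ_[p] N) ↔ ∃ y, x = (p : ℤ_[p]) ^ k • y := by
  rw [Ideal.span_singleton_pow, Submodule.ideal_span_singleton_smul,
    Submodule.mem_smul_pointwise_iff_exists]
  exact ⟨fun ⟨y, _, h⟩ => ⟨y, h.symm⟩, fun ⟨y, h⟩ => ⟨y, trivial, h.symm⟩⟩

theorem toRationalSpan_smul (t : ℤ_[p]) (m : N) :
    toRationalSpan p (t • m) = (t : ℚ_[p]) • toRationalSpan p m := by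
  rw [map_smul]
  exact (algebraMap_smul (A := ℚ_[p]) (M := ℚ_[p] ⊗[ℤ_[p]] N) t (toRationalSpan p m)).symm

theorem toRationalSpan_pow_smul (k : ℕ) (m : N) :
    toRationalSpan p ((p : ℤ_[p]) ^ k • m) = (p : ℚ_[p]) ^ k • toRationalSpan p m := by
  rw [toRationalSpan_smul]; push_cast; rfl

/-- Extension of scalars to `ℚ_[p]` is localization at the nonzero elements of `ℤ_[p]`, so its
kernel is torsion. -/
theorem toRationalSpan_injective
    (htf : ∀ (t : ℤ_[p]) (x : N), t ≠ 0 → t • x = 0 → x = 0) :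
    Function.Injective (toRationalSpan p : N → RationalSpan p N) := by
  have hloc : IsLocalizedModule (nonZeroDivisors ℤ_[p]) (TensorProduct.mk ℤ_[p] ℚ_[p] N 1) :=
    inferInstance
  refine (injective_iff_map_eq_zero (toRationalSpan p : N →ₗ[ℤ_[p]] RationalSpan p N)).2
    fun x hx => ?_
  obtain ⟨s, hs⟩ := (IsLocalizedModule.eq_zero_iff (nonZeroDivisors ℤ_[p])
    (TensorProduct.mk ℤ_[p] ℚ_[p] N 1)).1 hx
  exact htf s x (nonZeroDivisors.coe_ne_zero s) hs

theorem norm_toRationalSpan_le (m : N) : ‖toRationalSpan p m‖ ≤ 1 := by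
  have h := gaugeNorm_le (1 : ℚ_[p]) m
  rwa [one_smul, norm_one] at h

theorem norm_smul_toRationalSpan_le (a : ℚ_[p]) (m : N) : ‖a • toRationalSpan p m‖ ≤ ‖a‖ :=
  gaugeNorm_le a m

theorem exists_rep_norm_lt {x : RationalSpan p N} {r : ℝ} (h : ‖x‖ < r) :
    ∃ (a : ℚ_[p]) (m : N), x = a • toRationalSpan p m ∧ ‖a‖ < r := by
  by_contra! hne
  have hp : r ≤ ‖x‖ := le_gaugeNorm x r hne
  exact absurd h hp.not_gt

/-- The infimum is not known to be attained, but ‖x‖ < p gives a representation with ‖a‖ < p, and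
the value group leaves ‖a‖ ≤ 1. -/
theorem exists_eq_toRationalSpan {x : RationalSpan p N} (h : ‖x‖ ≤ 1) :
    ∃ m : N, x = toRationalSpan p m := by
  have hp : (1 : ℝ) < p := by exact_mod_cast (Fact.out : p.Prime).one_lt
  obtain ⟨a, m, rfl, ha⟩ := exists_rep_norm_lt (h.trans_lt hp)
  have ha' : ‖a‖ ≤ 1 := by
    rw [← zpow_zero (p : ℝ), Padic.norm_le_pow_iff_norm_lt_pow_add_one, zero_add, zpow_one]
    exact ha
  let t : ℤ_[p] := ⟨a, ha'⟩
  exact ⟨t • m, (toRationalSpan_smul t m).symm⟩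

theorem norm_le_one_iff {x : RationalSpan p N} :
    ‖x‖ ≤ 1 ↔ x ∈ Set.range (toRationalSpan p : N → RationalSpan p N) :=
  ⟨fun h => (exists_eq_toRationalSpan h).imp fun _ h => h.symm,
    fun ⟨m, h⟩ => h ▸ norm_toRationalSpan_le m⟩

theorem exists_eq_smul_of_norm_le {x : RationalSpan p N} {a : ℚ_[p]} (ha : a ≠ 0)
    (h : ‖x‖ ≤ ‖a‖) : ∃ m : N, x = a • toRationalSpan p m := by
  have h' : ‖a⁻¹ • x‖ ≤ 1 := by
    rw [norm_smul, norm_inv, inv_mul_le_iff₀ (norm_pos_iff.2 ha), mul_one]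
    exact h
  obtain ⟨m, hm⟩ := exists_eq_toRationalSpan h'
  exact ⟨m, by rw [← hm, smul_inv_smul₀ ha]⟩

theorem norm_natCast_pow (k : ℕ) : ‖(p : ℚ_[p]) ^ k‖ = ((p : ℝ)⁻¹) ^ k := by
  rw [norm_pow, Padic.norm_p]

theorem natCast_pow_ne_zero (k : ℕ) : (p : ℚ_[p]) ^ k ≠ 0 :=
  pow_ne_zero _ (Nat.cast_ne_zero.2 (Fact.out : p.Prime).ne_zero)

theorem inv_prime_lt_one : (p : ℝ)⁻¹ < 1 :=
  inv_lt_one_of_one_lt₀ (by exact_mod_cast (Fact.out : p.Prime).one_lt)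

theorem inv_prime_pos : 0 < (p : ℝ)⁻¹ :=
  inv_pos.2 (by exact_mod_cast (Fact.out : p.Prime).pos)

theorem tendsto_inv_prime_pow : Filter.Tendsto (fun k : ℕ => ((p : ℝ)⁻¹) ^ k) Filter.atTop (𝓝 0) :=
  tendsto_pow_atTop_nhds_zero_of_lt_one inv_prime_pos.le inv_prime_lt_one

theorem norm_toRationalSpan_le_pow {k : ℕ} {m : N}
    (h : m ∈ (idealP p ^ k • ⊤ : Submodule ℤ_[p] N)) :
    ‖toRationalSpan p m‖ ≤ ((p : ℝ)⁻¹) ^ k := by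
  obtain ⟨y, rfl⟩ := mem_idealP_pow_smul_top.1 h
  rw [toRationalSpan_pow_smul, ← norm_natCast_pow]
  exact norm_smul_toRationalSpan_le _ _

theorem mem_pow_of_norm_le (htf : ∀ (t : ℤ_[p]) (x : N), t ≠ 0 → t • x = 0 → x = 0) {k : ℕ}
    {m : N} (h : ‖toRationalSpan p m‖ ≤ ((p : ℝ)⁻¹) ^ k) :
    m ∈ (idealP p ^ k • ⊤ : Submodule ℤ_[p] N) := by
  rw [← norm_natCast_pow] at h
  obtain ⟨y, hy⟩ := exists_eq_smul_of_norm_le (natCast_pow_ne_zero k) h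
  rw [← toRationalSpan_pow_smul] at hy
  exact mem_idealP_pow_smul_top.2 ⟨y, toRationalSpan_injective htf hy⟩

theorem norm_add_le_max_gauge (x y : RationalSpan p N) : ‖x + y‖ ≤ max ‖x‖ ‖y‖ := by
  refine le_of_forall_gt_imp_ge_of_dense fun r hr => ?_
  obtain ⟨a, m, rfl, ha⟩ := exists_rep_norm_lt ((le_max_left _ _).trans_lt hr)
  obtain ⟨b, n, rfl, hb⟩ := exists_rep_norm_lt ((le_max_right _ _).trans_lt hr)
  rcases le_total ‖a‖ ‖b‖ with h | h
  · obtain ⟨k, hk⟩ := exists_common_scalar a b m n h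
    rw [hk]
    exact (norm_smul_toRationalSpan_le b k).trans hb.le
  · obtain ⟨k, hk⟩ := exists_common_scalar b a n m h
    rw [add_comm, hk]
    exact (norm_smul_toRationalSpan_le a k).trans ha.le

theorem eq_zero_of_norm_eq_zero [IsHausdorff (idealP p) N]
    (htf : ∀ (t : ℤ_[p]) (x : N), t ≠ 0 → t • x = 0 → x = 0) {x : RationalSpan p N}
    (h : ‖x‖ = 0) : x = 0 := by
  obtain ⟨m, rfl⟩ := exists_eq_toRationalSpan (h.le.trans zero_le_one)
  rw [IsHausdorff.haus (I := idealP p) inferInstance m fun k => SModEq.zero.2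
    (mem_pow_of_norm_le htf (h.le.trans (pow_nonneg (inv_prime_pos (p := p)).le k))), map_zero]

theorem exists_norm_eq_zpow {x : RationalSpan p N} (hx : ‖x‖ ≠ 0) :
    ∃ n : ℤ, ‖x‖ = (p : ℝ) ^ n := by
  have hp : (1 : ℝ) < p := by exact_mod_cast (Fact.out : p.Prime).one_lt
  have hp0 : (0 : ℝ) < p := one_pos.trans hp
  have hx0 : 0 < ‖x‖ := lt_of_le_of_ne (norm_nonneg x) hx.symm
  have hrep : ∀ (b : ℚ_[p]) (m : N), x = b • toRationalSpan p m → ∃ n : ℤ, ‖b‖ = (p : ℝ) ^ n := by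
    rintro b m rfl
    have hb : b ≠ 0 := by
      rintro rfl
      rw [zero_smul, norm_zero] at hx
      exact hx rfl
    exact ⟨_, Padic.norm_eq_zpow_neg_valuation hb⟩
  -- A scalar within a factor p of the infimum already attains it, since norms of nonzero scalars
  -- are powers of p.
  obtain ⟨a, m, hxa, ha⟩ := exists_rep_norm_lt (lt_mul_of_one_lt_left hx0 hp)
  obtain ⟨n, hn⟩ := hrep a m hxa
  refine ⟨n, le_antisymm ?_ (le_gaugeNorm x _ fun b m' hxb => ?_)⟩
  · rw [← hn, hxa]
    exact norm_smul_toRationalSpan_le a m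
  · obtain ⟨n', hn'⟩ := hrep b m' hxb
    have h₁ : ‖x‖ ≤ ‖b‖ := by
      rw [hxb]
      exact norm_smul_toRationalSpan_le b m'
    have h₂ : (p : ℝ) ^ n < (p : ℝ) ^ (n' + 1) := by
      rw [zpow_add_one₀ hp0.ne', ← hn, ← hn', mul_comm]
      exact ha.trans_le (mul_le_mul_of_nonneg_left h₁ hp0.le)
    rw [hn']
    exact zpow_le_zpow_right₀ hp.le (Int.lt_add_one_iff.1 ((zpow_lt_zpow_iff_right₀ hp).1 h₂))

/-- It suffices to treat sequences whose distances are controlled by p^(-k). After subtraction of `u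
0` they come from `N`, where this control means congruence modulo p^k, so precompleteness provides
the limit. -/
theorem completeSpace_rationalSpan [IsPrecomplete (idealP p) N]
    (htf : ∀ (t : ℤ_[p]) (x : N), t ≠ 0 → t • x = 0 → x = 0) :
    CompleteSpace (RationalSpan p N) := by
  refine Metric.complete_of_convergent_controlled_sequences (fun k => ((p : ℝ)⁻¹) ^ k)
    (fun k => pow_pos (inv_prime_pos (p := p)) k) fun u hu => ?_
  have hone : ∀ k, ‖u k - u 0‖ ≤ 1 := fun k => by
    simpa [dist_eq_norm] using (hu 0 k 0 (Nat.zero_le k) le_rfl).le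
  choose f hf using fun k => exists_eq_toRationalSpan (hone k)
  have hsub : ∀ k l, toRationalSpan p (f k - f l) = u k - u l := fun k l => by
    rw [map_sub, ← hf, ← hf, sub_sub_sub_cancel_right]
  obtain ⟨x, hx⟩ := IsPrecomplete.prec (I := idealP p) inferInstance (f := f) fun {k l} hkl => by
    refine (SModEq.sub_mem).2 (mem_pow_of_norm_le htf ?_)
    rw [hsub, ← dist_eq_norm]
    exact (hu k k l le_rfl hkl).le
  refine ⟨u 0 + toRationalSpan p x, tendsto_iff_norm_sub_tendsto_zero.2
    (squeeze_zero (fun _ => norm_nonneg _) (fun k => ?_) (tendsto_inv_prime_pow (p := p)))⟩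
  have e : u k - (u 0 + toRationalSpan p x) = toRationalSpan p (f k - x) := by
    rw [map_sub, ← hf, sub_add_eq_sub_sub]
  rw [e]
  exact norm_toRationalSpan_le_pow (SModEq.sub_mem.1 (hx k))

theorem isPAdicBanach_rationalSpan [IsAdicComplete (idealP p) N]
    (htf : ∀ (t : ℤ_[p]) (x : N), t ≠ 0 → t • x = 0 → x = 0) :
    IsPAdicBanach p (RationalSpan p N) where
  eq_zero _ h := eq_zero_of_norm_eq_zero htf h
  complete := completeSpace_rationalSpan htf
  ultrametric := norm_add_le_max_gauge
  norm_mem _ hx := exists_norm_eq_zpow fun h => hx (eq_zero_of_norm_eq_zero htf h)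

end Gauge

/-! ## Completions of torsion-free modules -/

section Completed

variable {p : ℕ} [Fact p.Prime] {M : Type*} [AddCommGroup M] [Module ℤ_[p] M]

instance : IsAdicComplete (idealP p) (AdicCompletion (idealP p) M) :=
  AdicCompletion.isAdicComplete (Submodule.fg_span_singleton _)

theorem mem_pow_smul_top_of_eval_eq_zero {k : ℕ} {x : AdicCompletion (idealP p) M}
    (h : AdicCompletion.eval (idealP p) M k x = 0) :
    x ∈ (idealP p ^ k • ⊤ : Submodule ℤ_[p] (AdicCompletion (idealP p) M)) := by
  rw [AdicCompletion.pow_smul_top_eq_ker_eval (Submodule.fg_span_singleton _)]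
  exact h

theorem norm_le_pow_of_eval_eq_zero {k : ℕ} {x : AdicCompletion (idealP p) M}
    (h : AdicCompletion.eval (idealP p) M k x = 0) :
    ‖toRationalSpan p x‖ ≤ ((p : ℝ)⁻¹) ^ k :=
  norm_toRationalSpan_le_pow (mem_pow_smul_top_of_eval_eq_zero h)

theorem exists_eval_eq_mk (k : ℕ) (x : AdicCompletion (idealP p) M) :
    ∃ v : M, AdicCompletion.eval (idealP p) M k x = Submodule.Quotient.mk v :=
  (Submodule.Quotient.mk_surjective _ _).imp fun _ h => h.symm

theorem eval_of_eq_mk (k : ℕ) (v : M) :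
    AdicCompletion.eval (idealP p) M k (AdicCompletion.of (idealP p) M v) =
      Submodule.Quotient.mk v := rfl

theorem adicCompletion_ext {x y : AdicCompletion (idealP p) M}
    (h : ∀ k, AdicCompletion.eval (idealP p) M k x = AdicCompletion.eval (idealP p) M k y) :
    x = y :=
  AdicCompletion.ext h

/-- If p^n x = 0, lift x at level k + n to v. Then p^n v = p^(n+k) y, so v = p^k y in the
torsion-free `M`, and x vanishes at level k. A general t is a unit times a power of p. -/
theorem adicCompletion_torsionFree
    (htf : ∀ (t : ℤ_[p]) (x : M), t ≠ 0 → t • x = 0 → x = 0) (t : ℤ_[p])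
    (x : AdicCompletion (idealP p) M) (ht : t ≠ 0) (hx : t • x = 0) : x = 0 := by
  have hpow : ∀ n : ℕ, (p : ℤ_[p]) ^ n • x = 0 → x = 0 := by
    intro n hn
    refine adicCompletion_ext fun k => ?_
    obtain ⟨v, hv⟩ := exists_eval_eq_mk (k + n) x
    have h₁ := congrArg (AdicCompletion.eval (idealP p) M (k + n)) hn
    rw [map_smul, hv, map_zero, ← Submodule.Quotient.mk_smul, Submodule.Quotient.mk_eq_zero,
      mem_idealP_pow_smul_top] at h₁
    obtain ⟨y, hy⟩ := h₁
    have h₂ : v = (p : ℤ_[p]) ^ k • y := by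
      rw [← sub_eq_zero]
      refine htf ((p : ℤ_[p]) ^ n) _
        (pow_ne_zero _ (Nat.cast_ne_zero.2 (Fact.out : p.Prime).ne_zero)) ?_
      rw [smul_sub, hy, smul_smul, ← pow_add, add_comm n k, sub_self]
    have h₃ := AdicCompletion.transitionMap_comp_eval_apply _ _ (Nat.le_add_right k n) x
    rw [map_zero]
    refine h₃.symm.trans ((congrArg (AdicCompletion.transitionMap (idealP p) M
      (Nat.le_add_right k n)) hv).trans ?_)
    exact (Submodule.Quotient.mk_eq_zero _).2 (mem_idealP_pow_smul_top.2 ⟨y, h₂⟩)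
  rw [PadicInt.unitCoeff_spec ht, mul_smul, ← Units.smul_def, smul_eq_zero_iff_eq] at hx
  exact hpow _ hx

end Completed

end

noncomputable section

/-! ## The completion of a vertex algebra -/

section CompletedModes

variable {p : ℕ} [Fact p.Prime] {M : Type*} [AddCommGroup M] [Module ℤ_[p] M]

/-- The products of compatible sequences. -/
def completedY (Y : ModeMap ℤ_[p] M) : ModeMap ℤ_[p] (AdicCompletion (idealP p) M) :=
  fun n => completedProduct (idealP p) (Y n)

variable {Y : ModeMap ℤ_[p] M}

theorem completedModes_smul (n : ℤ) (a b : ℚ_[p]) (u v : AdicCompletion (idealP p) M) :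
    completedModes Y n (a • toRationalSpan p u) (b • toRationalSpan p v) =
      (a * b) • toRationalSpan p (completedY Y n u v) := by
  rw [map_smul, LinearMap.map_smul₂, smul_smul, mul_comm b a]
  congr 1
  refine (LinearMap.BilinMap.baseChange_tmul (completedProduct (idealP p) (Y n))
    (1 : ℚ_[p]) u 1 v).trans ?_
  rw [mul_one]
  rfl

theorem completedModes_toRationalSpan_smul (n : ℤ) (b : ℚ_[p])
    (u v : AdicCompletion (idealP p) M) :
    completedModes Y n (toRationalSpan p u) (b • toRationalSpan p v) =
      b • toRationalSpan p (completedY Y n u v) := by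
  have := completedModes_smul (Y := Y) n 1 b u v
  rwa [one_smul, one_mul] at this

theorem completedModes_toRationalSpan (n : ℤ) (u v : AdicCompletion (idealP p) M) :
    completedModes Y n (toRationalSpan p u) (toRationalSpan p v) =
      toRationalSpan p (completedY Y n u v) := by
  have := completedModes_toRationalSpan_smul (Y := Y) n 1 u v
  rwa [one_smul, one_smul] at this

theorem eval_completedY (n : ℤ) {u v : AdicCompletion (idealP p) M} {k : ℕ} {a b : M}
    (hu : AdicCompletion.eval (idealP p) M k u = Submodule.Quotient.mk a)
    (hv : AdicCompletion.eval (idealP p) M k v = Submodule.Quotient.mk b) :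
    AdicCompletion.eval (idealP p) M k (completedY Y n u v) = Submodule.Quotient.mk (Y n a b) := by
  rw [completedY, eval_completedProduct, hu, hv, quotientProduct_mk]

theorem norm_completedModes_le (n : ℤ) (x y : RationalSpan p (AdicCompletion (idealP p) M)) :
    ‖completedModes Y n x y‖ ≤ ‖x‖ * ‖y‖ := by
  refine le_mul_of_forall_lt₀ fun r hr s hs => ?_
  obtain ⟨a, u, rfl, ha⟩ := exists_rep_norm_lt hr
  obtain ⟨b, v, rfl, hb⟩ := exists_rep_norm_lt hs
  rw [completedModes_smul]
  refine (norm_smul_toRationalSpan_le _ _).trans ?_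
  rw [norm_mul]
  exact mul_le_mul ha.le hb.le (norm_nonneg b) ((norm_nonneg a).trans ha.le)

theorem tendsto_toRationalSpan_zero {ι : Type*} {l : Filter ι}
    {f : ι → AdicCompletion (idealP p) M}
    (h : ∀ k, ∀ᶠ i in l, AdicCompletion.eval (idealP p) M k (f i) = 0) :
    Filter.Tendsto (fun i => toRationalSpan p (f i)) l (𝓝 0) := by
  rw [tendsto_zero_iff_norm_tendsto_zero, Metric.tendsto_nhds]
  intro ε hε
  obtain ⟨k, hk⟩ := exists_pow_lt_of_lt_one hε (inv_prime_lt_one (p := p))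
  filter_upwards [h k] with i hi
  rw [dist_zero_right, norm_norm]
  exact (norm_le_pow_of_eval_eq_zero hi).trans_lt hk

theorem IsVertexAlgebra.isPAdicField {vac : M} (h : IsVertexAlgebra Y vac)
    (x : RationalSpan p (AdicCompletion (idealP p) M)) :
    IsPAdicField x (fun n => completedModes Y n x) where
  bounded := ⟨1, zero_le_one, fun n b => by
    rw [one_mul]
    exact norm_completedModes_le n x b⟩
  tendsto b := by
    obtain ⟨a, u, rfl⟩ := exists_rep x
    obtain ⟨c, v, rfl⟩ := exists_rep b
    simp only [completedModes_smul]
    rw [← smul_zero (a * c)]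
    refine Filter.Tendsto.const_smul (tendsto_toRationalSpan_zero fun k => ?_) _
    obtain ⟨u', hu⟩ := exists_eval_eq_mk k u
    obtain ⟨v', hv⟩ := exists_eval_eq_mk k v
    obtain ⟨n₀, hn₀⟩ := h.truncation u' v'
    filter_upwards [Filter.eventually_gt_atTop n₀] with n hn
    rw [eval_completedY n hu hv, hn₀ n hn]
    rfl

theorem fieldNorm_completedModes_sub_le (a b : RationalSpan p (AdicCompletion (idealP p) M)) :
    fieldNorm (fun n => completedModes Y n b - completedModes Y n a) ≤ ‖b - a‖ := by
  refine Real.iSup_le (fun n => Real.iSup_le (fun c => ?_) (norm_nonneg _)) (norm_nonneg _)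
  -- This bound includes the vectors of norm zero, where the quotient is 0 by convention.
  refine div_le_of_le_mul₀ (norm_nonneg _) (norm_nonneg _) ?_
  have h := norm_completedModes_le (Y := Y) n (b - a) c
  rw [map_sub] at h
  exact h

theorem jacobiLeft_completedModes (r s t : ℤ) (a b c : ℚ_[p])
    (u v w : AdicCompletion (idealP p) M) (i : ℕ) :
    jacobiLeft (completedModes Y) r s t (a • toRationalSpan p u) (b • toRationalSpan p v)
      (c • toRationalSpan p w) i =
      (a * b * c) • toRationalSpan p (jacobiLeft (completedY Y) r s t u v w i) := by
  rw [jacobiLeft, jacobiLeft, completedModes_smul, completedModes_smul, map_zsmul, smul_comm]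

theorem jacobiRight_completedModes (r s t : ℤ) (a b c : ℚ_[p])
    (u v w : AdicCompletion (idealP p) M) (i : ℕ) :
    jacobiRight (completedModes Y) r s t (a • toRationalSpan p u) (b • toRationalSpan p v)
      (c • toRationalSpan p w) i =
      (a * b * c) • toRationalSpan p (jacobiRight (completedY Y) r s t u v w i) := by
  rw [jacobiRight, jacobiRight, completedModes_smul, completedModes_smul, completedModes_smul,
    completedModes_smul, map_zsmul, map_sub, map_zsmul, mul_left_comm b a c,
    ← mul_assoc a b c, smul_comm (t.negOnePow : ℤ) (a * b * c), ← smul_sub, smul_comm]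

theorem eval_jacobiLeft (r s t : ℤ) {u v w : AdicCompletion (idealP p) M} {k : ℕ} {a b c : M}
    (hu : AdicCompletion.eval (idealP p) M k u = Submodule.Quotient.mk a)
    (hv : AdicCompletion.eval (idealP p) M k v = Submodule.Quotient.mk b)
    (hw : AdicCompletion.eval (idealP p) M k w = Submodule.Quotient.mk c) (i : ℕ) :
    AdicCompletion.eval (idealP p) M k (jacobiLeft (completedY Y) r s t u v w i) =
      Submodule.mkQ _ (jacobiLeft Y r s t a b c i) := by
  rw [jacobiLeft, map_zsmul, eval_completedY _ (eval_completedY _ hu hv) hw, jacobiLeft, map_zsmul]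
  rfl

theorem eval_jacobiRight (r s t : ℤ) {u v w : AdicCompletion (idealP p) M} {k : ℕ} {a b c : M}
    (hu : AdicCompletion.eval (idealP p) M k u = Submodule.Quotient.mk a)
    (hv : AdicCompletion.eval (idealP p) M k v = Submodule.Quotient.mk b)
    (hw : AdicCompletion.eval (idealP p) M k w = Submodule.Quotient.mk c) (i : ℕ) :
    AdicCompletion.eval (idealP p) M k (jacobiRight (completedY Y) r s t u v w i) =
      Submodule.mkQ _ (jacobiRight Y r s t a b c i) := by
  rw [jacobiRight, map_zsmul, map_sub, map_zsmul,
    eval_completedY _ hu (eval_completedY _ hv hw),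
    eval_completedY _ hv (eval_completedY _ hu hw), jacobiRight, map_zsmul, map_sub, map_zsmul]
  rfl

theorem IsVertexAlgebra.exists_jacobi_bound {R V : Type*} [CommRing R] [AddCommGroup V]
    [Module R V] {Y : ModeMap R V} {vac : V} (h : IsVertexAlgebra Y vac) (r s t : ℤ)
    (u v w : V) : ∃ n : ℕ, ∀ i, n ≤ i →
      jacobiLeft Y r s t u v w i = 0 ∧ jacobiRight Y r s t u v w i = 0 := by
  obtain ⟨n₁, h₁⟩ := h.truncation u v
  obtain ⟨n₂, h₂⟩ := h.truncation v w
  obtain ⟨n₃, h₃⟩ := h.truncation u w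
  refine ⟨(max (n₁ - t) (max (n₂ - s) (n₃ - r)) + 1).toNat, fun i hi => ⟨?_, ?_⟩⟩
  · rw [jacobiLeft, h₁ _ (by omega), map_zero, LinearMap.zero_apply, smul_zero]
  · rw [jacobiRight, h₂ _ (by omega), h₃ _ (by omega), map_zero, map_zero, smul_zero, sub_zero,
      smul_zero]

/-- Modulo p^k the three vectors have representatives in `M`, for which the sums are finite and the
algebraic identity holds. The number of terms needed grows with k, which is why only limits agree.
-/
theorem IsVertexAlgebra.eventually_eval_jacobi {vac : M} (h : IsVertexAlgebra Y vac) (r s t : ℤ)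
    (u v w : AdicCompletion (idealP p) M) (k : ℕ) : ∀ᶠ n : ℕ in Filter.atTop,
      AdicCompletion.eval (idealP p) M k (jacobiLeft (completedY Y) r s t u v w n) = 0 ∧
      AdicCompletion.eval (idealP p) M k (jacobiRight (completedY Y) r s t u v w n) = 0 ∧
      AdicCompletion.eval (idealP p) M k (∑ i ∈ Finset.range n,
        (jacobiRight (completedY Y) r s t u v w i -
          jacobiLeft (completedY Y) r s t u v w i)) = 0 := by
  obtain ⟨a, ha⟩ := exists_eval_eq_mk k u
  obtain ⟨b, hb⟩ := exists_eval_eq_mk k v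
  obtain ⟨c, hc⟩ := exists_eval_eq_mk k w
  obtain ⟨n₀, hn₀⟩ := h.exists_jacobi_bound r s t a b c
  filter_upwards [Filter.eventually_ge_atTop n₀] with n hn
  refine ⟨?_, ?_, ?_⟩
  · rw [eval_jacobiLeft r s t ha hb hc, (hn₀ n hn).1, map_zero]
  · rw [eval_jacobiRight r s t ha hb hc, (hn₀ n hn).2, map_zero]
  · simp only [map_sum, map_sub, eval_jacobiLeft r s t ha hb hc, eval_jacobiRight r s t ha hb hc]
    rw [Finset.sum_sub_distrib, ← map_sum, ← map_sum,
      ← finsum_eq_sum_range fun i hi => (hn₀ i (hn.trans hi)).1,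
      ← finsum_eq_sum_range fun i hi => (hn₀ i (hn.trans hi)).2, h.jacobi, sub_self]

theorem summable_toRationalSpan
    (htf : ∀ (t : ℤ_[p]) (x : M), t ≠ 0 → t • x = 0 → x = 0)
    {f : ℕ → AdicCompletion (idealP p) M}
    (h : ∀ k, ∀ᶠ i in Filter.atTop, AdicCompletion.eval (idealP p) M k (f i) = 0) :
    Summable fun i => toRationalSpan p (f i) := by
  have hB := isPAdicBanach_rationalSpan (N := AdicCompletion (idealP p) M)
    (adicCompletion_torsionFree htf)
  have := hB.complete
  have : IsUltrametricDist (RationalSpan p (AdicCompletion (idealP p) M)) :=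
    IsUltrametricDist.isUltrametricDist_of_forall_norm_add_le_max_norm hB.ultrametric
  have : NonarchimedeanAddGroup (RationalSpan p (AdicCompletion (idealP p) M)) := inferInstance
  refine NonarchimedeanAddGroup.summable_of_tendsto_cofinite_zero ?_
  rw [Nat.cofinite_eq_atTop]
  exact tendsto_toRationalSpan_zero h

/-- The terms tend to zero, so both series converge in a complete nonarchimedean group. The
differences of their partial sums also tend to zero, so the sums agree. -/
theorem IsVertexAlgebra.exists_hasSum_jacobi {vac : M} (h : IsVertexAlgebra Y vac)
    (htf : ∀ (t : ℤ_[p]) (x : M), t ≠ 0 → t • x = 0 → x = 0) (r s t : ℤ)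
    (u v w : AdicCompletion (idealP p) M) : ∃ S,
      HasSum (fun i => toRationalSpan p (jacobiLeft (completedY Y) r s t u v w i)) S ∧
      HasSum (fun i => toRationalSpan p (jacobiRight (completedY Y) r s t u v w i)) S := by
  obtain ⟨S, hS⟩ := summable_toRationalSpan htf fun k =>
    (h.eventually_eval_jacobi r s t u v w k).mono fun _ h => h.1
  obtain ⟨S', hS'⟩ := summable_toRationalSpan htf fun k =>
    (h.eventually_eval_jacobi r s t u v w k).mono fun _ h => h.2.1
  have h₁ := (hS'.sub hS).tendsto_sum_nat.norm
  have h₂ := (tendsto_toRationalSpan_zero fun k =>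
    (h.eventually_eval_jacobi r s t u v w k).mono fun _ h => h.2.2).norm
  simp only [map_sum, map_sub, norm_zero] at h₂
  have h₃ := (isPAdicBanach_rationalSpan (adicCompletion_torsionFree htf)).eq_zero _
    (tendsto_nhds_unique h₁ h₂)
  rw [sub_eq_zero.1 h₃] at hS'
  exact ⟨S, hS, hS'⟩

/-- The completion of a torsion-free vertex algebra is a `p`-adic vertex algebra. -/
theorem IsVertexAlgebra.isPAdicVertexAlgebra {vac : M} (h : IsVertexAlgebra Y vac)
    (htf : ∀ (t : ℤ_[p]) (x : M), t ≠ 0 → t • x = 0 → x = 0) :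
    IsPAdicVertexAlgebra (completedModes Y)
      (toRationalSpan p (AdicCompletion.of (idealP p) M vac)) where
  banach := isPAdicBanach_rationalSpan (adicCompletion_torsionFree htf)
  field := h.isPAdicField
  continuous a ε hε := ⟨ε, hε, fun b hb => (fieldNorm_completedModes_sub_le a b).trans_lt hb⟩
  vac_norm := norm_toRationalSpan_le _
  creative a := by
    obtain ⟨c, u, rfl⟩ := exists_rep a
    have hu : completedY Y (-1) u (AdicCompletion.of (idealP p) M vac) = u :=
      adicCompletion_ext fun k => by
        obtain ⟨u', hu'⟩ := exists_eval_eq_mk k u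
        rw [eval_completedY _ hu' (eval_of_eq_mk k vac), h.creative, hu']
    rw [map_smul, LinearMap.smul_apply, completedModes_toRationalSpan, hu]
  creative_nonneg a n hn := by
    obtain ⟨c, u, rfl⟩ := exists_rep a
    have hu : completedY Y n u (AdicCompletion.of (idealP p) M vac) = 0 :=
      adicCompletion_ext fun k => by
        obtain ⟨u', hu'⟩ := exists_eval_eq_mk k u
        rw [eval_completedY _ hu' (eval_of_eq_mk k vac), h.creative_nonneg _ _ hn, map_zero]
        rfl
    rw [map_smul, LinearMap.smul_apply, completedModes_toRationalSpan, hu, map_zero, smul_zero]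
  jacobi r s t x y z := by
    obtain ⟨a, u, rfl⟩ := exists_rep x
    obtain ⟨b, v, rfl⟩ := exists_rep y
    obtain ⟨c, w, rfl⟩ := exists_rep z
    obtain ⟨S, h₁, h₂⟩ := h.exists_hasSum_jacobi htf r s t u v w
    refine ⟨(a * b * c) • S, ?_, ?_⟩
    · simpa only [← jacobiLeft_completedModes] using h₁.const_smul (a * b * c)
    · simpa only [← jacobiRight_completedModes] using h₂.const_smul (a * b * c)

/-! ### The Virasoro relations on the completion -/

variable {c' : ℤ_[p]} {ω : M}

theorem IsVirasoroRep.completedY (h : IsVirasoroRep c' fun n => Y (n + 1) ω) :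
    IsVirasoroRep c' fun n => completedY Y (n + 1) (AdicCompletion.of (idealP p) M ω) := by
  intro m n x
  refine adicCompletion_ext fun k => ?_
  obtain ⟨v, hv⟩ := exists_eval_eq_mk k x
  have e : ∀ (n : ℤ) {x v}, AdicCompletion.eval (idealP p) M k x = Submodule.Quotient.mk v →
      AdicCompletion.eval (idealP p) M k
        (_root_.completedY Y n (AdicCompletion.of (idealP p) M ω) x) =
        Submodule.Quotient.mk (Y n ω v) := fun n _ _ hx => eval_completedY n (eval_of_eq_mk k ω) hx
  rw [map_add, map_add, map_smul, map_smul, e _ (e _ hv), e _ (e _ hv), e _ hv, hv, h m n v]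
  rfl

/-- The source of c = 2c', since binom(m+1, 3) = (m³ - m)/6. -/
theorem choose_three_cast (m : ℤ) :
    ((Ring.choose (m + 1) 3 : ℤ) : ℚ_[p]) = ((m ^ 3 - m : ℤ) : ℚ_[p]) / 12 * 2 := by
  have h := congrArg (Int.cast : ℤ → ℚ_[p]) (VirasoroAlgebra.six_mul_choose m)
  push_cast at h ⊢
  linear_combination h / 6

theorem isWeaklyConformal_completedModes {vac : M} (h : IsVertexAlgebra Y vac)
    (htf : ∀ (t : ℤ_[p]) (x : M), t ≠ 0 → t • x = 0 → x = 0)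
    (hL : IsVirasoroRep c' fun n => Y (n + 1) ω)
    (hT : ∀ u, IsCovariant (Y 0 ω) fun n => Y n u) :
    IsWeaklyConformal (completedModes Y) (toRationalSpan p (AdicCompletion.of (idealP p) M vac))
      (toRationalSpan p (AdicCompletion.of (idealP p) M ω)) (2 * (c' : ℚ_[p])) where
  vertexAlgebra := h.isPAdicVertexAlgebra htf
  virasoro m n := by
    refine LinearMap.ext fun x => ?_
    obtain ⟨a, u, rfl⟩ := exists_rep x
    have e : ∀ (n : ℤ) (u : AdicCompletion (idealP p) M),
        conformalMode (completedModes Y) (toRationalSpan p (AdicCompletion.of (idealP p) M ω)) n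
          (toRationalSpan p u) =
        toRationalSpan p (completedY Y (n + 1) (AdicCompletion.of (idealP p) M ω) u) :=
      fun n u => completedModes_toRationalSpan _ _ _
    rw [map_smul, map_smul]
    congr 1
    simp only [LinearMap.sub_apply, LinearMap.add_apply, Module.End.mul_apply,
      LinearMap.smul_apply, Module.End.one_apply, e]
    rw [hL.completedY m n u, map_add, map_add, toRationalSpan_smul, toRationalSpan_smul, add_assoc,
      add_sub_cancel_left]
    congr 2
    by_cases h₀ : m + n = 0
    · rw [if_pos h₀, if_pos h₀, PadicInt.coe_mul, PadicInt.coe_intCast, choose_three_cast,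
        mul_assoc]
    · rw [if_neg h₀, if_neg h₀, PadicInt.coe_zero]
  translation x y n := by
    obtain ⟨a, u, rfl⟩ := exists_rep x
    obtain ⟨b, v, rfl⟩ := exists_rep y
    have key : completedY Y 0 (AdicCompletion.of (idealP p) M ω) (completedY Y n u v) -
        completedY Y n u (completedY Y 0 (AdicCompletion.of (idealP p) M ω) v) =
        (-n : ℤ) • completedY Y (n - 1) u v := by
      refine adicCompletion_ext fun k => ?_
      obtain ⟨u', hu⟩ := exists_eval_eq_mk k u
      obtain ⟨v', hv⟩ := exists_eval_eq_mk k v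
      rw [map_sub, map_zsmul, eval_completedY _ (eval_of_eq_mk k ω) (eval_completedY _ hu hv),
        eval_completedY _ hu (eval_completedY _ (eval_of_eq_mk k ω) hv), eval_completedY _ hu hv]
      refine (map_sub (Submodule.mkQ _) _ _).symm.trans
        (Eq.trans (congrArg _ ?_) (map_zsmul (Submodule.mkQ _) _ _))
      exact LinearMap.congr_fun (hT u' n) v'
    rw [conformalMode, neg_add_cancel]
    simp only [completedModes_smul, completedModes_toRationalSpan_smul]
    rw [← smul_sub, ← map_sub, key, map_zsmul, smul_comm, Int.cast_smul_eq_zsmul]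

end CompletedModes

end

noncomputable section

/-! ## Eigenspaces of diagonal operators on completions -/

section Diagonal

variable {p : ℕ} [Fact p.Prime] {M ι : Type*} [AddCommGroup M] [Module ℤ_[p] M]

instance : IsAdicComplete (idealP p) ℤ_[p] := by
  have h : IsAdicComplete (IsLocalRing.maximalIdeal ℤ_[p]) ℤ_[p] := inferInstance
  rwa [PadicInt.maximalIdeal_eq_span_p] at h

instance {N : Type*} [AddCommGroup N] [Module ℤ_[p] N] :
    IsScalarTower ℤ_[p] ℚ_[p] (RationalSpan p N) :=
  inferInstanceAs (IsScalarTower ℤ_[p] ℚ_[p] (ℚ_[p] ⊗[ℤ_[p]] N))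

theorem Module.Basis.eq_zero_of_smul_eq_zero (b : Module.Basis ι ℤ_[p] M) (t : ℤ_[p]) (x : M)
    (ht : t ≠ 0) (hx : t • x = 0) : x = 0 := by
  refine b.ext_elem fun i => ?_
  have := congrArg (fun v => b.repr v i) hx
  simpa [ht] using this

theorem mem_pow_smul_top_of_repr (b : Module.Basis ι ℤ_[p] M) {k : ℕ} {v : M}
    (h : ∀ i, b.repr v i ∈ (idealP p ^ k • ⊤ : Submodule ℤ_[p] ℤ_[p])) :
    v ∈ (idealP p ^ k • ⊤ : Submodule ℤ_[p] M) := by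
  rw [← b.linearCombination_repr v, Finsupp.linearCombination_apply]
  refine Submodule.sum_mem _ fun i _ => ?_
  obtain ⟨y, hy⟩ := mem_idealP_pow_smul_top.1 (h i)
  exact mem_idealP_pow_smul_top.2 ⟨y • b i, by
    change b.repr v i • b i = _
    rw [hy, smul_assoc]⟩

/-- The coordinates of an element of the completion. -/
def completedCoord (b : Module.Basis ι ℤ_[p] M) (i : ι) :
    AdicCompletion (idealP p) M →ₗ[ℤ_[p]] ℤ_[p] :=
  (AdicCompletion.ofLinearEquiv (idealP p) ℤ_[p]).symm.toLinearMap ∘ₗ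
    AdicCompletion.map (idealP p) (b.coord i)

theorem completedCoord_apply (b : Module.Basis ι ℤ_[p] M) (i : ι)
    (x : AdicCompletion (idealP p) M) : completedCoord b i x =
      (AdicCompletion.ofLinearEquiv (idealP p) ℤ_[p]).symm
        (AdicCompletion.map (idealP p) (b.coord i) x) := rfl

theorem completedCoord_of (b : Module.Basis ι ℤ_[p] M) (i : ι) (v : M) :
    completedCoord b i (AdicCompletion.of (idealP p) M v) = b.repr v i := by
  rw [completedCoord_apply, AdicCompletion.map_of, AdicCompletion.ofLinearEquiv_symm_of]
  rfl

theorem completedCoord_map (b : Module.Basis ι ℤ_[p] M) (i : ι) {D : Module.End ℤ_[p] M}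
    {a : ℤ_[p]} (h : b.coord i ∘ₗ D = a • b.coord i) (x : AdicCompletion (idealP p) M) :
    completedCoord b i (AdicCompletion.map (idealP p) D x) = a * completedCoord b i x := by
  have e : AdicCompletion.map (idealP p) (b.coord i) (AdicCompletion.map (idealP p) D x) =
      a • AdicCompletion.map (idealP p) (b.coord i) x := by
    rw [AdicCompletion.map_comp_apply, h]
    refine adicCompletion_ext fun k => ?_
    obtain ⟨v, hv⟩ := exists_eval_eq_mk k x
    rw [map_smul]
    change (LinearMap.reduceModIdeal _ _) (AdicCompletion.eval (idealP p) M k x) =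
      a • (LinearMap.reduceModIdeal _ _) (AdicCompletion.eval (idealP p) M k x)
    rw [hv]
    rfl
  rw [completedCoord_apply, e, map_smul, completedCoord_apply, smul_eq_mul]

/-- At level k, a representative of x has all its coordinates divisible by p^k, so it is itself
divisible by p^k. -/
theorem completedCoord_ext (b : Module.Basis ι ℤ_[p] M) {x : AdicCompletion (idealP p) M}
    (h : ∀ i, completedCoord b i x = 0) : x = 0 := by
  refine adicCompletion_ext fun k => ?_
  obtain ⟨v, hv⟩ := exists_eval_eq_mk k x
  rw [hv, map_zero, Submodule.Quotient.mk_eq_zero]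
  refine mem_pow_smul_top_of_repr b fun i => ?_
  have h₁ := h i
  rw [completedCoord_apply, LinearEquiv.symm_apply_eq, map_zero] at h₁
  have h₂ : AdicCompletion.eval (idealP p) ℤ_[p] k
      (AdicCompletion.map (idealP p) (b.coord i) x) = 0 := by
    rw [h₁, map_zero]
  have h₃ : AdicCompletion.eval (idealP p) ℤ_[p] k
      (AdicCompletion.map (idealP p) (b.coord i) x) = Submodule.Quotient.mk (b.repr v i) := by
    change (LinearMap.reduceModIdeal _ _) (AdicCompletion.eval (idealP p) M k x) = _
    rw [hv]
    rfl
  rw [h₃, Submodule.Quotient.mk_eq_zero] at h₂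
  exact h₂

theorem of_injective_of_basis (b : Module.Basis ι ℤ_[p] M) :
    Function.Injective (AdicCompletion.of (idealP p) M) := by
  refine (injective_iff_map_eq_zero _).2 fun v hv => b.ext_elem fun i => ?_
  rw [← completedCoord_of, hv, map_zero, map_zero]
  rfl

variable {b : Module.Basis ι ℤ_[p] M} {D : Module.End ℤ_[p] M} {wt : ι → ℤ}

theorem coord_comp_diagonal (hD : ∀ i, D (b i) = (wt i : ℤ_[p]) • b i) (i : ι) :
    b.coord i ∘ₗ D = (wt i : ℤ_[p]) • b.coord i := by
  refine b.ext fun j => ?_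
  classical
  simp only [LinearMap.comp_apply, hD, map_smul, LinearMap.smul_apply, Module.Basis.coord_apply,
    Module.Basis.repr_self, Finsupp.single_apply]
  split_ifs with h
  · rw [h]
  · simp

/-- The coordinate satisfies (wt i - k)xᵢ = 0 in `ℤ_[p]`, a domain of characteristic zero. -/
theorem mem_eigenspace_of_coord (hD : ∀ i, D (b i) = (wt i : ℤ_[p]) • b i) {k : ℤ}
    {x : AdicCompletion (idealP p) M} (hx : AdicCompletion.map (idealP p) D x = (k : ℤ_[p]) • x)
    {i : ι} (hi : wt i ≠ k) : completedCoord b i x = 0 := by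
  have h := completedCoord_map b i (coord_comp_diagonal hD i) x
  rw [hx, map_smul, smul_eq_mul, ← sub_eq_zero, ← sub_mul] at h
  refine (mul_eq_zero.1 h).resolve_left fun h₀ => hi ?_
  exact_mod_cast (sub_eq_zero.1 h₀).symm

theorem of_mem_eigenspace {k : ℤ} {v : M} (hv : v ∈ Module.End.eigenspace D (k : ℤ_[p])) :
    AdicCompletion.map (idealP p) D (AdicCompletion.of (idealP p) M v) =
      (k : ℤ_[p]) • AdicCompletion.of (idealP p) M v := by
  rw [AdicCompletion.map_of, Module.End.mem_eigenspace_iff.1 hv, map_smul]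

theorem basis_mem_eigenspace (hD : ∀ i, D (b i) = (wt i : ℤ_[p]) • b i) (i : ι) :
    b i ∈ Module.End.eigenspace D (wt i : ℤ_[p]) :=
  Module.End.mem_eigenspace_iff.2 (hD i)

theorem eigenspace_completion (hD : ∀ i, D (b i) = (wt i : ℤ_[p]) • b i)
    (hfin : ∀ k, {i | wt i = k}.Finite) (k : ℤ) (x : AdicCompletion (idealP p) M) :
    AdicCompletion.map (idealP p) D x = (k : ℤ_[p]) • x ↔
      ∃ v ∈ Module.End.eigenspace D (k : ℤ_[p]), AdicCompletion.of (idealP p) M v = x := by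
  refine ⟨fun hx => ?_, fun ⟨v, hv, h⟩ => h ▸ of_mem_eigenspace hv⟩
  have hmem : ∀ i ∈ (hfin k).toFinset, b i ∈ Module.End.eigenspace D (k : ℤ_[p]) := fun i hi => by
    have h := basis_mem_eigenspace hD i
    rwa [((hfin k).mem_toFinset.1 hi : wt i = k)] at h
  -- Only the finitely many coordinates of weight k can be nonzero, so the basis expansion of x is a
  -- finite sum in `M`.
  refine ⟨∑ i ∈ (hfin k).toFinset, completedCoord b i x • b i,
    Submodule.sum_mem _ fun i hi => Submodule.smul_mem _ _ (hmem i hi), ?_⟩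
  rw [← sub_eq_zero]
  refine completedCoord_ext b fun j => ?_
  classical
  rw [map_sub, completedCoord_of, map_sum, Finsupp.finsetSum_apply]
  simp only [map_smul, Finsupp.smul_apply, Module.Basis.repr_self, Finsupp.single_apply,
    smul_eq_mul, mul_ite, mul_one, mul_zero, Finset.sum_ite_eq', Set.Finite.mem_toFinset]
  split_ifs with hj
  · exact sub_self _
  · rw [mem_eigenspace_of_coord hD hx hj, sub_self]

theorem eigenspace_le_span (hD : ∀ i, D (b i) = (wt i : ℤ_[p]) • b i) (k : ℤ) :
    Module.End.eigenspace D (k : ℤ_[p]) ≤ Submodule.span ℤ_[p] (b '' {i | wt i = k}) := by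
  intro v hv
  rw [b.mem_span_image]
  intro i hi
  by_contra h
  have h₁ := mem_eigenspace_of_coord hD (of_mem_eigenspace hv) h
  rw [completedCoord_of] at h₁
  exact (Finsupp.mem_support_iff.1 hi) h₁

theorem iSup_eigenspace_eq_top (hD : ∀ i, D (b i) = (wt i : ℤ_[p]) • b i) :
    (⨆ k : ℤ, Module.End.eigenspace D (k : ℤ_[p])) = ⊤ := by
  rw [eq_top_iff, ← b.span_eq, Submodule.span_le]
  rintro _ ⟨i, rfl⟩
  exact Submodule.mem_iSup_of_mem (wt i) (basis_mem_eigenspace hD i)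

variable {Y : ModeMap ℤ_[p] M} {ω vac : M}

theorem completedY_of_eq_map (n : ℤ) (x : AdicCompletion (idealP p) M) :
    completedY Y n (AdicCompletion.of (idealP p) M ω) x =
      AdicCompletion.map (idealP p) (Y n ω) x := by
  refine adicCompletion_ext fun k => ?_
  obtain ⟨v, hv⟩ := exists_eval_eq_mk k x
  rw [eval_completedY n (eval_of_eq_mk k ω) hv]
  change _ = (LinearMap.reduceModIdeal _ _) (AdicCompletion.eval (idealP p) M k x)
  rw [hv]
  rfl

/-- Every vector is a scalar multiple of one from the completion, and injectivity of
`toRationalSpan` brings the eigenvector equation down to it. -/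
theorem weightSpace_eq_span (hD : ∀ i, Y 1 ω (b i) = (wt i : ℤ_[p]) • b i)
    (hfin : ∀ k, {i | wt i = k}.Finite) (k : ℤ) :
    weightSpace (completedModes Y) (toRationalSpan p (AdicCompletion.of (idealP p) M ω)) k =
      Submodule.span ℚ_[p] ((toRationalSpan p ∘ₗ AdicCompletion.of (idealP p) M) ''
        Module.End.eigenspace (Y 1 ω) (k : ℤ_[p])) := by
  have e : ∀ (a : ℚ_[p]) (m : AdicCompletion (idealP p) M),
      a • toRationalSpan p m ∈ weightSpace (completedModes Y)
        (toRationalSpan p (AdicCompletion.of (idealP p) M ω)) k ↔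
      a • toRationalSpan p (AdicCompletion.map (idealP p) (Y 1 ω) m - (k : ℤ_[p]) • m) = 0 := by
    intro a m
    rw [weightSpace, Module.End.mem_eigenspace_iff, conformalMode, zero_add,
      completedModes_toRationalSpan_smul, completedY_of_eq_map, map_sub, toRationalSpan_smul,
      smul_sub, sub_eq_zero, smul_comm a, PadicInt.coe_intCast]
  refine le_antisymm (fun x hx => ?_) (Submodule.span_le.2 ?_)
  · obtain ⟨a, m, rfl⟩ := exists_rep x
    rw [e, smul_eq_zero] at hx
    rcases hx with rfl | hx
    · rw [zero_smul]
      exact Submodule.zero_mem _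
    · have h := toRationalSpan_injective (adicCompletion_torsionFree b.eq_zero_of_smul_eq_zero)
        (hx.trans (map_zero _).symm)
      obtain ⟨v, hv, rfl⟩ := (eigenspace_completion hD hfin k m).1 (sub_eq_zero.1 h)
      exact Submodule.smul_mem _ _ (Submodule.subset_span ⟨v, hv, rfl⟩)
  · rintro _ ⟨v, hv, rfl⟩
    have h := (e 1 (AdicCompletion.of (idealP p) M v)).2 (by
      rw [of_mem_eigenspace hv, sub_self, map_zero, smul_zero])
    rwa [one_smul] at h

/-- The image of `M` lies in the sum of the eigenspaces because the basis is diagonal. Every vector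
is a scalar multiple of a p-adic limit of elements of `M`. -/
theorem dense_iSup_weightSpace (hD : ∀ i, Y 1 ω (b i) = (wt i : ℤ_[p]) • b i)
    (hfin : ∀ k, {i | wt i = k}.Finite) :
    Dense ((⨆ k : ℤ, weightSpace (completedModes Y)
      (toRationalSpan p (AdicCompletion.of (idealP p) M ω)) k : Submodule ℚ_[p]
        (RationalSpan p (AdicCompletion (idealP p) M))) :
      Set (RationalSpan p (AdicCompletion (idealP p) M))) := by
  set S := ⨆ k : ℤ, weightSpace (completedModes Y)
      (toRationalSpan p (AdicCompletion.of (idealP p) M ω)) k with hS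
  have hmem : ∀ v, toRationalSpan p (AdicCompletion.of (idealP p) M v) ∈ S := fun v => by
    have h : (⊤ : Submodule ℤ_[p] M) ≤ (S.restrictScalars ℤ_[p]).comap
        (toRationalSpan p ∘ₗ AdicCompletion.of (idealP p) M) := by
      rw [← iSup_eigenspace_eq_top hD]
      refine iSup_le fun k v hv => ?_
      refine Submodule.mem_iSup_of_mem (p := fun k => weightSpace _ _ k) k ?_
      rw [weightSpace_eq_span hD hfin]
      exact Submodule.subset_span ⟨v, hv, rfl⟩
    exact h trivial
  intro x
  obtain ⟨a, m, rfl⟩ := exists_rep x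
  choose v hv using fun k => exists_eval_eq_mk k m
  have h₁ : Filter.Tendsto (fun k => toRationalSpan p (m - AdicCompletion.of (idealP p) M (v k)))
      Filter.atTop (𝓝 0) :=
    squeeze_zero_norm (fun k => norm_le_pow_of_eval_eq_zero (by
      rw [map_sub, hv, eval_of_eq_mk, sub_self])) (tendsto_inv_prime_pow (p := p))
  have h₂ := (h₁.const_sub (toRationalSpan p m)).const_smul a
  simp only [map_sub, sub_sub_cancel, sub_zero] at h₂
  exact mem_closure_of_tendsto h₂ (Filter.Eventually.of_forall fun k =>
    Submodule.smul_mem _ _ (hmem (v k)))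

theorem isPAdicVOA_completedModes {c' : ℤ_[p]} (h : IsVertexAlgebra Y vac)
    (hL : IsVirasoroRep c' fun n => Y (n + 1) ω)
    (hT : ∀ u, IsCovariant (Y 0 ω) fun n => Y n u)
    (hD : ∀ i, Y 1 ω (b i) = (wt i : ℤ_[p]) • b i)
    (hfin : ∀ k, {i | wt i = k}.Finite) {t : ℤ} (ht : ∀ i, t ≤ wt i) :
    IsPAdicVOA (completedModes Y) (toRationalSpan p (AdicCompletion.of (idealP p) M vac))
      (toRationalSpan p (AdicCompletion.of (idealP p) M ω)) (2 * (c' : ℚ_[p])) where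
  conformal :=
    { weaklyConformal := isWeaklyConformal_completedModes h b.eq_zero_of_smul_eq_zero hL hT
      finite := fun k => by
        have hle : weightSpace (completedModes Y)
            (toRationalSpan p (AdicCompletion.of (idealP p) M ω)) k ≤
            Submodule.span ℚ_[p] ((fun i => toRationalSpan p
              (AdicCompletion.of (idealP p) M (b i))) '' {i | wt i = k}) := by
          rw [weightSpace_eq_span hD hfin, Submodule.span_le]
          rintro _ ⟨v, hv, rfl⟩
          have h₁ := eigenspace_le_span hD k hv
          refine (Submodule.span_le (p := ((Submodule.span ℚ_[p] _).restrictScalars ℤ_[p]).comap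
            (toRationalSpan p ∘ₗ AdicCompletion.of (idealP p) M))).2 ?_ h₁
          rintro _ ⟨i, hi, rfl⟩
          exact Submodule.subset_span ⟨i, hi, rfl⟩
        have := FiniteDimensional.span_of_finite ℚ_[p] ((hfin k).image fun i =>
          toRationalSpan p (AdicCompletion.of (idealP p) M (b i)))
        exact Submodule.finiteDimensional_of_le hle
      bounded_below := ⟨t, fun k hk => by
        rw [weightSpace_eq_span hD hfin, Submodule.span_eq_bot]
        rintro _ ⟨v, hv, rfl⟩
        have h₁ := eigenspace_le_span hD k hv
        have he : {i | wt i = k} = ∅ := Set.eq_empty_iff_forall_notMem.2 fun i hi =>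
          ((ht i).trans_eq (show wt i = k from hi)).not_gt hk
        rw [he, Set.image_empty, Submodule.span_empty, Submodule.mem_bot] at h₁
        rw [h₁, map_zero]⟩ }
  dense := dense_iSup_weightSpace hD hfin

end Diagonal

end

theorem mainTheorem2 (p : ℕ) [Fact p.Prime] (c' : ℤ_[p]) :
    ∃ Y : ModeMap ℤ_[p] (VirV c'),
      (IsVirasoroVertexOperator c' Y ∧ ∀ Z, IsVirasoroVertexOperator c' Z → Z = Y) ∧
      IsPAdicVOA (completedModes Y) (virToBanach c' (virVac c')) (virToBanach c' (virOmega c'))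
        (2 * (c' : ℚ_[p])) ∧
      Set.range (toRationalSpan p : VirCompletion c' → VirBanach c') = {x | ‖x‖ ≤ 1} ∧
      Function.Injective (toRationalSpan p : VirCompletion c' → VirBanach c') ∧
      Function.Injective (virOf c') ∧
      (⨆ k : ℤ, virWeightSpace c' k) = ⊤ ∧
      (∀ (k : ℤ) (x : VirCompletion c'),
        completedProduct (idealP p) (Y 1) (virOf c' (virOmega c')) x = k • x ↔
          ∃ v ∈ virWeightSpace c' k, virOf c' v = x) ∧
      ∀ k : ℤ, weightSpace (completedModes Y) (virToBanach c' (virOmega c')) k =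
        Submodule.span ℚ_[p] (virToBanach c' '' virWeightSpace c' k) := by
  -- The basis is obtained before the vertex algebra: it supplies the torsion-freeness on which the
  -- existence of `Y` rests, and later the weights.
  obtain ⟨b, hb⟩ := exists_virV_basis ℚ_[p] c'
  have htf : ∀ (n : ℤ) (v : VirV c'), n ≠ 0 → n • v = 0 → v = 0 := fun n v hn hv =>
    b.eq_zero_of_smul_eq_zero (n : ℤ_[p]) v (Int.cast_ne_zero.2 hn)
      ((Int.cast_smul_eq_zsmul ℤ_[p] n v).trans hv)
  obtain ⟨Y, hY, hT⟩ := exists_isVirasoroVertexOperator c' htf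
  have hω : ∀ n, Y (n + 1) (virOmega c') = virL c' n := hY.1.omega
  have hD : Y 1 (virOmega c') = virL c' 0 := hω 0
  have hfin := finite_multiset_weight
  have hb' : ∀ m, Y 1 (virOmega c') (b m) =
      ((((m.map (· + 2)).sum : ℕ) : ℤ) : ℤ_[p]) • b m := fun m => by
    rw [hD, hb, Int.cast_natCast]
  refine ⟨Y, hY, ?_, ?_, ?_, of_injective_of_basis b, ?_, ?_, ?_⟩
  · refine isPAdicVOA_completedModes hY.1.vertexAlgebra ?_ (fun u => ?_) hb' hfin (t := 0)
      fun m => Int.natCast_nonneg _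
    · simp only [hω]
      exact virL_isVirasoroRep c'
    · have h := hω (-1)
      rw [neg_add_cancel] at h
      rw [h]
      exact hT u
  · exact Set.ext fun x => norm_le_one_iff.symm
  · exact toRationalSpan_injective (adicCompletion_torsionFree b.eq_zero_of_smul_eq_zero)
  · have h := iSup_eigenspace_eq_top hb'
    rw [hD] at h
    exact h
  · intro k x
    have h := eigenspace_completion hb' hfin k x
    rw [← completedY_of_eq_map, hD, Int.cast_smul_eq_zsmul] at h
    exact h
  · intro k
    have h := weightSpace_eq_span hb' hfin k
    rw [hD] at h
    exact h
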